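/- Let $\overline M$ be a smooth (Hausdorff, second countable) manifold of dimension $n+1\ge 2$ with boundary $\partial M$ and interior $M$, and let $g$ be a smooth pseudo-Riemannian metric on $M$ with Levi-Civita connection $\nabla$, such that the projective structure of $\nabla$ extends smoothly to $\overline M$. Let $\tilde\nabla$ be a torsion-free connection on $T\overline M$, smooth up to the boundary, in the extended projective class; that is, there is a smooth one-form $\Upsilon$ on $M$ with $\tilde\nabla_XY=\nabla_XY+\Upsilon(X)Y+\Upsilon(Y)X$ on $M$. Write $\mathcal E(w)$ for the bundle of densities of projective weight $w$, normalized so that $\mathcal E(-n-2)$ is the bundle of volume densities; adding $(w)$ to the name of a tensor bundle denotes tensor product with $\mathcal E(w)$, and round brackets around indices denote symmetric tensors. The connection $\tilde\nabla$ identifies the standard projective tractor bundle with $\mathcal T\cong\mathcal E^i(-1)\oplus\mathcal E(-1)$ and its dual with $\mathcal T^*\cong\mathcal E_i(1)\oplus\mathcal E(1)$, with pairing $\langle(\nu^i,\rho),(\mu_i,\sigma)\rangle=\nu^i\mu_i+\rho\sigma$. Put $\tau=\operatorname{vol}(g)^{-2/(n+2)}\in\Gamma(\mathcal E(2)|_M)$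 and $h^{ij}=\tau^{-1}g^{ij}$, a section of $\mathcal E^{(ij)}(-2)$ over $M$. The tractor lift $L(\tau^{-1}g^{ij})\in\Gamma(S^2\mathcal T)$ is, in this splitting and over $M$, the symmetric form $$\begin{pmatrix}h^{ij}&\lambda^i\\ \lambda^j&\nu\end{pmatrix},\qquad \lambda^j=-\tfrac1{n+2}\tilde\nabla_ih^{ij},\qquad \nu=\tfrac1{(n+1)(n+2)}\tilde\nabla_i\tilde\nabla_jh^{ij}+\tfrac1{n+1}\tilde{\mathsf P}_{ij}h^{ij},$$ where $\tilde{\mathsf P}_{ij}=\frac{(n+1)\widetilde{\mathrm{Ric}}_{ij}+\widetilde{\mathrm{Ric}}_{ji}}{n(n+2)}$ is the projective Schouten tensor of $\tilde\nabla$; over $\overline M$, $L(\tau^{-1}g^{ij})$ denotes the extension of this section by continuity. Assume that $L(\tau^{-1}g^{ij})$ is non-degenerate as a bilinear form on $\mathcal T^*$ over all of $\overline M$, and let $\Phi$ be its pointwise inverse, a section of $S^2\mathcal T^*$, written in the splitting of $\tilde\nabla$ as $$\Phi=\begin{pmatrix}\psi_{ij}&\mu_i\\ \mu_j&\sigma\end{pmatrix}.$$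 Then $\sigma\in\Gamma(\mathcal E(2))$, $\mu_i\in\Gamma(\mathcal E_i(2))$ and $\psi_{ij}\in\Gamma(\mathcal E_{(ij)}(2))$ are smooth on $\overline M$, and there are smooth sections $\xi_i^j\in\Gamma(\mathcal E_i^j(-2))$ and $\eta_i\in\Gamma(\mathcal E_i(-2))$ over $\overline M$ such that, on all of $\overline M$, $$\tilde\nabla_i\sigma=2\mu_i-2\sigma\mu_j\xi_i^j-\sigma^2\eta_i .$$ -/

import Mathlib

open Bundle Manifold Topology
open scoped ContDiff

noncomputable section

/-! ### Affine connections and pseudo-Riemannian metrics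

`Mbar` is always a smooth manifold with boundary of dimension `n + 1`. Connections on the tangent
bundle are written as in Mathlib: `nabla Y x v` is the value of `∇_v Y` at `x`. -/

section Geometry

variable {n : ℕ} {Mbar : Type*} [TopologicalSpace Mbar]
  [ChartedSpace (EuclideanHalfSpace (n + 1)) Mbar]

/-- The differential operators `Y ↦ ∇ Y` from vector fields to endomorphism fields. -/
abbrev AffineOperator (n : ℕ) (Mbar : Type*) [TopologicalSpace Mbar]
    [ChartedSpace (EuclideanHalfSpace (n + 1)) Mbar] : Type _ :=
  (Π x : Mbar, TangentSpace (𝓡∂ (n + 1)) x) →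
    (Π x : Mbar, TangentSpace (𝓡∂ (n + 1)) x →L[ℝ] TangentSpace (𝓡∂ (n + 1)) x)

/-- Differentiability of a vector field at a point. -/
abbrev FieldDifferentiableAt [IsManifold (𝓡∂ (n + 1)) ∞ Mbar]
    (X : Π y : Mbar, TangentSpace (𝓡∂ (n + 1)) y) (x : Mbar) : Prop :=
  MDifferentiableAt (𝓡∂ (n + 1))
    ((𝓡∂ (n + 1)).prod 𝓘(ℝ, EuclideanSpace ℝ (Fin (n + 1))))
    (fun y ↦ TotalSpace.mk' (EuclideanSpace ℝ (Fin (n + 1)))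
      (E := (TangentSpace (𝓡∂ (n + 1)) : Mbar → Type _)) y (X y)) x

/-- `∇_X Y - ∇_Y X = [X, Y]` on `s`. -/
def IsTorsionFreeOn [IsManifold (𝓡∂ (n + 1)) ∞ Mbar] (nabla : AffineOperator n Mbar) (s : Set Mbar) : Prop :=
  ∀ x ∈ s, ∀ X Y : Π y : Mbar, TangentSpace (𝓡∂ (n + 1)) y,
    FieldDifferentiableAt X x → FieldDifferentiableAt Y x →
      nabla Y x (X x) - nabla X x (Y x) = VectorField.mlieBracket (𝓡∂ (n + 1)) X Y x

/-- Projective equivalence on `s`: there is a smooth one-form `Υ` on `s` with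
`∇'_X Y = ∇_X Y + Υ(X) Y + Υ(Y) X`. -/
def ProjectivelyEquivalentOn [IsManifold (𝓡∂ (n + 1)) ∞ Mbar]
    (nabla nabla' : AffineOperator n Mbar) (s : Set Mbar) : Prop :=
  ∃ Υ : Π x : Mbar, TangentSpace (𝓡∂ (n + 1)) x →L[ℝ] ℝ,
    ContMDiffOn (𝓡∂ (n + 1))
      ((𝓡∂ (n + 1)).prod 𝓘(ℝ, EuclideanSpace ℝ (Fin (n + 1)) →L[ℝ] ℝ)) ∞
      (fun x ↦ TotalSpace.mk' (EuclideanSpace ℝ (Fin (n + 1)) →L[ℝ] ℝ)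
        (E := fun x : Mbar ↦ TangentSpace (𝓡∂ (n + 1)) x →L[ℝ] ℝ) x (Υ x)) s ∧
    ∀ x ∈ s, ∀ Y : Π y : Mbar, TangentSpace (𝓡∂ (n + 1)) y, FieldDifferentiableAt Y x →
      ∀ v : TangentSpace (𝓡∂ (n + 1)) x,
        nabla' Y x v = nabla Y x v + Υ x v • Y x + Υ x (Y x) • v

/-- A smooth pseudo-Riemannian metric on the part `s` of `Mbar` (of any signature); the values
outside of `s` are irrelevant. -/
structure PseudoRiemannianMetricOn [IsManifold (𝓡∂ (n + 1)) ∞ Mbar] (s : Set Mbar) where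
  /-- The bilinear form `g` on each tangent space. -/
  toFun : Π x : Mbar, TangentSpace (𝓡∂ (n + 1)) x →L[ℝ] TangentSpace (𝓡∂ (n + 1)) x →L[ℝ] ℝ
  symm : ∀ x ∈ s, ∀ v w, toFun x v w = toFun x w v
  nondegenerate : ∀ x ∈ s, ∀ v, (∀ w, toFun x v w = 0) → v = 0
  contMDiffOn : ContMDiffOn (𝓡∂ (n + 1))
      ((𝓡∂ (n + 1)).prod 𝓘(ℝ, EuclideanSpace ℝ (Fin (n + 1)) →L[ℝ]
        EuclideanSpace ℝ (Fin (n + 1)) →L[ℝ] ℝ)) ∞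
      (fun x ↦ TotalSpace.mk' (EuclideanSpace ℝ (Fin (n + 1)) →L[ℝ]
          EuclideanSpace ℝ (Fin (n + 1)) →L[ℝ] ℝ)
        (E := fun x : Mbar ↦ TangentSpace (𝓡∂ (n + 1)) x →L[ℝ]
          TangentSpace (𝓡∂ (n + 1)) x →L[ℝ] ℝ) x (toFun x)) s

/-- `nabla` is the Levi-Civita connection of `g` on `s`. -/
structure IsLeviCivitaOn [IsManifold (𝓡∂ (n + 1)) ∞ Mbar] {s : Set Mbar}
    (g : PseudoRiemannianMetricOn (n := n) s) (nabla : AffineOperator n Mbar) : Prop where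
  isCovariantDerivativeOn : IsCovariantDerivativeOn (EuclideanSpace ℝ (Fin (n + 1))) nabla s
  torsionFree : IsTorsionFreeOn nabla s
  metric : ∀ x ∈ s, ∀ X Y : Π y : Mbar, TangentSpace (𝓡∂ (n + 1)) y,
    FieldDifferentiableAt X x → FieldDifferentiableAt Y x → ∀ v : TangentSpace (𝓡∂ (n + 1)) x,
      mvfderiv (𝓡∂ (n + 1)) (fun y ↦ g.toFun y (X y) (Y y)) x v =
        g.toFun x (nabla X x v) (Y x) + g.toFun x (X x) (nabla Y x v)

/-! ### Coordinate frames and weighted tensor fields -/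

/-- The coordinate vector field `∂_i` of the preferred chart around `p`; it is a frame field over
the domain of that chart. -/
def coordField [IsManifold (𝓡∂ (n + 1)) ∞ Mbar] (p : Mbar) (i : Fin (n + 1)) :
    Π x : Mbar, TangentSpace (𝓡∂ (n + 1)) x :=
  (trivializationAt (EuclideanSpace ℝ (Fin (n + 1)))
    (TangentSpace (𝓡∂ (n + 1)) : Mbar → Type _) p).localFrame
      (EuclideanSpace.basisFun (Fin (n + 1)) ℝ).toBasis i

/-- The coordinate frame at `x` of the preferred chart around `p`. -/
def coordFrame [IsManifold (𝓡∂ (n + 1)) ∞ Mbar] (p x : Mbar) :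
    Fin (n + 1) → TangentSpace (𝓡∂ (n + 1)) x :=
  fun i ↦ coordField p i x

/-- The `i`-th component of a tangent vector at `x` in the coordinate frame around `p`. -/
def coordComponent [IsManifold (𝓡∂ (n + 1)) ∞ Mbar] (p x : Mbar)
    (v : TangentSpace (𝓡∂ (n + 1)) x) (i : Fin (n + 1)) : ℝ :=
  (trivializationAt (EuclideanSpace ℝ (Fin (n + 1)))
    (TangentSpace (𝓡∂ (n + 1)) : Mbar → Type _) p).continuousLinearMapAt ℝ x v i

variable (n Mbar) in
/-- Sections of the bundle `E^{i₁…i_a}_{j₁…j_b}(w)`, as equivariant functions on frames: to each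
frame `v` of `T_x Mbar` the section assigns its components, and for the frame `v A` with
`A ∈ GL(n+1, ℝ)` these change by the usual tensorial rule, multiplied by `|det A|^{-w/(n+2)}`.
For `w = -(n+2)` and `a = b = 0` these are the volume densities of an `(n+1)`-manifold, and
`E(w)` is the power of exponent `-w/(n+2)` of the bundle of volume densities. -/
structure WeightedTensorField (w : ℝ) (a b : ℕ) where
  /-- The components with respect to a frame. -/
  toFun : Π x : Mbar, (Fin (n + 1) → TangentSpace (𝓡∂ (n + 1)) x) →
    (Fin a → Fin (n + 1)) → (Fin b → Fin (n + 1)) → ℝ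
  equivariant : ∀ x v, LinearIndependent ℝ v →
    ∀ A : Matrix (Fin (n + 1)) (Fin (n + 1)) ℝ, A.det ≠ 0 → ∀ K L,
      toFun x (fun j ↦ ∑ i, A i j • v i) K L =
        |A.det| ^ (-w / ((n : ℝ) + 2)) *
          ∑ K' : Fin a → Fin (n + 1), ∑ L' : Fin b → Fin (n + 1),
            (∏ r, A⁻¹ (K r) (K' r)) * (∏ s, A (L' s) (L s)) * toFun x v K' L'

/-- The components of a weighted tensor field in the coordinate frame around `p`. -/
def WeightedTensorField.inChart [IsManifold (𝓡∂ (n + 1)) ∞ Mbar] {w : ℝ} {a b : ℕ}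
    (T : WeightedTensorField n Mbar w a b) (p : Mbar) :
    Mbar → (Fin a → Fin (n + 1)) → (Fin b → Fin (n + 1)) → ℝ :=
  fun x ↦ T.toFun x (coordFrame p x)

/-- Smoothness (up to the boundary) of a weighted tensor field. -/
def WeightedTensorField.IsSmooth [IsManifold (𝓡∂ (n + 1)) ∞ Mbar] {w : ℝ} {a b : ℕ}
    (T : WeightedTensorField n Mbar w a b) : Prop :=
  ∀ (p : Mbar) (K : Fin a → Fin (n + 1)) (L : Fin b → Fin (n + 1)),
    ContMDiffOn (𝓡∂ (n + 1)) 𝓘(ℝ, ℝ) ∞ (fun x ↦ T.inChart p x K L)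
      (chartAt (EuclideanHalfSpace (n + 1)) p).source

/-! ### Covariant derivatives and curvature in coordinates -/

/-- The partial derivative `∂_k f` at `x`, for the preferred chart around `p`. -/
def coordDeriv [IsManifold (𝓡∂ (n + 1)) ∞ Mbar] (p : Mbar) (f : Mbar → ℝ) (x : Mbar)
    (k : Fin (n + 1)) : ℝ :=
  mvfderiv (𝓡∂ (n + 1)) f x (coordField p k x)

/-- The connection coefficients: `∇_{∂_k} ∂_j = ∑ l, Γ^l_{kj} ∂_l`, where
`Γ^l_{kj} = christoffel nabla p x l k j`. -/
def christoffel [IsManifold (𝓡∂ (n + 1)) ∞ Mbar] (nabla : AffineOperator n Mbar) (p x : Mbar)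
    (l k j : Fin (n + 1)) : ℝ :=
  coordComponent p x (nabla (coordField p j) x (coordField p k x)) l

/-- The components `(∇_k T)^K_L` at `x`, in the preferred chart around `p`, of the covariant
derivative of a section of weight `w` with component functions `T` in that chart. Since volume
densities have weight `-(n+2)`, a weight `w` contributes the term `w/(n+2) Γ^l_{kl} T`. -/
def covDeriv [IsManifold (𝓡∂ (n + 1)) ∞ Mbar] (nabla : AffineOperator n Mbar) (p : Mbar)
    (w : ℝ) {a b : ℕ} (T : Mbar → (Fin a → Fin (n + 1)) → (Fin b → Fin (n + 1)) → ℝ)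
    (x : Mbar) (k : Fin (n + 1)) (K : Fin a → Fin (n + 1)) (L : Fin b → Fin (n + 1)) : ℝ :=
  coordDeriv p (fun y ↦ T y K L) x k
    + ∑ r : Fin a, ∑ l, christoffel nabla p x (K r) k l * T x (Function.update K r l) L
    - ∑ s : Fin b, ∑ l, christoffel nabla p x l k (L s) * T x K (Function.update L s l)
    + w / ((n : ℝ) + 2) * (∑ l, christoffel nabla p x l k l) * T x K L

/-- The Riemann tensor `R_{ij}{}^k{}_l`, where
`(∇_i ∇_j - ∇_j ∇_i) V^k = R_{ij}{}^k{}_l V^l` for torsion-free `∇`. -/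
def riemannTensor [IsManifold (𝓡∂ (n + 1)) ∞ Mbar] (nabla : AffineOperator n Mbar)
    (p x : Mbar) (i j k l : Fin (n + 1)) : ℝ :=
  coordDeriv p (fun y ↦ christoffel nabla p y k j l) x i
    - coordDeriv p (fun y ↦ christoffel nabla p y k i l) x j
    + ∑ m, (christoffel nabla p x k i m * christoffel nabla p x m j l
      - christoffel nabla p x k j m * christoffel nabla p x m i l)

/-- The Ricci tensor `Ric_{ij} = R_{ki}{}^k{}_j`. -/
def ricciTensor [IsManifold (𝓡∂ (n + 1)) ∞ Mbar] (nabla : AffineOperator n Mbar)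
    (p x : Mbar) (i j : Fin (n + 1)) : ℝ :=
  ∑ k, riemannTensor nabla p x k i k j

/-- The projective Schouten tensor of a torsion-free connection in dimension `n + 1`,
`P_{ij} = ((n+1) Ric_{ij} + Ric_{ji}) / (n (n+2))`, which is `Ric_{ij} / n` if `Ric` is
symmetric. -/
def schoutenTensor [IsManifold (𝓡∂ (n + 1)) ∞ Mbar] (nabla : AffineOperator n Mbar)
    (p x : Mbar) (i j : Fin (n + 1)) : ℝ :=
  (((n : ℝ) + 1) * ricciTensor nabla p x i j + ricciTensor nabla p x j i) /
    ((n : ℝ) * ((n : ℝ) + 2))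

/-! ### The solution of the metricity equation and its tractor lift -/

/-- The Gram matrix `g(v_i, v_j)` of the metric in a frame. -/
def PseudoRiemannianMetricOn.gram [IsManifold (𝓡∂ (n + 1)) ∞ Mbar] {s : Set Mbar}
    (g : PseudoRiemannianMetricOn (n := n) s) (x : Mbar)
    (v : Fin (n + 1) → TangentSpace (𝓡∂ (n + 1)) x) : Matrix (Fin (n + 1)) (Fin (n + 1)) ℝ :=
  Matrix.of fun i j ↦ g.toFun x (v i) (v j)

/-- The volume density `vol(g)`, evaluated on a frame. -/
def PseudoRiemannianMetricOn.vol [IsManifold (𝓡∂ (n + 1)) ∞ Mbar] {s : Set Mbar}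
    (g : PseudoRiemannianMetricOn (n := n) s) (x : Mbar)
    (v : Fin (n + 1) → TangentSpace (𝓡∂ (n + 1)) x) : ℝ :=
  Real.sqrt |(g.gram x v).det|

/-- `τ = vol(g)^{-2/(n+2)}`, a density of weight `2`, evaluated on a frame. -/
def PseudoRiemannianMetricOn.tau [IsManifold (𝓡∂ (n + 1)) ∞ Mbar] {s : Set Mbar}
    (g : PseudoRiemannianMetricOn (n := n) s) (x : Mbar)
    (v : Fin (n + 1) → TangentSpace (𝓡∂ (n + 1)) x) : ℝ :=
  g.vol x v ^ (-(2 : ℝ) / ((n : ℝ) + 2))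

/-- The components of `τ⁻¹ g^{ij}` (weight `-2`) in the preferred chart around `p`. -/
def PseudoRiemannianMetricOn.tauInvMetric [IsManifold (𝓡∂ (n + 1)) ∞ Mbar] {s : Set Mbar}
    (g : PseudoRiemannianMetricOn (n := n) s) (p : Mbar) :
    Mbar → (Fin 2 → Fin (n + 1)) → (Fin 0 → Fin (n + 1)) → ℝ :=
  fun x K _ ↦ (g.tau x (coordFrame p x))⁻¹ * (g.gram x (coordFrame p x))⁻¹ (K 0) (K 1)

/-- The middle slot of `L(h)` in the splitting of `nabla`: `λ^j = -1/(n+2) ∇_i h^{ij}`, where `h`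
has weight `-2`. -/
def liftMiddle [IsManifold (𝓡∂ (n + 1)) ∞ Mbar] (nabla : AffineOperator n Mbar) (p : Mbar)
    (h : Mbar → (Fin 2 → Fin (n + 1)) → (Fin 0 → Fin (n + 1)) → ℝ) :
    Mbar → (Fin 1 → Fin (n + 1)) → (Fin 0 → Fin (n + 1)) → ℝ :=
  fun x K L ↦ -(1 / ((n : ℝ) + 2)) * ∑ i, covDeriv nabla p (-2) h x i ![i, K 0] L

/-- The bottom slot of `L(h)` in the splitting of `nabla`:
`ν = 1/((n+1)(n+2)) ∇_i ∇_j h^{ij} + 1/(n+1) P_{ij} h^{ij} = 1/(n+1) (P_{ij} h^{ij} - ∇_i λ^i)`. -/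
def liftBottom [IsManifold (𝓡∂ (n + 1)) ∞ Mbar] (nabla : AffineOperator n Mbar) (p : Mbar)
    (h : Mbar → (Fin 2 → Fin (n + 1)) → (Fin 0 → Fin (n + 1)) → ℝ) : Mbar → ℝ :=
  fun x ↦ 1 / ((n : ℝ) + 1) *
    ((∑ i, ∑ j, schoutenTensor nabla p x i j * h x ![i, j] ![])
      - ∑ i, covDeriv nabla p (-2) (liftMiddle nabla p h) x i ![i] ![])

/-- The symmetric block matrix of a bilinear form on (co)tractors. In the splitting of a connection
and a coordinate frame, `T = E^i(-1) ⊕ E(-1)` and `T^* = E_i(1) ⊕ E(1)`, with the duality pairing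
`⟨(ν^i, ρ), (μ_i, σ)⟩ = ν^i μ_i + ρ σ`. A section of `S²T` with slots `(h^{ij}, λ^i, ν)` and a
section of `S²T^*` with slots `(σ, μ_i, ψ_{ij})` have the matrices
`tractorMatrix h λ ν` and `tractorMatrix ψ μ σ`. -/
def tractorMatrix {n : ℕ} (block : Fin (n + 1) → Fin (n + 1) → ℝ) (mixed : Fin (n + 1) → ℝ)
    (corner : ℝ) : Matrix (Fin (n + 1) ⊕ Unit) (Fin (n + 1) ⊕ Unit) ℝ :=
  Matrix.fromBlocks (Matrix.of block) (Matrix.of fun i _ ↦ mixed i)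
    (Matrix.of fun _ j ↦ mixed j) (Matrix.of fun _ _ ↦ corner)

/-- The matrix of `L(τ⁻¹ g^{ij})` at a point of the interior, in the splitting of `nabla` and the
preferred chart around `p`. -/
def PseudoRiemannianMetricOn.liftMatrix [IsManifold (𝓡∂ (n + 1)) ∞ Mbar] {s : Set Mbar}
    (g : PseudoRiemannianMetricOn (n := n) s) (nabla : AffineOperator n Mbar) (p x : Mbar) :
    Matrix (Fin (n + 1) ⊕ Unit) (Fin (n + 1) ⊕ Unit) ℝ :=
  tractorMatrix (fun i j ↦ g.tauInvMetric p x ![i, j] ![])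
    (fun i ↦ liftMiddle nabla p (g.tauInvMetric p) x ![i] ![])
    (liftBottom nabla p (g.tauInvMetric p) x)

/-- The matrix of `L(τ⁻¹ g^{ij})` at an arbitrary point of `Mbar`, namely of the extension by
continuity of the section `L(τ⁻¹ g^{ij})` given over the interior. -/
def PseudoRiemannianMetricOn.extendedLiftMatrix [IsManifold (𝓡∂ (n + 1)) ∞ Mbar] {s : Set Mbar}
    (g : PseudoRiemannianMetricOn (n := n) s) (nabla : AffineOperator n Mbar) (p x : Mbar) :
    Matrix (Fin (n + 1) ⊕ Unit) (Fin (n + 1) ⊕ Unit) ℝ :=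
  extendFrom s (fun y ↦ g.liftMatrix nabla p y) x

end Geometry

end

/-!
The inverse metric `h = τ⁻¹ g⁻¹` solves the metricity equation: in terms of any connection in the
projective class, the trace-free part of `∇_k h^{ij}` vanishes, that is
`∇_k h^{ij} = -δ_k^i λ^j - δ_k^j λ^i` (`coordDeriv_tauInvMetric_of_projectivelyEquivalentOn`). For
`∇~` the connection coefficients are smooth up to the boundary. Commuting second derivatives
expresses all derivatives of `h`, `λ` and `∂_i λ^i` linearly through these functions, with
coefficients smooth up to the boundary (`partialDeriv_prolongation_mem`). A solution of such a
closed linear system over the interior is bounded and Lipschitz near each boundary point by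
Grönwall's inequality, so it extends continuously, and then smoothly, to the boundary
(`exists_contDiffOn_extension_of_linear_hasFDerivAt`). Hence the lift `L(h)` with slots
`(h, λ, ν)` extends smoothly, and its pointwise inverse with slots `(ψ, μ, σ)` is smooth.

The inverse satisfies `h^{ij} μ_j + σ λ^i = 0` and `μ_i λ^i + σ ν = 1`. With `r = (μ, σ)`,
`∂_k σ = -(r ∂_k L(h) rᵀ)`; inserting the metricity equation and these two identities gives
`∇_k σ = 2 μ_k - σ κ_k`, where `κ` is an explicit polynomial in smooth quantities
(`coordDeriv_add_eq_errorForm`). In the interior `σ` has no zeros, and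
`κ = 2 μ / σ - d(σ/τ) / (σ/τ) - 2 Υ` is a one-form; by density of the interior the smooth
components `κ_k` transform like those of a one-form up to the boundary
(`errorForm_transition`, `oneFormOfComponents_coordField`). Finally
`ξ_i^j = κ_i λ^j / 2` and `η_i = κ_i ν` satisfy
`2 σ μ_j ξ_i^j + σ² η_i = σ κ_i (μ_j λ^j + σ ν) = σ κ_i`.
-/

section

open Filter Set Metric

/-! ### Linear total differential equations up to the boundary -/

section ParallelExtension

variable {E F : Type*} [NormedAddCommGroup E] [NormedSpace ℝ E]
  [NormedAddCommGroup F] [NormedSpace ℝ F]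

/-- Grönwall's inequality along segments: a solution of a linear total differential equation with
bounded coefficients on a bounded convex set is bounded. -/
theorem norm_bounded_of_linear_hasFDerivAt {W : Set E} (hW : Convex ℝ W) {x : E} {r : ℝ}
    (hWr : W ⊆ ball x r) {A : E → F →L[ℝ] E →L[ℝ] F} {K : ℝ} (hK : ∀ u ∈ W, ‖A u‖ ≤ K)
    {f : E → F} (hf : ∀ u ∈ W, HasFDerivAt f (A u (f u)) u) :
    ∃ B, ∀ u ∈ W, ‖f u‖ ≤ B := by
  rcases W.eq_empty_or_nonempty with rfl | ⟨y₀, hy₀⟩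
  · exact ⟨0, by simp⟩
  have hK0 : 0 ≤ K := (A y₀).opNorm_nonneg.trans (hK y₀ hy₀)
  refine ⟨‖f y₀‖ * Real.exp (K * (2 * r)), fun y hy ↦ ?_⟩
  set g : ℝ → E := fun t ↦ y₀ + t • (y - y₀) with hg
  have hgW : ∀ t ∈ Icc (0 : ℝ) 1, g t ∈ W := fun t ht ↦ hW.add_smul_sub_mem hy₀ hy ht
  have hgd : ∀ t, HasDerivAt g (y - y₀) t := fun t ↦ by
    simpa [hg] using ((hasDerivAt_id t).smul_const (y - y₀)).const_add y₀
  have hfd : ∀ t ∈ Icc (0 : ℝ) 1, HasDerivAt (fun t ↦ f (g t)) (A (g t) (f (g t)) (y - y₀)) t :=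
    fun t ht ↦ (hf _ (hgW t ht)).comp_hasDerivAt t (hgd t)
  have hyy : ‖y - y₀‖ ≤ 2 * r := by
    have h1 := hWr hy
    have h2 := hWr hy₀
    rw [mem_ball] at h1 h2
    rw [← dist_eq_norm]
    linarith [dist_triangle_right y y₀ x]
  have key := norm_le_gronwallBound_of_norm_deriv_right_le (f := fun t ↦ f (g t))
    (f' := fun t ↦ A (g t) (f (g t)) (y - y₀)) (δ := ‖f y₀‖) (K := K * (2 * r)) (ε := 0)
    (a := 0) (b := 1) (fun t ht ↦ (hfd t ht).continuousAt.continuousWithinAt)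
    (fun t ht ↦ (hfd t (Ico_subset_Icc_self ht)).hasDerivWithinAt) (by simp [hg])
    (fun t ht ↦ by
      have h1 := hK _ (hgW t (Ico_subset_Icc_self ht))
      calc ‖A (g t) (f (g t)) (y - y₀)‖ ≤ ‖A (g t)‖ * ‖f (g t)‖ * ‖y - y₀‖ :=
            (A (g t)).le_opNorm₂ _ _
        _ ≤ K * ‖f (g t)‖ * (2 * r) := by gcongr
        _ = K * (2 * r) * ‖f (g t)‖ + 0 := by ring) 1 (by simp)
  simpa [gronwallBound_ε0, hg] using key

/-- A Lipschitz map into a complete space has a limit at each point of the closure of its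
domain. -/
theorem LipschitzOnWith.exists_tendsto_nhdsWithin {X Y : Type*} [PseudoMetricSpace X]
    [PseudoMetricSpace Y] [CompleteSpace Y] {W : Set X} {f : X → Y} {K : NNReal}
    (hf : LipschitzOnWith K f W) {x : X} (hx : x ∈ closure W) :
    ∃ y, Tendsto f (𝓝[W] x) (𝓝 y) := by
  have : (𝓝[W] x).NeBot := mem_closure_iff_nhdsWithin_neBot.1 hx
  have hc : Cauchy (map f (𝓝[W] x)) := by
    rw [cauchy_map_iff]
    refine ⟨this, hf.uniformContinuousOn.mono_left (le_inf ?_ ?_)⟩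
    · exact (cauchy_nhds.mono' this inf_le_left).2
    · rw [← prod_principal_principal]
      exact prod_mono inf_le_right inf_le_right
  exact cauchy_iff_exists_le_nhds.1 hc

variable {C V : Set E} {A : E → F →L[ℝ] E →L[ℝ] F} {f : E → F}

/-- Every point of a relatively open subset of a convex set `C` has a convex neighbourhood on
which a solution of a linear total differential equation given on the interior of `C` is
Lipschitz. -/
theorem exists_ball_lipschitzOnWith_of_linear_hasFDerivAt (hC : Convex ℝ C) (hV : IsOpen V)
    (hA : ContinuousOn A (C ∩ V)) (hf : ∀ u ∈ interior C ∩ V, HasFDerivAt f (A u (f u)) u)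
    {x : E} (hx : x ∈ C ∩ V) :
    ∃ r > 0, ball x r ⊆ V ∧ ∃ K, LipschitzOnWith K f (interior C ∩ ball x r) := by
  obtain ⟨r₁, hr₁, hr₁V⟩ := Metric.isOpen_iff.1 hV x hx.2
  have hnorm := ContinuousWithinAt.norm (f := A) (hA x hx)
  have hb : ∀ᶠ u in 𝓝[C ∩ V] x, ‖A u‖ < ‖A x‖ + 1 :=
    hnorm.eventually (gt_mem_nhds (lt_add_one _))
  obtain ⟨r₂, hr₂, hr₂A⟩ := Metric.mem_nhdsWithin_iff.1 hb
  set r := min r₁ r₂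
  have hWV : ball x r ⊆ V := (ball_subset_ball (min_le_left _ _)).trans hr₁V
  have hWconv : Convex ℝ (interior C ∩ ball x r) := hC.interior.inter (convex_ball x r)
  have hfW : ∀ u ∈ interior C ∩ ball x r, HasFDerivAt f (A u (f u)) u :=
    fun u hu ↦ hf u ⟨hu.1, hWV hu.2⟩
  have hAW : ∀ u ∈ interior C ∩ ball x r, ‖A u‖ ≤ ‖A x‖ + 1 := fun u hu ↦
    (hr₂A ⟨ball_subset_ball (min_le_right _ _) hu.2, interior_subset hu.1, hWV hu.2⟩ :
      ‖A u‖ < _).le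
  obtain ⟨B, hB⟩ := norm_bounded_of_linear_hasFDerivAt hWconv inter_subset_right hAW hfW
  refine ⟨r, lt_min hr₁ hr₂, hWV, ((‖A x‖ + 1) * B).toNNReal, ?_⟩
  refine hWconv.lipschitzOnWith_of_nnnorm_hasFDerivWithin_le
    (fun u hu ↦ (hfW u hu).hasFDerivWithinAt) fun u hu ↦ ?_
  rw [← NNReal.coe_le_coe, coe_nnnorm]
  refine le_trans ?_ (Real.le_coe_toNNReal _)
  calc ‖A u (f u)‖ ≤ ‖A u‖ * ‖f u‖ := (A u).le_opNorm _
    _ ≤ (‖A x‖ + 1) * B := by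
      gcongr
      exacts [hAW u hu, hB u hu]

/-- Solutions over the interior of a linear total differential equation with coefficients smooth
up to the boundary extend smoothly to the boundary: they are Lipschitz near each boundary point,
hence extend continuously, and the equation passes to the limit. -/
theorem exists_contDiffOn_extension_of_linear_hasFDerivAt [CompleteSpace F] (hC : Convex ℝ C)
    (hCc : IsClosed C) (hCi : (interior C).Nonempty) (hV : IsOpen V) (hA : ContDiffOn ℝ ∞ A (C ∩ V))
    (hf : ∀ u ∈ interior C ∩ V, HasFDerivAt f (A u (f u)) u) :
    ∃ G : E → F, ContDiffOn ℝ ∞ G (C ∩ V) ∧ EqOn G f (interior C ∩ V) := by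
  set Ω := interior C ∩ V
  set T := C ∩ V
  have hΩT : Ω ⊆ T := inter_subset_inter_left _ interior_subset
  have hTcl : ∀ x ∈ T, x ∈ closure Ω := fun x hx ↦ by
    have h1 : x ∈ closure (interior C) := by
      rw [hC.closure_interior_eq_closure_of_nonempty_interior hCi]; exact subset_closure hx.1
    exact hV.closure_inter ⟨h1, hx.2⟩
  have hlim : ∀ x ∈ T, ∃ y, Tendsto f (𝓝[Ω] x) (𝓝 y) := fun x hx ↦ by
    obtain ⟨r, hr, hrV, K, hK⟩ :=
      exists_ball_lipschitzOnWith_of_linear_hasFDerivAt hC hV hA.continuousOn hf hx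
    have hnhds : 𝓝[Ω] x = 𝓝[interior C ∩ ball x r] x := by
      rw [nhdsWithin_inter_of_mem', nhdsWithin_inter_of_mem']
      · exact nhdsWithin_le_nhds (ball_mem_nhds x hr)
      · exact nhdsWithin_le_nhds (hV.mem_nhds hx.2)
    rw [hnhds]
    refine hK.exists_tendsto_nhdsWithin ?_
    rw [mem_closure_iff_nhdsWithin_neBot, ← hnhds, ← mem_closure_iff_nhdsWithin_neBot]
    exact hTcl x hx
  set G := extendFrom Ω f with hGdef
  have hΩo : IsOpen Ω := isOpen_interior.inter hV
  have hGc : ContinuousOn G T := continuousOn_extendFrom hTcl hlim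
  have hGf : EqOn G f Ω := extendFrom_extends fun u hu ↦
    (hf u hu).continuousAt.continuousWithinAt
  have hGd : ∀ x ∈ T, HasFDerivWithinAt G (A x (G x)) T x := fun x hx ↦ by
    obtain ⟨r, hr, hrV⟩ := Metric.isOpen_iff.1 hV x hx.2
    -- The radius is halved so that the closure of `W` stays inside `V`, where `G` is continuous.
    set W := interior C ∩ ball x (r / 2)
    have hWΩ : W ⊆ Ω := inter_subset_inter_right _
      ((ball_subset_ball (by linarith)).trans hrV)
    have hGW : ∀ u ∈ W, HasFDerivAt G (A u (G u)) u := fun u hu ↦ by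
      rw [hGf (hWΩ hu)]
      exact (hf u (hWΩ hu)).congr_of_eventuallyEq (hGf.eventuallyEq_of_mem
        (hΩo.mem_nhds (hWΩ hu)))
    have hWT : closure W ⊆ T := fun y hy ↦ by
      refine ⟨closure_minimal (inter_subset_left.trans interior_subset) hCc hy, hrV ?_⟩
      exact closedBall_subset_ball (by linarith)
        (closure_ball_subset_closedBall (closure_mono inter_subset_right hy))
    have hAG : ContinuousOn (fun u ↦ A u (G u)) T := hA.continuousOn.clm_apply hGc
    have hd := hasFDerivWithinAt_closure_of_tendsto_fderiv (f := G) (f' := A x (G x)) (x := x)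
      (fun u hu ↦ (hGW u hu).differentiableAt.differentiableWithinAt)
      (hC.interior.inter (convex_ball x (r / 2))) (isOpen_interior.inter isOpen_ball)
      (fun y hy ↦ (hGc y (hWT hy)).mono (hWΩ.trans hΩT))
      (((hAG x hx).mono_left (nhdsWithin_mono x (hWΩ.trans hΩT))).congr'
        (eventually_of_mem self_mem_nhdsWithin fun u hu ↦ (hGW u hu).fderiv.symm))
    refine hd.mono_of_mem_nhdsWithin ?_
    have hsub : C ∩ ball x (r / 2) ⊆ closure W := fun y hy ↦ by
      refine isOpen_ball.closure_inter ⟨?_, hy.2⟩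
      rw [hC.closure_interior_eq_closure_of_nonempty_interior hCi]
      exact subset_closure hy.1
    refine mem_of_superset (inter_mem ?_ ?_) hsub
    · exact mem_of_superset self_mem_nhdsWithin inter_subset_left
    · exact nhdsWithin_le_nhds (ball_mem_nhds x (by positivity))
  -- Smoothness by bootstrapping: if `G` is of class `C^k`, so is its derivative `A u (G u)`.
  refine ⟨G, contDiffOn_infty.2 fun k ↦ ?_, hGf⟩
  have hT : UniqueDiffOn ℝ T := (uniqueDiffOn_convex hC hCi).inter hV
  induction k with
  | zero => exact contDiffOn_zero.2 hGc
  | succ k ih =>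
    rw [Nat.cast_add, Nat.cast_one, contDiffOn_succ_iff_hasFDerivWithinAt_of_uniqueDiffOn hT]
    refine ⟨by simp, fun u ↦ A u (G u), ?_, hGd⟩
    exact (hA.of_le (by exact_mod_cast le_top)).clm_apply ih

end ParallelExtension

/-! ### Prolongation of the metricity equation -/

section Prolongation

variable {m : ℕ}

/-- The partial derivative `∂_k f` of a function on `ℝ^m`. -/
noncomputable def partialDeriv (k : Fin m) (f : EuclideanSpace ℝ (Fin m) → ℝ) :
    EuclideanSpace ℝ (Fin m) → ℝ :=
  fun u ↦ fderiv ℝ f u (EuclideanSpace.basisFun (Fin m) ℝ k)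

theorem partialDeriv_congr {Ω : Set (EuclideanSpace ℝ (Fin m))} (hΩ : IsOpen Ω) (k : Fin m)
    {f g : EuclideanSpace ℝ (Fin m) → ℝ} (h : EqOn f g Ω) :
    EqOn (partialDeriv k f) (partialDeriv k g) Ω := fun u hu ↦ by
  simp only [partialDeriv, (h.eventuallyEq_of_mem (hΩ.mem_nhds hu)).fderiv_eq]

theorem ContDiffOn.partialDeriv {Ω : Set (EuclideanSpace ℝ (Fin m))} (hΩ : IsOpen Ω)
    {f : EuclideanSpace ℝ (Fin m) → ℝ} (hf : ContDiffOn ℝ ∞ f Ω) (k : Fin m) :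
    ContDiffOn ℝ ∞ (partialDeriv k f) Ω :=
  ((contDiffOn_infty_iff_fderiv_of_isOpen hΩ).1 hf).2.clm_apply contDiffOn_const

theorem partialDeriv_comm {Ω : Set (EuclideanSpace ℝ (Fin m))} (hΩ : IsOpen Ω)
    {f : EuclideanSpace ℝ (Fin m) → ℝ} (hf : ContDiffOn ℝ ∞ f Ω) (k l : Fin m)
    {u : EuclideanSpace ℝ (Fin m)} (hu : u ∈ Ω) :
    partialDeriv k (partialDeriv l f) u = partialDeriv l (partialDeriv k f) u := by
  have hd : DifferentiableAt ℝ (fderiv ℝ f) u :=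
    ((((contDiffOn_infty_iff_fderiv_of_isOpen hΩ).1 hf).2.differentiableOn (by simp)) u
      hu).differentiableAt (hΩ.mem_nhds hu)
  have hs : IsSymmSndFDerivAt ℝ f u :=
    (hf.contDiffAt (hΩ.mem_nhds hu)).isSymmSndFDerivAt
      (by rw [minSmoothness_of_isRCLikeNormedField]; exact WithTop.coe_le_coe.2 le_top)
  have key : ∀ i j : Fin m, partialDeriv i (partialDeriv j f) u =
      fderiv ℝ (fderiv ℝ f) u (EuclideanSpace.basisFun (Fin m) ℝ i)
        (EuclideanSpace.basisFun (Fin m) ℝ j) := fun i j ↦ by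
    have h : fderiv ℝ (partialDeriv j f) u = _ := (hd.hasFDerivAt.clm_apply
      (hasFDerivAt_const (EuclideanSpace.basisFun (Fin m) ℝ j) u)).fderiv
    rw [partialDeriv, h]
    simp
  rw [key, key, hs.eq]

/-- The linear combinations of the functions `f a` on `Ω` whose coefficients are smooth on `T`. -/
def smoothSpan (T Ω : Set (EuclideanSpace ℝ (Fin m))) {ι : Type*} [Fintype ι]
    (f : ι → EuclideanSpace ℝ (Fin m) → ℝ) : Submodule ℝ (EuclideanSpace ℝ (Fin m) → ℝ) where
  carrier := {g | ∃ c : ι → EuclideanSpace ℝ (Fin m) → ℝ, (∀ a, ContDiffOn ℝ ∞ (c a) T) ∧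
    ∀ u ∈ Ω, g u = ∑ a, c a u * f a u}
  add_mem' := by
    rintro _ _ ⟨c, hc, hg⟩ ⟨d, hd, hg'⟩
    exact ⟨fun a u ↦ c a u + d a u, fun a ↦ (hc a).add (hd a), fun u hu ↦ by
      simp [hg u hu, hg' u hu, add_mul, Finset.sum_add_distrib]⟩
  zero_mem' := ⟨fun _ _ ↦ 0, fun _ ↦ contDiffOn_const, fun _ _ ↦ by simp⟩
  smul_mem' := by
    rintro r _ ⟨c, hc, hg⟩
    exact ⟨fun a u ↦ r * c a u, fun a ↦ contDiffOn_const.mul (hc a), fun u hu ↦ by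
      simp [hg u hu, Finset.mul_sum, mul_assoc]⟩

section smoothSpan

variable {T Ω : Set (EuclideanSpace ℝ (Fin m))} {ι κ : Type*} [Fintype ι] [Fintype κ]
  {f : ι → EuclideanSpace ℝ (Fin m) → ℝ} {f' : κ → EuclideanSpace ℝ (Fin m) → ℝ}
  {g g' c : EuclideanSpace ℝ (Fin m) → ℝ}

theorem smoothSpan.congr (hg : g ∈ smoothSpan T Ω f) (h : EqOn g' g Ω) :
    g' ∈ smoothSpan T Ω f := by
  obtain ⟨c, hc, hcg⟩ := hg
  exact ⟨c, hc, fun u hu ↦ (h hu).trans (hcg u hu)⟩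

theorem smoothSpan.mul_mem (hc : ContDiffOn ℝ ∞ c T) (hg : g ∈ smoothSpan T Ω f) :
    (fun u ↦ c u * g u) ∈ smoothSpan T Ω f := by
  obtain ⟨d, hd, hdg⟩ := hg
  exact ⟨fun a u ↦ c u * d a u, fun a ↦ hc.mul (hd a), fun u hu ↦ by
    simp [hdg u hu, Finset.mul_sum, mul_assoc]⟩

theorem smoothSpan.sum_mem {κ : Type*} (s : Finset κ) {g : κ → EuclideanSpace ℝ (Fin m) → ℝ}
    (hg : ∀ a ∈ s, g a ∈ smoothSpan T Ω f) : (fun u ↦ ∑ a ∈ s, g a u) ∈ smoothSpan T Ω f :=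
  smoothSpan.congr ((smoothSpan T Ω f).sum_mem hg) fun u _ ↦ by simp

theorem smoothSpan.generator_mem (a : ι) : f a ∈ smoothSpan T Ω f := by
  classical
  exact ⟨fun b _ ↦ if b = a then 1 else 0, fun _ ↦ contDiffOn_const, fun u _ ↦ by simp⟩

theorem smoothSpan.trans (h : ∀ a, f a ∈ smoothSpan T Ω f') (hg : g ∈ smoothSpan T Ω f) :
    g ∈ smoothSpan T Ω f' := by
  obtain ⟨c, hc, hcg⟩ := hg
  exact smoothSpan.congr
    (smoothSpan.sum_mem Finset.univ fun a _ ↦ smoothSpan.mul_mem (hc a) (h a)) hcg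

theorem ContDiffOn.exists_partialDeriv_extension (hT : UniqueDiffOn ℝ T) (hΩ : IsOpen Ω)
    (hΩT : Ω ⊆ T) (hc : ContDiffOn ℝ ∞ c T) (k : Fin m) :
    ∃ c', ContDiffOn ℝ ∞ c' T ∧ EqOn (_root_.partialDeriv k c) c' Ω := by
  refine ⟨fun u ↦ fderivWithin ℝ c T u (EuclideanSpace.basisFun (Fin m) ℝ k),
    ((contDiffOn_infty_iff_fderivWithin hT).1 hc).2.clm_apply contDiffOn_const, fun u hu ↦ ?_⟩
  simp only [_root_.partialDeriv]
  rw [fderivWithin_of_mem_nhds (mem_of_superset (hΩ.mem_nhds hu) hΩT)]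

/-- Differentiating a linear combination: the coefficients have derivatives smooth on `T`, so only
the derivatives of the `f a` matter. -/
theorem smoothSpan.partialDeriv_mem (hT : UniqueDiffOn ℝ T) (hΩ : IsOpen Ω) (hΩT : Ω ⊆ T)
    (k : Fin m) (hfd : ∀ a, DifferentiableOn ℝ (f a) Ω) (hf : ∀ a, f a ∈ smoothSpan T Ω f')
    (hf' : ∀ a, partialDeriv k (f a) ∈ smoothSpan T Ω f') (hg : g ∈ smoothSpan T Ω f) :
    partialDeriv k g ∈ smoothSpan T Ω f' := by
  obtain ⟨c, hc, hcg⟩ := hg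
  choose c' hc' hcc' using fun a ↦ (hc a).exists_partialDeriv_extension hT hΩ hΩT k
  refine smoothSpan.congr (smoothSpan.sum_mem Finset.univ fun a _ ↦ add_mem
    (smoothSpan.mul_mem (hc' a) (hf a)) (smoothSpan.mul_mem (hc a) (hf' a))) fun u hu ↦ ?_
  rw [partialDeriv_congr hΩ k hcg hu]
  have hcd : ∀ a, DifferentiableAt ℝ (c a) u := fun a ↦
    (((hc a).mono hΩT).contDiffAt (hΩ.mem_nhds hu)).differentiableAt (by simp)
  have hfd' : ∀ a, DifferentiableAt ℝ (f a) u := fun a ↦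
    (hfd a).differentiableAt (hΩ.mem_nhds hu)
  simp only [partialDeriv, Pi.add_apply]
  rw [fderiv_fun_sum fun a _ ↦ (hcd a).fun_mul (hfd' a), sum_apply]
  refine Finset.sum_congr rfl fun a _ ↦ ?_
  rw [fderiv_fun_mul (hcd a) (hfd' a), ← hcc' a hu]
  simp only [partialDeriv, add_apply, smul_apply, smul_eq_mul]
  ring

/-- If the partial derivatives of finitely many functions on `interior C ∩ V` are linear
combinations of these functions, with coefficients smooth on `C ∩ V`, then these functions extend
smoothly to `C ∩ V`. -/
theorem exists_contDiffOn_extension_of_partialDeriv_mem {C V : Set (EuclideanSpace ℝ (Fin m))}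
    (hC : Convex ℝ C) (hCc : IsClosed C) (hCi : (interior C).Nonempty) (hV : IsOpen V)
    (hfd : ∀ a, DifferentiableOn ℝ (f a) (interior C ∩ V))
    (hf : ∀ a k, partialDeriv k (f a) ∈ smoothSpan (C ∩ V) (interior C ∩ V) f)
    (hg : g ∈ smoothSpan (C ∩ V) (interior C ∩ V) f) :
    ∃ G, ContDiffOn ℝ ∞ G (C ∩ V) ∧ EqOn G g (interior C ∩ V) := by
  classical
  choose c hc hcf using hf
  have hΩ : IsOpen (interior C ∩ V) := isOpen_interior.inter hV
  -- The elementary coefficient `y ↦ (v ↦ y b * v k • e_a)`.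
  let M : ι → Fin m → ι → (ι → ℝ) →L[ℝ] EuclideanSpace ℝ (Fin m) →L[ℝ] (ι → ℝ) := fun a k b ↦
    (ContinuousLinearMap.proj (R := ℝ) (φ := fun _ : ι ↦ ℝ) b).smulRight
      ((EuclideanSpace.proj k : EuclideanSpace ℝ (Fin m) →L[ℝ] ℝ).smulRight
        (Pi.single a (1 : ℝ) : ι → ℝ))
  obtain ⟨G, hG, hGf⟩ := exists_contDiffOn_extension_of_linear_hasFDerivAt
    (A := fun u ↦ ∑ a, ∑ k, ∑ b, c a k b u • M a k b) (f := fun u a ↦ f a u) hC hCc hCi hV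
    (contDiffOn_clm_apply.2 fun y ↦ contDiffOn_clm_apply.2 fun v ↦ by
      simp only [sum_apply, smul_apply]
      exact ContDiffOn.sum fun a _ ↦ ContDiffOn.sum fun k _ ↦ ContDiffOn.sum fun b _ ↦
        (hc a k b).smul contDiffOn_const) (fun u hu ↦ by
      rw [hasFDerivAt_pi']
      intro a
      have h1 := ((hfd a).differentiableAt (hΩ.mem_nhds hu)).hasFDerivAt
      convert! h1 using 1
      ext v
      have hv : v = ∑ k, v k • EuclideanSpace.basisFun (Fin m) ℝ k := by
        simpa using ((EuclideanSpace.basisFun (Fin m) ℝ).sum_repr v).symm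
      conv_rhs => rw [hv, map_sum]
      simp only [map_smul, smul_eq_mul]
      have h2 : ∀ k, fderiv ℝ (f a) u (EuclideanSpace.basisFun (Fin m) ℝ k) =
          ∑ b, c a k b u * f b u := fun k ↦ hcf a k u hu
      simp only [h2]
      simp [M, Pi.single_apply, Finset.mul_sum]
      exact Finset.sum_congr rfl fun _ _ ↦ Finset.sum_congr rfl fun _ _ ↦ by ring)
  obtain ⟨d, hd, hdg⟩ := hg
  refine ⟨fun u ↦ ∑ a, d a u * G u a, ContDiffOn.sum fun a _ ↦ (hd a).mul ?_, fun u hu ↦ ?_⟩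
  · exact contDiffOn_pi.1 hG a
  · simp only [hGf hu, hdg u hu]

end smoothSpan

/-- The solution of an equation `∂_k h^{ij} = -δ_k^i λ^j - δ_k^j λ^i + …`, its trace part `λ` and
the divergence of `λ`, as one family of functions. -/
noncomputable def prolongation (h : Fin m → Fin m → EuclideanSpace ℝ (Fin m) → ℝ)
    (lam : Fin m → EuclideanSpace ℝ (Fin m) → ℝ) :
    (Fin m × Fin m) ⊕ Fin m ⊕ Unit → EuclideanSpace ℝ (Fin m) → ℝ :=
  Sum.elim (fun p ↦ h p.1 p.2) (Sum.elim lam fun _ u ↦ ∑ i, partialDeriv i (lam i) u)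

theorem partialDeriv_add_mul_add_mul {f g g' : EuclideanSpace ℝ (Fin m) → ℝ}
    {u : EuclideanSpace ℝ (Fin m)} (hf : DifferentiableAt ℝ f u) (hg : DifferentiableAt ℝ g u)
    (hg' : DifferentiableAt ℝ g' u) (c d : ℝ) (k : Fin m) :
    partialDeriv k (fun y ↦ f y + c * g y + d * g' y) u =
      partialDeriv k f u + c * partialDeriv k g u + d * partialDeriv k g' u := by
  have h := ((hf.hasFDerivAt.add (hg.hasFDerivAt.const_mul c)).add
    (hg'.hasFDerivAt.const_mul d)).fderiv
  have h' : fderiv ℝ (fun y ↦ f y + c * g y + d * g' y) u = _ := h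
  simp only [partialDeriv, h']
  simp

/-- Commuting second derivatives of `h` determine `∂ λ` up to its trace, and commuting second
derivatives of `λ` then determine the derivative of this trace; the second step divides by
`m - 1`. -/
theorem partialDeriv_prolongation_mem (hm : 2 ≤ m) {T Ω : Set (EuclideanSpace ℝ (Fin m))}
    (hT : UniqueDiffOn ℝ T) (hΩ : IsOpen Ω) (hΩT : Ω ⊆ T)
    {h : Fin m → Fin m → EuclideanSpace ℝ (Fin m) → ℝ}
    {lam : Fin m → EuclideanSpace ℝ (Fin m) → ℝ} (hh : ∀ i j, ContDiffOn ℝ ∞ (h i j) Ω)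
    (hlam : ∀ i, ContDiffOn ℝ ∞ (lam i) Ω)
    (heq : ∀ k i j, (fun u ↦ partialDeriv k (h i j) u + (if k = i then 1 else 0) * lam j u
        + (if k = j then 1 else 0) * lam i u) ∈
      smoothSpan T Ω (fun p : Fin m × Fin m ↦ h p.1 p.2))
    (a : (Fin m × Fin m) ⊕ Fin m ⊕ Unit) (k : Fin m) :
    partialDeriv k (prolongation h lam a) ∈ smoothSpan T Ω (prolongation h lam) := by
  set f₀ : Fin m × Fin m → EuclideanSpace ℝ (Fin m) → ℝ := fun p ↦ h p.1 p.2
  set f₁ : (Fin m × Fin m) ⊕ Fin m → EuclideanSpace ℝ (Fin m) → ℝ := Sum.elim f₀ lam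
  set N : EuclideanSpace ℝ (Fin m) → ℝ := fun u ↦ ∑ i, partialDeriv i (lam i) u with hN
  set f₂ := prolongation h lam
  have h01 : ∀ p, f₀ p ∈ smoothSpan T Ω f₁ := fun p ↦ smoothSpan.generator_mem (f := f₁) (.inl p)
  have h02 : ∀ p, f₀ p ∈ smoothSpan T Ω f₂ := fun p ↦ smoothSpan.generator_mem (f := f₂) (.inl p)
  have hl1 : ∀ j, lam j ∈ smoothSpan T Ω f₁ := fun j ↦
    smoothSpan.generator_mem (f := f₁) (.inr j)
  have hl2 : ∀ j, lam j ∈ smoothSpan T Ω f₂ := fun j ↦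
    smoothSpan.generator_mem (f := f₂) (.inr (.inl j))
  have hN2 : N ∈ smoothSpan T Ω f₂ := smoothSpan.generator_mem (f := f₂) (.inr (.inr ()))
  have h12 : ∀ p, f₁ p ∈ smoothSpan T Ω f₂ := Sum.rec h02 hl2
  have hd : ∀ {f : EuclideanSpace ℝ (Fin m) → ℝ}, ContDiffOn ℝ ∞ f Ω →
      DifferentiableOn ℝ f Ω := fun hf ↦ hf.differentiableOn (by simp)
  have hd' : ∀ {f : EuclideanSpace ℝ (Fin m) → ℝ}, ContDiffOn ℝ ∞ f Ω →
      ∀ u ∈ Ω, DifferentiableAt ℝ f u := fun hf u hu ↦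
    (hd hf).differentiableAt (hΩ.mem_nhds hu)
  have hNs : ContDiffOn ℝ ∞ N Ω := ContDiffOn.sum fun i _ ↦ (hlam i).partialDeriv hΩ i
  set b : Fin m → Fin m → Fin m → EuclideanSpace ℝ (Fin m) → ℝ := fun k i j u ↦
    partialDeriv k (h i j) u + (if k = i then 1 else 0) * lam j u
      + (if k = j then 1 else 0) * lam i u with hb
  have hdh : ∀ k p, partialDeriv k (f₀ p) ∈ smoothSpan T Ω f₁ := fun k p ↦ by
    have h1 := smoothSpan.trans h01 (heq k p.1 p.2)
    have h2 := smoothSpan.mul_mem (c := fun _ ↦ if k = p.1 then 1 else 0) contDiffOn_const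
      (hl1 p.2)
    have h3 := smoothSpan.mul_mem (c := fun _ ↦ if k = p.2 then 1 else 0) contDiffOn_const
      (hl1 p.1)
    refine smoothSpan.congr (sub_mem (sub_mem h1 h2) h3) fun u _ ↦ ?_
    simp only [Pi.sub_apply, f₀]
    ring
  have hD0 : ∀ k g, g ∈ smoothSpan T Ω f₀ → partialDeriv k g ∈ smoothSpan T Ω f₁ := fun k g hg ↦
    smoothSpan.partialDeriv_mem (f := f₀) hT hΩ hΩT k (fun p ↦ hd (hh p.1 p.2)) h01 (hdh k) hg
  -- Since `b k k j = ∂_k h^{kj} + λ^j + δ_k^j λ^k`, the antisymmetrized derivatives of `b` contain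
  -- no second derivatives of `h`; contraction over `k` leaves `m ∂_l λ^j - δ_l^j N`.
  set s : Fin m → Fin m → EuclideanSpace ℝ (Fin m) → ℝ := fun l j u ↦
    ∑ k, (partialDeriv l (b k k j) u - partialDeriv k (b l k j) u) with hs
  have hs1 : ∀ l j, s l j ∈ smoothSpan T Ω f₁ := fun l j ↦
    smoothSpan.sum_mem Finset.univ fun k _ ↦
      sub_mem (hD0 l _ (heq k k j)) (hD0 k _ (heq l k j))
  have hseq : ∀ l j, EqOn (s l j)
      (fun u ↦ 0 + m * partialDeriv l (lam j) u + (if l = j then -1 else 0) * N u) Ω := by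
    intro l j u hu
    have hb' : ∀ k k' i j, partialDeriv k (b k' i j) u = partialDeriv k (partialDeriv k' (h i j)) u
        + (if k' = i then 1 else 0) * partialDeriv k (lam j) u
        + (if k' = j then 1 else 0) * partialDeriv k (lam i) u := fun k k' i j ↦
      partialDeriv_add_mul_add_mul (hd' ((hh i j).partialDeriv hΩ k') u hu)
        (hd' (hlam j) u hu) (hd' (hlam i) u hu) _ _ k
    simp only [hs, hb']
    simp only [partialDeriv_comm hΩ (hh _ _) l _ hu]
    simp only [hN]
    simp [Finset.sum_add_distrib, Finset.sum_sub_distrib]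
    split_ifs <;> ring
  have hdl : ∀ k j, partialDeriv k (lam j) ∈ smoothSpan T Ω f₂ := fun k j ↦ by
    have h1 := (smoothSpan T Ω f₂).smul_mem (1 / m : ℝ) (smoothSpan.trans h12 (hs1 k j))
    have h2 := (smoothSpan T Ω f₂).smul_mem (if k = j then (1 / m : ℝ) else 0) hN2
    refine smoothSpan.congr (add_mem h1 h2) fun u hu ↦ ?_
    have : (m : ℝ) ≠ 0 := by positivity
    simp only [Pi.add_apply, Pi.smul_apply, smul_eq_mul, hseq k j hu]
    split_ifs <;> field_simp <;> ring
  have hD1 : ∀ k g, g ∈ smoothSpan T Ω f₁ → partialDeriv k g ∈ smoothSpan T Ω f₂ := fun k g hg ↦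
    smoothSpan.partialDeriv_mem (f := f₁) hT hΩ hΩT k
      (Sum.rec (fun p ↦ hd (hh p.1 p.2)) fun j ↦ hd (hlam j))
      h12 (Sum.rec (fun p ↦ smoothSpan.trans h12 (hdh k p)) (hdl k)) hg
  -- In `∑ l, (∂_l s_k^l - ∂_k s_l^l)` the second derivatives of `λ` cancel and `(m - 1) ∂_k N`
  -- remains.
  have hdN : ∀ k, partialDeriv k N ∈ smoothSpan T Ω f₂ := fun k ↦ by
    have h1 : (fun u ↦ ∑ l, (partialDeriv l (s k l) u - partialDeriv k (s l l) u)) ∈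
        smoothSpan T Ω f₂ := smoothSpan.sum_mem Finset.univ fun l _ ↦
      sub_mem (hD1 l _ (hs1 k l)) (hD1 k _ (hs1 l l))
    refine smoothSpan.congr ((smoothSpan T Ω f₂).smul_mem (1 / (m - 1 : ℝ)) h1) fun u hu ↦ ?_
    have hs' : ∀ k l j, partialDeriv k (s l j) u =
        0 + m * partialDeriv k (partialDeriv l (lam j)) u
          + (if l = j then -1 else 0) * partialDeriv k N u := fun k l j ↦ by
      rw [partialDeriv_congr hΩ k (hseq l j) hu, partialDeriv_add_mul_add_mul
        (differentiableAt_const 0) (hd' ((hlam j).partialDeriv hΩ l) u hu) (hd' hNs u hu)]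
      simp [partialDeriv]
    simp only [Pi.smul_apply, smul_eq_mul, hs']
    simp only [partialDeriv_comm hΩ (hlam _) k _ hu]
    have hm1 : (m - 1 : ℝ) ≠ 0 := by
      have : (2 : ℝ) ≤ m := by exact_mod_cast hm
      linarith
    simp [Finset.sum_add_distrib]
    field_simp
    ring
  exact match a with
    | .inl p => smoothSpan.trans h12 (hdh k p)
    | .inr (.inl j) => hdl k j
    | .inr (.inr _) => hdN k

end Prolongation

/-! ### Charts, coordinate frames and coordinate derivatives -/

section Charts

variable {n : ℕ} {Mbar : Type*} [TopologicalSpace Mbar]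
  [ChartedSpace (EuclideanHalfSpace (n + 1)) Mbar] [IsManifold (𝓡∂ (n + 1)) ∞ Mbar]

/-- A scalar function read in the preferred chart around `p`. -/
noncomputable def readInChart (p : Mbar) (f : Mbar → ℝ) : EuclideanSpace ℝ (Fin (n + 1)) → ℝ :=
  f ∘ (extChartAt (𝓡∂ (n + 1)) p).symm

omit [IsManifold (𝓡∂ (n + 1)) ∞ Mbar] in
theorem readInChart_extChartAt {p x : Mbar}
    (hx : x ∈ (chartAt (EuclideanHalfSpace (n + 1)) p).source) (f : Mbar → ℝ) :
    readInChart p f (extChartAt (𝓡∂ (n + 1)) p x) = f x := by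
  simp only [readInChart, Function.comp_apply]
  rw [(extChartAt (𝓡∂ (n + 1)) p).left_inv (by rwa [extChartAt_source])]

/-- The open subset of `ℝ^{n+1}` whose intersection with the half-space is the image of the
preferred chart around `p`. -/
def chartOpen (p : Mbar) : Set (EuclideanSpace ℝ (Fin (n + 1))) :=
  (𝓡∂ (n + 1)).symm ⁻¹' (chartAt (EuclideanHalfSpace (n + 1)) p).target

omit [IsManifold (𝓡∂ (n + 1)) ∞ Mbar] in
theorem isOpen_chartOpen (p : Mbar) : IsOpen (chartOpen (n := n) p) :=
  (chartAt (EuclideanHalfSpace (n + 1)) p).open_target.preimage (𝓡∂ (n + 1)).continuous_symm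

omit [IsManifold (𝓡∂ (n + 1)) ∞ Mbar] in
theorem extChartAt_target_eq (p : Mbar) :
    (extChartAt (𝓡∂ (n + 1)) p).target = range (𝓡∂ (n + 1)) ∩ chartOpen p := by
  rw [extChartAt_target, inter_comm]; rfl

theorem mem_interior_iff_extChartAt {p x : Mbar}
    (hx : x ∈ (chartAt (EuclideanHalfSpace (n + 1)) p).source) :
    x ∈ (𝓡∂ (n + 1)).interior Mbar ↔
      extChartAt (𝓡∂ (n + 1)) p x ∈ interior (range (𝓡∂ (n + 1))) ∩ chartOpen p := by
  have h := (𝓡∂ (n + 1)).isInteriorPoint_iff_of_mem_atlas (n := ∞) (by simp)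
    (chart_mem_atlas (EuclideanHalfSpace (n + 1)) p) hx
  refine h.trans ?_
  have e : ((chartAt (EuclideanHalfSpace (n + 1)) p).extend (𝓡∂ (n + 1))).target =
    range (𝓡∂ (n + 1)) ∩ chartOpen p := extChartAt_target_eq p
  rw [e, interior_inter, (isOpen_chartOpen p).interior_eq]
  rfl

omit [IsManifold (𝓡∂ (n + 1)) ∞ Mbar] in
theorem image_extChartAt_source (p : Mbar) :
    extChartAt (𝓡∂ (n + 1)) p '' (chartAt (EuclideanHalfSpace (n + 1)) p).source =
      range (𝓡∂ (n + 1)) ∩ chartOpen p := by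
  rw [← extChartAt_source (𝓡∂ (n + 1)), PartialEquiv.image_source_eq_target, extChartAt_target_eq]

theorem image_extChartAt_interior (p : Mbar) :
    extChartAt (𝓡∂ (n + 1)) p '' ((chartAt (EuclideanHalfSpace (n + 1)) p).source ∩
      (𝓡∂ (n + 1)).interior Mbar) = interior (range (𝓡∂ (n + 1))) ∩ chartOpen p := by
  ext u
  constructor
  · rintro ⟨x, hx, rfl⟩
    exact (mem_interior_iff_extChartAt hx.1).1 hx.2
  · intro hu
    have hu' : u ∈ (extChartAt (𝓡∂ (n + 1)) p).target := by
      rw [extChartAt_target_eq]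
      exact ⟨interior_subset hu.1, hu.2⟩
    have hx := (extChartAt (𝓡∂ (n + 1)) p).map_target hu'
    rw [extChartAt_source] at hx
    have hr := (extChartAt (𝓡∂ (n + 1)) p).right_inv hu'
    exact ⟨_, ⟨hx, (mem_interior_iff_extChartAt hx).2 (by rwa [hr])⟩, hr⟩

theorem isOpen_source_inter_interior (p : Mbar) :
    IsOpen ((chartAt (EuclideanHalfSpace (n + 1)) p).source ∩ (𝓡∂ (n + 1)).interior Mbar) :=
  (chartAt (EuclideanHalfSpace (n + 1)) p).open_source.inter
    ((𝓡∂ (n + 1)).isOpen_interior (n := ∞) (by simp))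

theorem dense_interior : Dense ((𝓡∂ (n + 1)).interior Mbar) := by
  intro x
  have hx := mem_chart_source (EuclideanHalfSpace (n + 1)) x
  set φ := extChartAt (𝓡∂ (n + 1)) x
  have hxT : φ x ∈ range (𝓡∂ (n + 1)) ∩ chartOpen x := by
    rw [← image_extChartAt_source]; exact mem_image_of_mem _ hx
  have hcl : φ x ∈ closure (interior (range (𝓡∂ (n + 1))) ∩ chartOpen x) := by
    rw [inter_comm]
    refine (isOpen_chartOpen x).inter_closure ⟨hxT.2, ?_⟩
    rw [(𝓡∂ (n + 1)).convex_range.closure_interior_eq_closure_of_nonempty_interior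
      (𝓡∂ (n + 1)).nonempty_interior]
    exact subset_closure hxT.1
  rw [mem_closure_iff_nhdsWithin_neBot] at hcl
  have hc : Tendsto φ.symm (𝓝[interior (range (𝓡∂ (n + 1))) ∩ chartOpen x] (φ x)) (𝓝 x) := by
    have := (continuousAt_extChartAt_symm (I := 𝓡∂ (n + 1)) x).tendsto
    rw [extChartAt_to_inv] at this
    exact this.mono_left inf_le_left
  refine mem_closure_of_tendsto hc (eventually_of_mem self_mem_nhdsWithin fun u hu ↦ ?_)
  rw [← image_extChartAt_interior] at hu
  obtain ⟨y, hy, rfl⟩ := hu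
  rw [(extChartAt (𝓡∂ (n + 1)) x).left_inv (by rw [extChartAt_source]; exact hy.1)]
  exact hy.2

theorem contMDiffOn_source_iff_readInChart (p : Mbar) (f : Mbar → ℝ) :
    ContMDiffOn (𝓡∂ (n + 1)) 𝓘(ℝ, ℝ) ∞ f (chartAt (EuclideanHalfSpace (n + 1)) p).source ↔
      ContDiffOn ℝ ∞ (readInChart p f) (range (𝓡∂ (n + 1)) ∩ chartOpen p) := by
  rw [contMDiffOn_iff_of_subset_source' (x := p) (y := (0 : ℝ)) (by rw [extChartAt_source])
    (fun _ _ ↦ by rw [extChartAt_source, chartAt_self_eq]; trivial), image_extChartAt_source]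
  rfl

theorem contMDiffOn_interior_iff_readInChart (p : Mbar) (f : Mbar → ℝ) :
    ContMDiffOn (𝓡∂ (n + 1)) 𝓘(ℝ, ℝ) ∞ f ((chartAt (EuclideanHalfSpace (n + 1)) p).source ∩
        (𝓡∂ (n + 1)).interior Mbar) ↔
      ContDiffOn ℝ ∞ (readInChart p f) (interior (range (𝓡∂ (n + 1))) ∩ chartOpen p) := by
  rw [contMDiffOn_iff_of_subset_source' (x := p) (y := (0 : ℝ))
    (by rw [extChartAt_source]; exact inter_subset_left)
    (fun _ _ ↦ by rw [extChartAt_source, chartAt_self_eq]; trivial), image_extChartAt_interior]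
  rfl

theorem coordField_eq_symmL {p x : Mbar}
    (hx : x ∈ (chartAt (EuclideanHalfSpace (n + 1)) p).source) (i : Fin (n + 1)) :
    coordField p i x = (trivializationAt (EuclideanSpace ℝ (Fin (n + 1)))
      (TangentSpace (𝓡∂ (n + 1)) : Mbar → Type _) p).symmL ℝ x
        (EuclideanSpace.basisFun (Fin (n + 1)) ℝ i) := by
  have hb : x ∈ (trivializationAt (EuclideanSpace ℝ (Fin (n + 1)))
      (TangentSpace (𝓡∂ (n + 1)) : Mbar → Type _) p).baseSet := hx
  rw [coordField, Trivialization.localFrame_apply_of_mem_baseSet _ _ hb]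
  rw [Trivialization.symmL_apply _ hb]
  simp [Trivialization.basisAt]

theorem coordComponent_coordField {p x : Mbar}
    (hx : x ∈ (chartAt (EuclideanHalfSpace (n + 1)) p).source) (i j : Fin (n + 1)) :
    coordComponent p x (coordField p i x) j = if j = i then 1 else 0 := by
  have hb : x ∈ (trivializationAt (EuclideanSpace ℝ (Fin (n + 1)))
      (TangentSpace (𝓡∂ (n + 1)) : Mbar → Type _) p).baseSet := hx
  rw [coordComponent, coordField_eq_symmL hx,
    Trivialization.continuousLinearMapAt_symmL _ hb]
  simp

theorem coordComponent_add (p x : Mbar) (v w : TangentSpace (𝓡∂ (n + 1)) x) (i : Fin (n + 1)) :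
    coordComponent p x (v + w) i = coordComponent p x v i + coordComponent p x w i := by
  simp [coordComponent]

theorem coordComponent_smul (p x : Mbar) (c : ℝ) (v : TangentSpace (𝓡∂ (n + 1)) x)
    (i : Fin (n + 1)) : coordComponent p x (c • v) i = c * coordComponent p x v i := by
  simp [coordComponent]

theorem coordComponent_sum {ι : Type*} (p x : Mbar) (s : Finset ι)
    (v : ι → TangentSpace (𝓡∂ (n + 1)) x) (i : Fin (n + 1)) :
    coordComponent p x (∑ a ∈ s, v a) i = ∑ a ∈ s, coordComponent p x (v a) i := by
  simp [coordComponent]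

theorem sum_coordComponent_smul {p x : Mbar}
    (hx : x ∈ (chartAt (EuclideanHalfSpace (n + 1)) p).source)
    (v : TangentSpace (𝓡∂ (n + 1)) x) :
    ∑ i, coordComponent p x v i • coordField p i x = v := by
  have hb : x ∈ (trivializationAt (EuclideanSpace ℝ (Fin (n + 1)))
      (TangentSpace (𝓡∂ (n + 1)) : Mbar → Type _) p).baseSet := hx
  set e := trivializationAt (EuclideanSpace ℝ (Fin (n + 1)))
      (TangentSpace (𝓡∂ (n + 1)) : Mbar → Type _) p
  have h : v = e.symmL ℝ x (e.continuousLinearMapAt ℝ x v) :=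
    (Trivialization.symmL_continuousLinearMapAt _ hb v).symm
  have h2 : e.continuousLinearMapAt ℝ x v =
      ∑ i, (e.continuousLinearMapAt ℝ x v) i • EuclideanSpace.basisFun (Fin (n + 1)) ℝ i := by
    simpa using ((EuclideanSpace.basisFun (Fin (n + 1)) ℝ).sum_repr
      (e.continuousLinearMapAt ℝ x v)).symm
  conv_rhs => rw [h, h2, map_sum]
  refine Finset.sum_congr rfl fun i _ ↦ ?_
  rw [map_smul, coordField_eq_symmL hx]
  rfl

theorem linearIndependent_coordFrame {p x : Mbar}
    (hx : x ∈ (chartAt (EuclideanHalfSpace (n + 1)) p).source) :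
    LinearIndependent ℝ (coordFrame (n := n) p x) := by
  rw [Fintype.linearIndependent_iff]
  intro c hc j
  have h := congrArg (fun v : TangentSpace (𝓡∂ (n + 1)) x ↦ coordComponent p x v j) hc
  simp only [coordComponent_sum, coordComponent_smul, coordFrame, coordComponent_coordField hx] at h
  simpa [coordComponent] using h

theorem contMDiffOn_coordField (p : Mbar) (i : Fin (n + 1)) :
    ContMDiffOn (𝓡∂ (n + 1)) ((𝓡∂ (n + 1)).prod 𝓘(ℝ, EuclideanSpace ℝ (Fin (n + 1)))) ∞
      (fun x ↦ TotalSpace.mk' (EuclideanSpace ℝ (Fin (n + 1)))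
        (E := (TangentSpace (𝓡∂ (n + 1)) : Mbar → Type _)) x (coordField p i x))
      (chartAt (EuclideanHalfSpace (n + 1)) p).source :=
  (trivializationAt (EuclideanSpace ℝ (Fin (n + 1)))
    (TangentSpace (𝓡∂ (n + 1)) : Mbar → Type _) p).contMDiffOn_localFrame_baseSet ∞
      (EuclideanSpace.basisFun (Fin (n + 1)) ℝ).toBasis i

theorem contMDiffAt_coordField {p x : Mbar}
    (hx : x ∈ (chartAt (EuclideanHalfSpace (n + 1)) p).source) (i : Fin (n + 1)) :
    ContMDiffAt (𝓡∂ (n + 1)) ((𝓡∂ (n + 1)).prod 𝓘(ℝ, EuclideanSpace ℝ (Fin (n + 1)))) ∞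
      (fun x ↦ TotalSpace.mk' (EuclideanSpace ℝ (Fin (n + 1)))
        (E := (TangentSpace (𝓡∂ (n + 1)) : Mbar → Type _)) x (coordField p i x)) x :=
  (contMDiffOn_coordField p i).contMDiffAt
    ((chartAt (EuclideanHalfSpace (n + 1)) p).open_source.mem_nhds hx)

theorem fieldDifferentiableAt_coordField {p x : Mbar}
    (hx : x ∈ (chartAt (EuclideanHalfSpace (n + 1)) p).source) (i : Fin (n + 1)) :
    FieldDifferentiableAt (coordField p i) x :=
  (contMDiffAt_coordField hx i).mdifferentiableAt (by simp)

theorem ContMDiffOn.coordComponent {p : Mbar} {X : Π y : Mbar, TangentSpace (𝓡∂ (n + 1)) y}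
    {s : Set Mbar} (hs : s ⊆ (chartAt (EuclideanHalfSpace (n + 1)) p).source)
    (hX : ContMDiffOn (𝓡∂ (n + 1)) ((𝓡∂ (n + 1)).prod 𝓘(ℝ, EuclideanSpace ℝ (Fin (n + 1)))) ∞
      (fun x ↦ TotalSpace.mk' (EuclideanSpace ℝ (Fin (n + 1)))
        (E := (TangentSpace (𝓡∂ (n + 1)) : Mbar → Type _)) x (X x)) s) (i : Fin (n + 1)) :
    ContMDiffOn (𝓡∂ (n + 1)) 𝓘(ℝ, ℝ) ∞ (fun x ↦ coordComponent p x (X x) i) s := by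
  intro x hx
  set e := trivializationAt (EuclideanSpace ℝ (Fin (n + 1)))
      (TangentSpace (𝓡∂ (n + 1)) : Mbar → Type _) p
  have h1 := ((e.contMDiffWithinAt_section (IB := 𝓡∂ (n + 1)) (s := X) (x₀ := x) (a := s)
    (hs hx)).1 (hX x hx))
  have h2 : ContMDiffWithinAt (𝓡∂ (n + 1)) 𝓘(ℝ, ℝ) ∞ (fun x ↦ (e ⟨x, X x⟩).2 i) s x :=
    ((EuclideanSpace.proj i : EuclideanSpace ℝ (Fin (n + 1)) →L[ℝ] ℝ).contMDiff.contMDiffAt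
      ).comp_contMDiffWithinAt x h1
  refine h2.congr_of_mem (fun y hy ↦ ?_) hx
  have hy' : y ∈ e.baseSet := hs hy
  simp only [_root_.coordComponent]
  rw [Trivialization.continuousLinearMapAt_apply, Trivialization.coe_linearMapAt_of_mem _ hy']

theorem coordDeriv_eq_fderivWithin {p x : Mbar}
    (hx : x ∈ (chartAt (EuclideanHalfSpace (n + 1)) p).source) {f : Mbar → ℝ}
    (hf : MDifferentiableAt (𝓡∂ (n + 1)) 𝓘(ℝ, ℝ) f x) (k : Fin (n + 1)) :
    coordDeriv p f x k = fderivWithin ℝ (readInChart p f) (range (𝓡∂ (n + 1)))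
      (extChartAt (𝓡∂ (n + 1)) p x) (EuclideanSpace.basisFun (Fin (n + 1)) ℝ k) := by
  set φ := extChartAt (𝓡∂ (n + 1)) p
  have hφx : φ x ∈ φ.target := φ.map_source (by rwa [extChartAt_source])
  have hl : φ.symm (φ x) = x := φ.left_inv (by rwa [extChartAt_source])
  rw [coordDeriv, coordField_eq_symmL hx, TangentBundle.symmL_trivializationAt hx,
    ← mfderivWithin_eq_fderivWithin]
  have hcomp := mfderiv_comp_mfderivWithin_of_eq (g := f) (f := φ.symm) (x := φ x)
    (s := range (𝓡∂ (n + 1))) hf (mdifferentiableWithinAt_extChartAt_symm hφx)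
    ((𝓡∂ (n + 1)).uniqueMDiffOn _ (extChartAt_target_subset_range p hφx)) hl
  rw [readInChart, hcomp]
  rfl

theorem coordDeriv_eq_partialDeriv {p x : Mbar}
    (hx : x ∈ (chartAt (EuclideanHalfSpace (n + 1)) p).source ∩ (𝓡∂ (n + 1)).interior Mbar)
    {f : Mbar → ℝ} (hf : MDifferentiableAt (𝓡∂ (n + 1)) 𝓘(ℝ, ℝ) f x) (k : Fin (n + 1)) :
    coordDeriv p f x k = partialDeriv k (readInChart p f) (extChartAt (𝓡∂ (n + 1)) p x) := by
  rw [coordDeriv_eq_fderivWithin hx.1 hf, partialDeriv, fderivWithin_of_mem_nhds]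
  exact mem_interior_iff_mem_nhds.1 ((mem_interior_iff_extChartAt hx.1).1 hx.2).1

theorem ContMDiffOn.coordDeriv {p : Mbar} {f : Mbar → ℝ}
    (hf : ContMDiffOn (𝓡∂ (n + 1)) 𝓘(ℝ, ℝ) ∞ f (chartAt (EuclideanHalfSpace (n + 1)) p).source)
    (k : Fin (n + 1)) :
    ContMDiffOn (𝓡∂ (n + 1)) 𝓘(ℝ, ℝ) ∞ (fun x ↦ coordDeriv p f x k)
      (chartAt (EuclideanHalfSpace (n + 1)) p).source := by
  rw [contMDiffOn_source_iff_readInChart]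
  have hT : UniqueDiffOn ℝ (range (𝓡∂ (n + 1)) ∩ chartOpen p) :=
    (𝓡∂ (n + 1)).uniqueDiffOn.inter (isOpen_chartOpen p)
  have h := ((contDiffOn_infty_iff_fderivWithin hT).1
    ((contMDiffOn_source_iff_readInChart p f).1 hf)).2.clm_apply
      (contDiffOn_const (c := EuclideanSpace.basisFun (Fin (n + 1)) ℝ k))
  refine h.congr fun u hu ↦ ?_
  rw [← image_extChartAt_source] at hu
  obtain ⟨x, hx, rfl⟩ := hu
  have hxT : extChartAt (𝓡∂ (n + 1)) p x ∈ chartOpen p := by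
    have := mem_image_of_mem (extChartAt (𝓡∂ (n + 1)) p) hx
    rw [image_extChartAt_source] at this
    exact this.2
  rw [readInChart_extChartAt hx, coordDeriv_eq_fderivWithin hx,
    fderivWithin_inter ((isOpen_chartOpen p).mem_nhds hxT)]
  exact ((hf.contMDiffAt ((chartAt _ p).open_source.mem_nhds hx)).mdifferentiableAt (by simp))

theorem coordDeriv_congr {p x : Mbar} {f f' : Mbar → ℝ} (h : f =ᶠ[𝓝 x] f') (k : Fin (n + 1)) :
    coordDeriv p f x k = coordDeriv p f' x k := by
  have h1 : mfderiv (𝓡∂ (n + 1)) 𝓘(ℝ, ℝ) f x = mfderiv (𝓡∂ (n + 1)) 𝓘(ℝ, ℝ) f' x := h.mfderiv_eq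
  have h2 : f x = f' x := h.eq_of_nhds
  simp only [coordDeriv, mvfderiv]
  rw [h1]
  rfl

theorem coordDeriv_const (p x : Mbar) (c : ℝ) (k : Fin (n + 1)) :
    coordDeriv p (fun _ ↦ c) x k = 0 := by
  simp [coordDeriv, mvfderiv_const]

theorem coordDeriv_mul {p x : Mbar} {f f' : Mbar → ℝ}
    (hf : MDifferentiableAt (𝓡∂ (n + 1)) 𝓘(ℝ, ℝ) f x)
    (hf' : MDifferentiableAt (𝓡∂ (n + 1)) 𝓘(ℝ, ℝ) f' x) (k : Fin (n + 1)) :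
    coordDeriv p (fun y ↦ f y * f' y) x k =
      coordDeriv p f x k * f' x + f x * coordDeriv p f' x k := by
  have := mvfderiv_mul hf hf'
  simp only [coordDeriv]
  rw [show (fun y ↦ f y * f' y) = f * f' from rfl, this]
  simp
  ring

theorem coordDeriv_sum {p x : Mbar} {ι : Type*} (s : Finset ι) {f : ι → Mbar → ℝ}
    (hf : ∀ i ∈ s, MDifferentiableAt (𝓡∂ (n + 1)) 𝓘(ℝ, ℝ) (f i) x) (k : Fin (n + 1)) :
    coordDeriv p (fun y ↦ ∑ i ∈ s, f i y) x k = ∑ i ∈ s, coordDeriv p (f i) x k := by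
  classical
  have : MDifferentiableAt (𝓡∂ (n + 1)) 𝓘(ℝ, ℝ) (fun y ↦ ∑ i ∈ s, f i y) x ∧
      coordDeriv p (fun y ↦ ∑ i ∈ s, f i y) x k = ∑ i ∈ s, coordDeriv p (f i) x k := by
    induction s using Finset.induction_on with
    | empty => simpa [coordDeriv_const] using mdifferentiableAt_const
    | insert a s ha ih =>
      obtain ⟨h1, h2⟩ := ih fun i hi ↦ hf i (Finset.mem_insert_of_mem hi)
      have h0 := hf a (Finset.mem_insert_self a s)
      have := mvfderiv_add h0 h1
      simp only [Finset.sum_insert ha]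
      refine ⟨h0.add h1, ?_⟩
      rw [← h2]
      simp only [coordDeriv]
      rw [show (fun y ↦ f a y + ∑ i ∈ s, f i y) = f a + fun y ↦ ∑ i ∈ s, f i y from rfl, this]
      simp
  exact this.2

theorem coordDeriv_comp {p x : Mbar} {f : Mbar → ℝ} {φ : ℝ → ℝ} {φ' : ℝ}
    (hf : MDifferentiableAt (𝓡∂ (n + 1)) 𝓘(ℝ, ℝ) f x) (hφ : HasDerivAt φ φ' (f x))
    (k : Fin (n + 1)) :
    coordDeriv p (fun y ↦ φ (f y)) x k = φ' * coordDeriv p f x k := by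
  have := (hφ.hasFDerivAt.hasMFDerivAt.comp x hf.hasMFDerivAt).mfderiv
  simp only [coordDeriv, mvfderiv]
  rw [show (fun y ↦ φ (f y)) = φ ∘ f from rfl, this]
  have key : ∀ a : ℝ, a • φ' = φ' * a := fun a ↦ mul_comm a φ'
  exact key (mfderiv (𝓡∂ (n + 1)) 𝓘(ℝ, ℝ) f x (coordField p k x))

theorem contMDiffOn_christoffel [T2Space Mbar]
    {nabla : CovariantDerivative (𝓡∂ (n + 1)) (EuclideanSpace ℝ (Fin (n + 1)))
      (TangentSpace (𝓡∂ (n + 1)) : Mbar → Type _)}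
    (hsmooth : nabla.ContMDiffCovariantDerivative ∞) (p : Mbar) (l k j : Fin (n + 1)) :
    ContMDiffOn (𝓡∂ (n + 1)) 𝓘(ℝ, ℝ) ∞ (fun x ↦ christoffel nabla.toFun p x l k j)
      (chartAt (EuclideanHalfSpace (n + 1)) p).source := by
  intro x hx
  -- A connection is only known to preserve smoothness of global vector fields, so the coordinate
  -- field is cut off by a bump function.
  obtain ⟨χ, -, hχs⟩ := ((SmoothBumpFunction.nhds_basis_tsupport (I := 𝓡∂ (n + 1)) x).mem_iff).1
    ((chartAt (EuclideanHalfSpace (n + 1)) p).open_source.mem_nhds hx)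
  set Y : Π y : Mbar, TangentSpace (𝓡∂ (n + 1)) y := (χ : Mbar → ℝ) • coordField p j with hY
  have hYs : ContMDiff (𝓡∂ (n + 1)) ((𝓡∂ (n + 1)).prod 𝓘(ℝ, EuclideanSpace ℝ (Fin (n + 1)))) ∞
      (fun x ↦ TotalSpace.mk' (EuclideanSpace ℝ (Fin (n + 1)))
        (E := (TangentSpace (𝓡∂ (n + 1)) : Mbar → Type _)) x (Y x)) := by
    intro y
    by_cases hy : y ∈ tsupport χ
    · exact (χ.contMDiff y).smul_section (contMDiffAt_coordField (hχs hy) j)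
    · refine (contMDiff_zeroSection ℝ _ y).congr_of_eventuallyEq ?_
      filter_upwards [(isClosed_tsupport χ).isOpen_compl.mem_nhds hy] with z hz
      have : χ z = 0 := image_eq_zero_of_notMem_tsupport hz
      simp [hY, this, zeroSection]
  have h1 := (hsmooth.contMDiff.contMDiff (σ := Y) (by simpa using hYs.contMDiffOn))
  have hk := contMDiffOn_coordField p k
  have h2 := (h1.mono (subset_univ _)).clm_bundle_apply hk
  have h3 := h2.coordComponent subset_rfl l
  refine (h3 x hx).congr_of_eventuallyEq_of_mem ?_ hx
  refine nhdsWithin_le_nhds ?_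
  filter_upwards [χ.eventuallyEq_one.eventuallyEq_nhds,
    (chartAt (EuclideanHalfSpace (n + 1)) p).open_source.mem_nhds hx] with y hy hys
  simp only [christoffel]
  congr 2
  refine nabla.isCovariantDerivativeOnUniv.congr_of_eventuallyEq
    (fieldDifferentiableAt_coordField hys j) ((hYs y).mdifferentiableAt (by simp)) univ_mem ?_
  filter_upwards [hy] with z hz
  simp [hY, hz]

end Charts

/-! ### The metricity equation for `τ⁻¹ g^{ij}` -/

section Matrices

variable {ι : Type*} [Fintype ι] [DecidableEq ι]

theorem contDiff_det : ContDiff ℝ ∞ (fun A : ι × ι → ℝ ↦ (Matrix.of fun i j ↦ A (i, j)).det) := by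
  simp only [Matrix.det_apply, Matrix.of_apply]
  refine ContDiff.sum fun σ _ ↦ ContDiff.const_smul _ (contDiff_prod fun i _ ↦ ?_)
  fun_prop

theorem contDiffAt_matrix_inv_apply {A : ι × ι → ℝ} (hA : (Matrix.of fun i j ↦ A (i, j)).det ≠ 0)
    (a b : ι) :
    ContDiffAt ℝ ∞ (fun A : ι × ι → ℝ ↦ (Matrix.of fun i j ↦ A (i, j))⁻¹ a b) A := by
  simp only [Matrix.inv_def, Ring.inverse_eq_inv', Matrix.smul_apply, smul_eq_mul,
    Matrix.adjugate_apply]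
  refine (contDiff_det.contDiffAt.inv hA).mul ?_
  have h : ContDiff ℝ ∞ (fun A : ι × ι → ℝ ↦ fun p : ι × ι ↦
      (Matrix.of fun i j ↦ A (i, j)).updateRow b (Pi.single a 1) p.1 p.2) := by
    refine contDiff_pi.2 fun p ↦ ?_
    by_cases hp : p.1 = b
    · simp only [Matrix.updateRow_apply, hp, if_true]
      exact contDiff_const
    · simp only [Matrix.updateRow_apply, hp, if_false, Matrix.of_apply]
      fun_prop
  exact (contDiff_det.comp h).contDiffAt

/-- Jacobi's formula for the derivative of the determinant. -/
theorem hasFDerivAt_det (A : ι × ι → ℝ) :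
    ∃ D : (ι × ι → ℝ) →L[ℝ] ℝ,
      HasFDerivAt (fun A : ι × ι → ℝ ↦ (Matrix.of fun i j ↦ A (i, j)).det) D A ∧
      ∀ H : Matrix ι ι ℝ, D (fun p ↦ H p.1 p.2) =
        ((Matrix.of fun i j ↦ A (i, j)).adjugate * H).trace := by
  have h1 : ∀ σ : Equiv.Perm ι, HasFDerivAt (fun A : ι × ι → ℝ ↦ ∏ i, A (σ i, i))
      (∑ i, (∏ j ∈ Finset.univ.erase i, A (σ j, j)) •
        (ContinuousLinearMap.proj (R := ℝ) (φ := fun _ : ι × ι ↦ ℝ) (σ i, i))) A := fun σ ↦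
    HasFDerivAt.finsetProd fun i _ ↦ hasFDerivAt_apply (σ i, i) A
  refine ⟨_, (HasFDerivAt.fun_sum fun σ (_ : σ ∈ Finset.univ) ↦
    (h1 σ).const_smul (Equiv.Perm.sign σ : ℝ)).congr_of_eventuallyEq
      (Eventually.of_forall fun A ↦ ?_), fun H ↦ ?_⟩
  · simp [Matrix.det_apply, Units.smul_def]
  · have h2 : ((Matrix.of fun i j ↦ A (i, j)).adjugate * H).trace =
        ∑ i, ((Matrix.of fun i j ↦ A (i, j)).updateCol i (fun k ↦ H k i)).det := by
      simp only [← Matrix.cramer_apply, Matrix.cramer_eq_adjugate_mulVec, Matrix.trace,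
        Matrix.diag_apply, Matrix.mul_apply, Matrix.mulVec, dotProduct]
    rw [h2]
    simp only [Matrix.det_apply]
    rw [Finset.sum_comm]
    simp only [sum_apply, smul_apply, ContinuousLinearMap.proj_apply, smul_eq_mul,
      Finset.mul_sum]
    refine Finset.sum_congr rfl fun σ _ ↦ Finset.sum_congr rfl fun i _ ↦ ?_
    rw [← Finset.mul_prod_erase _ _ (Finset.mem_univ i)]
    have h3 : ∏ j ∈ Finset.univ.erase i, (Matrix.of fun i j ↦ A (i, j)).updateCol i
        (fun k ↦ H k i) (σ j) j = ∏ j ∈ Finset.univ.erase i, A (σ j, j) :=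
      Finset.prod_congr rfl fun j hj ↦ by
        simp [Finset.ne_of_mem_erase hj]
    rw [h3]
    simp [Units.smul_def]
    ring

end Matrices

section Metricity

variable {n : ℕ} {Mbar : Type*} [TopologicalSpace Mbar]
  [ChartedSpace (EuclideanHalfSpace (n + 1)) Mbar] [IsManifold (𝓡∂ (n + 1)) ∞ Mbar]

omit [IsManifold (𝓡∂ (n + 1)) ∞ Mbar] in
theorem ContMDiffOn.matrix_inv_apply {ι : Type*} [Fintype ι] [DecidableEq ι] {s : Set Mbar}
    {A : Mbar → Matrix ι ι ℝ}
    (hA : ∀ i j, ContMDiffOn (𝓡∂ (n + 1)) 𝓘(ℝ, ℝ) ∞ (fun x ↦ A x i j) s)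
    (hdet : ∀ x ∈ s, (A x).det ≠ 0) (i j : ι) :
    ContMDiffOn (𝓡∂ (n + 1)) 𝓘(ℝ, ℝ) ∞ (fun x ↦ (A x)⁻¹ i j) s := fun x hx ↦
  (contDiffAt_matrix_inv_apply (A := fun p : ι × ι ↦ A x p.1 p.2) (hdet x hx) i
    j).contMDiffAt.comp_contMDiffWithinAt (f := fun y (p : ι × ι) ↦ A y p.1 p.2) x
      (contMDiffWithinAt_pi_space.2 fun p ↦ hA p.1 p.2 x hx)

omit [IsManifold (𝓡∂ (n + 1)) ∞ Mbar] in
theorem ContMDiffOn.matrix_det {ι : Type*} [Fintype ι] [DecidableEq ι] {s : Set Mbar}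
    {A : Mbar → Matrix ι ι ℝ}
    (hA : ∀ i j, ContMDiffOn (𝓡∂ (n + 1)) 𝓘(ℝ, ℝ) ∞ (fun x ↦ A x i j) s) :
    ContMDiffOn (𝓡∂ (n + 1)) 𝓘(ℝ, ℝ) ∞ (fun x ↦ (A x).det) s := fun x hx ↦
  contDiff_det.contMDiff.contMDiffAt.comp_contMDiffWithinAt (f := fun y (p : ι × ι) ↦ A y p.1 p.2) x
      (contMDiffWithinAt_pi_space.2 fun p ↦ hA p.1 p.2 x hx)

/-- The chain rule for a function of finitely many functions. -/
theorem coordDeriv_comp_pi {p x : Mbar}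
    (hx : x ∈ (chartAt (EuclideanHalfSpace (n + 1)) p).source) {ι : Type*} [Fintype ι]
    {f : ι → Mbar → ℝ} (hf : ∀ a, ContMDiffAt (𝓡∂ (n + 1)) 𝓘(ℝ, ℝ) ∞ (f a) x)
    {F : (ι → ℝ) → ℝ} {F' : (ι → ℝ) →L[ℝ] ℝ} (hF : HasFDerivAt F F' fun a ↦ f a x)
    (k : Fin (n + 1)) :
    coordDeriv p (fun y ↦ F fun a ↦ f a y) x k = F' fun a ↦ coordDeriv p (f a) x k := by
  set φ := extChartAt (𝓡∂ (n + 1)) p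
  have hφx : φ x ∈ φ.target := φ.map_source (by rwa [extChartAt_source])
  have hl : φ.symm (φ x) = x := φ.left_inv (by rwa [extChartAt_source])
  have hfm : MDifferentiableAt (𝓡∂ (n + 1)) 𝓘(ℝ, ι → ℝ) (fun y a ↦ f a y) x :=
    (contMDiffAt_pi_space.2 hf).mdifferentiableAt (by simp)
  have hFm : MDifferentiableAt (𝓡∂ (n + 1)) 𝓘(ℝ, ℝ) (fun y ↦ F fun a ↦ f a y) x :=
    (hF.differentiableAt.mdifferentiableAt).comp x hfm
  have hd : ∀ a, HasFDerivWithinAt (readInChart p (f a)) (fderivWithin ℝ (readInChart p (f a))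
      (range (𝓡∂ (n + 1))) (φ x)) (range (𝓡∂ (n + 1))) (φ x) := fun a ↦ by
    refine DifferentiableWithinAt.hasFDerivWithinAt ?_
    rw [← mdifferentiableWithinAt_iff_differentiableWithinAt]
    have hfa : MDifferentiableAt (𝓡∂ (n + 1)) 𝓘(ℝ, ℝ) (f a) (φ.symm (φ x)) :=
      hl.symm ▸ (hf a).mdifferentiableAt (by simp)
    exact hfa.comp_mdifferentiableWithinAt _ (mdifferentiableWithinAt_extChartAt_symm hφx)
  have hpi := hasFDerivWithinAt_pi.2 hd
  have hF' : HasFDerivAt F F' (fun a ↦ readInChart p (f a) (φ x)) := by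
    simpa only [φ, readInChart_extChartAt (n := n) hx] using hF
  have h := (hF'.comp_hasFDerivWithinAt _ hpi).fderivWithin ((𝓡∂ (n + 1)).uniqueDiffOn _
    (extChartAt_target_subset_range p hφx))
  rw [coordDeriv_eq_fderivWithin hx hFm]
  simp only [coordDeriv_eq_fderivWithin hx ((hf _).mdifferentiableAt (by simp))]
  have e : readInChart (n := n) p (fun y ↦ F fun a ↦ f a y) =
      F ∘ fun u a ↦ readInChart (n := n) p (f a) u := rfl
  rw [e, h]
  rfl

variable (g : PseudoRiemannianMetricOn (n := n) ((𝓡∂ (n + 1)).interior Mbar))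

theorem contMDiffOn_gram (p : Mbar) (i j : Fin (n + 1)) :
    ContMDiffOn (𝓡∂ (n + 1)) 𝓘(ℝ, ℝ) ∞ (fun y ↦ g.gram y (coordFrame p y) i j)
      ((chartAt (EuclideanHalfSpace (n + 1)) p).source ∩ (𝓡∂ (n + 1)).interior Mbar) := by
  intro x hx
  have h : ContMDiffWithinAt (𝓡∂ (n + 1)) ((𝓡∂ (n + 1)).prod 𝓘(ℝ)) ∞
      (fun m ↦ TotalSpace.mk' ℝ (E := Bundle.Trivial Mbar ℝ) m
        (g.toFun m (coordField p i m) (coordField p j m)))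
      ((chartAt (EuclideanHalfSpace (n + 1)) p).source ∩ (𝓡∂ (n + 1)).interior Mbar) x := by
    apply ContMDiffWithinAt.clm_bundle_apply₂ (F₁ := EuclideanSpace ℝ (Fin (n + 1)))
      (F₂ := EuclideanSpace ℝ (Fin (n + 1)))
    · exact (g.contMDiffOn.mono inter_subset_right) x hx
    · exact ((contMDiffOn_coordField p i).mono inter_subset_left) x hx
    · exact ((contMDiffOn_coordField p j).mono inter_subset_left) x hx
  simp only [contMDiffWithinAt_totalSpace] at h
  exact h.2

theorem gram_det_ne_zero {x : Mbar} (hx : x ∈ (𝓡∂ (n + 1)).interior Mbar)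
    {v : Fin (n + 1) → TangentSpace (𝓡∂ (n + 1)) x} (hv : LinearIndependent ℝ v) :
    (g.gram x v).det ≠ 0 := by
  intro h
  obtain ⟨c, hc, hcv⟩ := Matrix.exists_mulVec_eq_zero_iff.2 h
  have hspan : Submodule.span ℝ (range v) = ⊤ := hv.span_eq_top_of_card_eq_finrank (by
    rw [Fintype.card_fin]
    exact (finrank_euclideanSpace_fin (𝕜 := ℝ) (n := n + 1)).symm)
  have hz : ∑ j, c j • v j = 0 := by
    refine g.nondegenerate x hx _ fun w ↦ ?_
    have hw : w ∈ Submodule.span ℝ (range v) := hspan ▸ Submodule.mem_top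
    rw [g.symm x hx]
    induction hw using Submodule.span_induction with
    | mem y hy =>
      obtain ⟨i, rfl⟩ := hy
      have := congrFun hcv i
      simpa [Matrix.mulVec, dotProduct, PseudoRiemannianMetricOn.gram, mul_comm] using this
    | zero => simp
    | add y z _ _ hy hz => simp only [map_add, add_apply, hy, hz, add_zero]
    | smul a y _ hy => simp only [map_smul, smul_apply, hy, smul_zero]
  exact hc (funext fun j ↦ Fintype.linearIndependent_iff.1 hv c hz j)

theorem vol_pos {x : Mbar} (hx : x ∈ (𝓡∂ (n + 1)).interior Mbar)
    {v : Fin (n + 1) → TangentSpace (𝓡∂ (n + 1)) x} (hv : LinearIndependent ℝ v) :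
    0 < g.vol x v :=
  Real.sqrt_pos.2 (abs_pos.2 (gram_det_ne_zero g hx hv))

theorem tau_eq_exp {x : Mbar} (hx : x ∈ (𝓡∂ (n + 1)).interior Mbar)
    {v : Fin (n + 1) → TangentSpace (𝓡∂ (n + 1)) x} (hv : LinearIndependent ℝ v) :
    g.tau x v = Real.exp (-(Real.log (g.gram x v).det / ((n : ℝ) + 2))) := by
  rw [PseudoRiemannianMetricOn.tau, Real.rpow_def_of_pos (vol_pos g hx hv),
    PseudoRiemannianMetricOn.vol, Real.log_sqrt (abs_nonneg _), Real.log_abs]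
  congr 1
  ring

theorem coordDeriv_congr_of_eqOn {p x : Mbar} {s : Set Mbar} (hs : IsOpen s) (hx : x ∈ s)
    {f f' : Mbar → ℝ} (h : EqOn f f' s) (k : Fin (n + 1)) :
    coordDeriv p f x k = coordDeriv p f' x k :=
  coordDeriv_congr (h.eventuallyEq_of_mem (hs.mem_nhds hx)) k

variable {g} {nabla : AffineOperator n Mbar}

theorem connection_coordField {p x : Mbar}
    (hx : x ∈ (chartAt (EuclideanHalfSpace (n + 1)) p).source) (k j : Fin (n + 1)) :
    nabla (coordField p j) x (coordField p k x) =
      ∑ l, christoffel nabla p x l k j • coordField p l x :=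
  (sum_coordComponent_smul hx _).symm

/-- The matrix `(l, j) ↦ Γ^l_{kj}` of the connection in the direction of `∂_k`. -/
noncomputable def christoffelMatrix (nabla : AffineOperator n Mbar) (p x : Mbar)
    (k : Fin (n + 1)) : Matrix (Fin (n + 1)) (Fin (n + 1)) ℝ :=
  Matrix.of fun l j ↦ christoffel nabla p x l k j

/-- Compatibility of the connection with the metric: `∂_k G = Γ_kᵀ G + G Γ_k`. -/
theorem coordDeriv_gram (hnabla : IsLeviCivitaOn g nabla) {p x : Mbar}
    (hx : x ∈ (chartAt (EuclideanHalfSpace (n + 1)) p).source ∩ (𝓡∂ (n + 1)).interior Mbar)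
    (k i j : Fin (n + 1)) :
    coordDeriv p (fun y ↦ g.gram y (coordFrame p y) i j) x k =
      ((christoffelMatrix nabla p x k).transpose * g.gram x (coordFrame p x) +
        g.gram x (coordFrame p x) * christoffelMatrix nabla p x k) i j := by
  have h := hnabla.metric x hx.2 (coordField p i) (coordField p j)
    (fieldDifferentiableAt_coordField hx.1 i) (fieldDifferentiableAt_coordField hx.1 j)
    (coordField p k x)
  rw [connection_coordField hx.1, connection_coordField hx.1] at h
  refine h.trans ?_
  simp [christoffelMatrix, Matrix.mul_apply, PseudoRiemannianMetricOn.gram, coordFrame, sum_apply,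
    mul_comm]

/-- The derivative of `g^{ij}`, obtained by differentiating `G⁻¹ G = 1`. -/
theorem coordDeriv_gram_inv (hnabla : IsLeviCivitaOn g nabla) {p x : Mbar}
    (hx : x ∈ (chartAt (EuclideanHalfSpace (n + 1)) p).source ∩ (𝓡∂ (n + 1)).interior Mbar)
    (k i j : Fin (n + 1)) :
    coordDeriv p (fun y ↦ (g.gram y (coordFrame p y))⁻¹ i j) x k =
      -(christoffelMatrix nabla p x k * (g.gram x (coordFrame p x))⁻¹ +
        (g.gram x (coordFrame p x))⁻¹ * (christoffelMatrix nabla p x k).transpose) i j := by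
  set U := (chartAt (EuclideanHalfSpace (n + 1)) p).source ∩ (𝓡∂ (n + 1)).interior Mbar
  have hU : IsOpen U := isOpen_source_inter_interior p
  have hdet : ∀ y ∈ U, (g.gram y (coordFrame p y)).det ≠ 0 := fun y hy ↦
    gram_det_ne_zero g hy.2 (linearIndependent_coordFrame (n := n) hy.1)
  have hgs := fun a b ↦ ((contMDiffOn_gram g p a b).contMDiffAt (hU.mem_nhds hx)).mdifferentiableAt
    (by simp)
  have hGs := fun a b ↦ ((ContMDiffOn.matrix_inv_apply (contMDiffOn_gram g p) hdet a b).contMDiffAt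
    (hU.mem_nhds hx)).mdifferentiableAt (by simp)
  set γ := g.gram x (coordFrame p x) with hγ
  set Γ := christoffelMatrix nabla p x k
  set DG : Matrix (Fin (n + 1)) (Fin (n + 1)) ℝ := Matrix.of fun a b ↦
    coordDeriv p (fun y ↦ (g.gram y (coordFrame p y))⁻¹ a b) x k with hDG
  have hdetx : IsUnit γ.det := (hdet x hx).isUnit
  have hzero : DG * γ + γ⁻¹ * (Γ.transpose * γ + γ * Γ) = 0 := by
    ext a b
    have h1 : coordDeriv p (fun y ↦ ∑ c, (g.gram y (coordFrame p y))⁻¹ a c *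
        g.gram y (coordFrame p y) c b) x k = 0 := by
      rw [← coordDeriv_const p x ((1 : Matrix (Fin (n + 1)) (Fin (n + 1)) ℝ) a b) k]
      refine coordDeriv_congr_of_eqOn hU hx (fun y hy ↦ ?_) k
      rw [← Matrix.mul_apply, Matrix.nonsing_inv_mul _ (hdet y hy).isUnit]
    rw [coordDeriv_sum _ (f := fun c y ↦ (g.gram y (coordFrame p y))⁻¹ a c *
      g.gram y (coordFrame p y) c b) fun c _ ↦ (hGs a c).mul (hgs c b)] at h1
    simp only [coordDeriv_mul (hGs a _) (hgs _ b), coordDeriv_gram hnabla hx] at h1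
    rw [Matrix.add_apply, Matrix.mul_apply, Matrix.mul_apply, ← Finset.sum_add_distrib]
    exact h1
  have h2 : DG = -(Γ * γ⁻¹ + γ⁻¹ * Γ.transpose) := by
    have h3 := congrArg (· * γ⁻¹) hzero
    simp only [add_mul, zero_mul, mul_add, Matrix.mul_assoc, Matrix.mul_nonsing_inv _ hdetx,
      mul_one] at h3
    rw [← Matrix.mul_assoc γ⁻¹ γ, Matrix.nonsing_inv_mul _ hdetx, one_mul] at h3
    rw [eq_neg_iff_add_eq_zero, ← h3]
    abel
  exact congrFun (congrFun h2 i) j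

theorem coordDeriv_gram_det (hnabla : IsLeviCivitaOn g nabla) {p x : Mbar}
    (hx : x ∈ (chartAt (EuclideanHalfSpace (n + 1)) p).source ∩ (𝓡∂ (n + 1)).interior Mbar)
    (k : Fin (n + 1)) :
    coordDeriv p (fun y ↦ (g.gram y (coordFrame p y)).det) x k =
      2 * (∑ l, christoffel nabla p x l k l) * (g.gram x (coordFrame p x)).det := by
  obtain ⟨D, hD, hDH⟩ := hasFDerivAt_det fun q : Fin (n + 1) × Fin (n + 1) ↦
    g.gram x (coordFrame p x) q.1 q.2
  have h := coordDeriv_comp_pi hx.1 (f := fun (q : Fin (n + 1) × Fin (n + 1)) y ↦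
    g.gram y (coordFrame p y) q.1 q.2) (fun q ↦ (contMDiffOn_gram g p q.1 q.2).contMDiffAt
      ((isOpen_source_inter_interior p).mem_nhds hx)) hD k
  simp only [coordDeriv_gram hnabla hx] at h
  refine h.trans ((hDH _).trans ?_)
  have e : (Matrix.of fun i j ↦ g.gram x (coordFrame p x) i j) = g.gram x (coordFrame p x) := rfl
  rw [e, mul_add, Matrix.trace_add, Matrix.trace_mul_comm, Matrix.mul_assoc,
    Matrix.mul_adjugate, ← Matrix.mul_assoc, Matrix.adjugate_mul]
  simp [Matrix.trace, christoffelMatrix, ← Finset.mul_sum]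
  ring

/-- The density `τ` of weight `2` is parallel for the Levi-Civita connection. -/
theorem coordDeriv_tau (hnabla : IsLeviCivitaOn g nabla) {p x : Mbar}
    (hx : x ∈ (chartAt (EuclideanHalfSpace (n + 1)) p).source ∩ (𝓡∂ (n + 1)).interior Mbar)
    (k : Fin (n + 1)) :
    coordDeriv p (fun y ↦ g.tau y (coordFrame p y)) x k =
      -(2 / ((n : ℝ) + 2) * (∑ l, christoffel nabla p x l k l)) * g.tau x (coordFrame p x) := by
  have hd := gram_det_ne_zero g hx.2 (linearIndependent_coordFrame (n := n) hx.1)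
  rw [coordDeriv_congr_of_eqOn (isOpen_source_inter_interior p) hx
    (fun y hy ↦ tau_eq_exp g hy.2 (linearIndependent_coordFrame (n := n) hy.1)),
    tau_eq_exp g hx.2 (linearIndependent_coordFrame (n := n) hx.1)]
  have hφ := (((Real.hasDerivAt_log hd).div_const ((n : ℝ) + 2)).fun_neg).exp
  rw [coordDeriv_comp (((ContMDiffOn.matrix_det (contMDiffOn_gram g p)).contMDiffAt
    ((isOpen_source_inter_interior p).mem_nhds hx)).mdifferentiableAt (by simp)) hφ,
    coordDeriv_gram_det hnabla hx]
  field_simp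

theorem tau_pos {x : Mbar} (hx : x ∈ (𝓡∂ (n + 1)).interior Mbar)
    {v : Fin (n + 1) → TangentSpace (𝓡∂ (n + 1)) x} (hv : LinearIndependent ℝ v) :
    0 < g.tau x v := by
  rw [tau_eq_exp g hx hv]
  positivity

theorem contMDiffOn_tau (p : Mbar) :
    ContMDiffOn (𝓡∂ (n + 1)) 𝓘(ℝ, ℝ) ∞ (fun y ↦ g.tau y (coordFrame p y))
      ((chartAt (EuclideanHalfSpace (n + 1)) p).source ∩ (𝓡∂ (n + 1)).interior Mbar) := by
  have hU := isOpen_source_inter_interior (n := n) p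
  intro x hx
  have hd := gram_det_ne_zero g hx.2 (linearIndependent_coordFrame (n := n) hx.1)
  have h : ContDiffAt ℝ ∞ (fun t ↦ Real.exp (-(Real.log t / ((n : ℝ) + 2))))
      (g.gram x (coordFrame p x)).det :=
    (((Real.contDiffAt_log.2 hd).div_const _).neg).exp
  exact (h.contMDiffAt.comp_contMDiffWithinAt (f := fun y ↦ (g.gram y (coordFrame p y)).det) x
    ((ContMDiffOn.matrix_det (contMDiffOn_gram g p)) x hx)).congr_of_mem
      (fun y hy ↦ tau_eq_exp g hy.2 (linearIndependent_coordFrame (n := n) hy.1)) hx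

theorem contMDiffOn_tauInvMetric (p : Mbar) (K : Fin 2 → Fin (n + 1)) (L : Fin 0 → Fin (n + 1)) :
    ContMDiffOn (𝓡∂ (n + 1)) 𝓘(ℝ, ℝ) ∞ (fun y ↦ g.tauInvMetric p y K L)
      ((chartAt (EuclideanHalfSpace (n + 1)) p).source ∩ (𝓡∂ (n + 1)).interior Mbar) :=
  ((contMDiffOn_tau p).inv₀ fun _ hy ↦
    (tau_pos hy.2 (linearIndependent_coordFrame (n := n) hy.1)).ne').mul
      (ContMDiffOn.matrix_inv_apply (contMDiffOn_gram g p) (fun _ hy ↦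
        gram_det_ne_zero g hy.2 (linearIndependent_coordFrame (n := n) hy.1)) _ _)

/-- `τ⁻¹ g^{ij}`, of weight `-2`, is parallel for the Levi-Civita connection. -/
theorem coordDeriv_tauInvMetric (hnabla : IsLeviCivitaOn g nabla) {p x : Mbar}
    (hx : x ∈ (chartAt (EuclideanHalfSpace (n + 1)) p).source ∩ (𝓡∂ (n + 1)).interior Mbar)
    (k i j : Fin (n + 1)) :
    coordDeriv p (fun y ↦ g.tauInvMetric p y ![i, j] ![]) x k =
      2 / ((n : ℝ) + 2) * (∑ l, christoffel nabla p x l k l) * g.tauInvMetric p x ![i, j] ![]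
        - ∑ l, christoffel nabla p x i k l * g.tauInvMetric p x ![l, j] ![]
        - ∑ l, christoffel nabla p x j k l * g.tauInvMetric p x ![i, l] ![] := by
  have hU := isOpen_source_inter_interior (n := n) p
  have ht := (tau_pos (g := g) hx.2 (linearIndependent_coordFrame (n := n) hx.1)).ne'
  have htd := ((contMDiffOn_tau (g := g) p).contMDiffAt (hU.mem_nhds hx)).mdifferentiableAt
    (by simp)
  have hid := (((contMDiffOn_tau (g := g) p).inv₀ fun _ hy ↦
    (tau_pos hy.2 (linearIndependent_coordFrame (n := n) hy.1)).ne').contMDiffAt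
      (hU.mem_nhds hx)).mdifferentiableAt (by simp)
  have hGd := ((ContMDiffOn.matrix_inv_apply (contMDiffOn_gram g p) (fun _ hy ↦
        gram_det_ne_zero g hy.2 (linearIndependent_coordFrame (n := n) hy.1)) i j).contMDiffAt
    (hU.mem_nhds hx)).mdifferentiableAt (by simp)
  simp only [PseudoRiemannianMetricOn.tauInvMetric, Matrix.cons_val_zero, Matrix.cons_val_one]
  rw [coordDeriv_mul hid hGd, coordDeriv_comp htd (hasDerivAt_inv ht), coordDeriv_tau hnabla hx,
    coordDeriv_gram_inv hnabla hx]
  simp only [Matrix.add_apply, Matrix.mul_apply, Matrix.transpose_apply, christoffelMatrix,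
    Matrix.of_apply]
  simp only [mul_left_comm _ (g.tau x (coordFrame p x))⁻¹, ← Finset.mul_sum,
    mul_comm ((g.gram x (coordFrame p x))⁻¹ i _)]
  field_simp
  ring

theorem tauInvMetric_symm {x : Mbar} (p : Mbar) (hx : x ∈ (𝓡∂ (n + 1)).interior Mbar)
    (i j : Fin (n + 1)) : g.tauInvMetric p x ![i, j] ![] = g.tauInvMetric p x ![j, i] ![] := by
  have h : (g.gram x (coordFrame p x)).transpose = g.gram x (coordFrame p x) := by
    ext a b
    exact g.symm x hx _ _
  simp only [PseudoRiemannianMetricOn.tauInvMetric, Matrix.cons_val_zero, Matrix.cons_val_one]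
  rw [← Matrix.transpose_apply (g.gram x (coordFrame p x))⁻¹ j i, Matrix.transpose_nonsing_inv, h]

theorem covDeriv_two_zero (nabla : AffineOperator n Mbar) (p : Mbar) (w : ℝ)
    (T : Mbar → (Fin 2 → Fin (n + 1)) → (Fin 0 → Fin (n + 1)) → ℝ) (x : Mbar)
    (k i j : Fin (n + 1)) (L : Fin 0 → Fin (n + 1)) :
    covDeriv nabla p w T x k ![i, j] L = coordDeriv p (fun y ↦ T y ![i, j] L) x k
      + ∑ l, christoffel nabla p x i k l * T x ![l, j] L
      + ∑ l, christoffel nabla p x j k l * T x ![i, l] L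
      + w / ((n : ℝ) + 2) * (∑ l, christoffel nabla p x l k l) * T x ![i, j] L := by
  have h0 : ∀ l, Function.update ![i, j] 0 l = ![l, j] := fun l ↦ by
    ext a; fin_cases a <;> simp
  have h1 : ∀ l, Function.update ![i, j] 1 l = ![i, l] := fun l ↦ by
    ext a; fin_cases a <;> simp
  simp only [covDeriv, Fin.sum_univ_two, Finset.univ_eq_empty, Finset.sum_empty, h0, h1,
    Matrix.cons_val_zero, Matrix.cons_val_one]
  ring

theorem covDeriv_one_zero (nabla : AffineOperator n Mbar) (p : Mbar) (w : ℝ)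
    (T : Mbar → (Fin 1 → Fin (n + 1)) → (Fin 0 → Fin (n + 1)) → ℝ) (x : Mbar)
    (k i : Fin (n + 1)) (L : Fin 0 → Fin (n + 1)) :
    covDeriv nabla p w T x k ![i] L = coordDeriv p (fun y ↦ T y ![i] L) x k
      + ∑ l, christoffel nabla p x i k l * T x ![l] L
      + w / ((n : ℝ) + 2) * (∑ l, christoffel nabla p x l k l) * T x ![i] L := by
  have h0 : ∀ l, Function.update ![i] 0 l = ![l] := fun l ↦ by
    ext a; fin_cases a; simp
  simp only [covDeriv, Finset.univ_unique, Fin.default_eq_zero, Finset.sum_singleton,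
    Finset.univ_eq_empty, Finset.sum_empty, h0, Matrix.cons_val_zero]
  ring

theorem covDeriv_zero_zero (nabla : AffineOperator n Mbar) (p : Mbar) (w : ℝ)
    (T : Mbar → (Fin 0 → Fin (n + 1)) → (Fin 0 → Fin (n + 1)) → ℝ) (x : Mbar)
    (k : Fin (n + 1)) (K L : Fin 0 → Fin (n + 1)) :
    covDeriv nabla p w T x k K L = coordDeriv p (fun y ↦ T y K L) x k
      + w / ((n : ℝ) + 2) * (∑ l, christoffel nabla p x l k l) * T x K L := by
  simp [covDeriv]

section ProjectiveChange

variable {nabla' : AffineOperator n Mbar} {Υ : Π x : Mbar, TangentSpace (𝓡∂ (n + 1)) x →L[ℝ] ℝ}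
  {s : Set Mbar}

theorem christoffel_projectiveChange
    (hΥ : ∀ x ∈ s, ∀ Y : Π y : Mbar, TangentSpace (𝓡∂ (n + 1)) y, FieldDifferentiableAt Y x →
      ∀ v : TangentSpace (𝓡∂ (n + 1)) x,
        nabla' Y x v = nabla Y x v + Υ x v • Y x + Υ x (Y x) • v)
    {p x : Mbar} (hx : x ∈ (chartAt (EuclideanHalfSpace (n + 1)) p).source ∩ s)
    (l k j : Fin (n + 1)) :
    christoffel nabla' p x l k j = christoffel nabla p x l k j
      + Υ x (coordField p k x) * (if l = j then 1 else 0)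
      + Υ x (coordField p j x) * (if l = k then 1 else 0) := by
  simp only [christoffel, hΥ x hx.2 _ (fieldDifferentiableAt_coordField hx.1 j),
    coordComponent_add, coordComponent_smul, coordComponent_coordField hx.1]

theorem sum_christoffel_projectiveChange
    (hΥ : ∀ x ∈ s, ∀ Y : Π y : Mbar, TangentSpace (𝓡∂ (n + 1)) y, FieldDifferentiableAt Y x →
      ∀ v : TangentSpace (𝓡∂ (n + 1)) x,
        nabla' Y x v = nabla Y x v + Υ x v • Y x + Υ x (Y x) • v)
    {p x : Mbar} (hx : x ∈ (chartAt (EuclideanHalfSpace (n + 1)) p).source ∩ s)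
    (k : Fin (n + 1)) :
    ∑ l, christoffel nabla' p x l k l = ∑ l, christoffel nabla p x l k l
      + ((n : ℝ) + 2) * Υ x (coordField p k x) := by
  simp only [christoffel_projectiveChange hΥ hx, Finset.sum_add_distrib]
  simp
  ring

end ProjectiveChange

variable {nabla' : AffineOperator n Mbar}

/-- The metricity equation `∂_k h^{ij} = -δ_k^i λ^j - δ_k^j λ^i` (up to connection terms) for
`h = τ⁻¹ g⁻¹`, in terms of an arbitrary connection in the projective class. -/
theorem coordDeriv_tauInvMetric_of_projectivelyEquivalentOn (hnabla : IsLeviCivitaOn g nabla)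
    (hproj : ProjectivelyEquivalentOn nabla nabla' ((𝓡∂ (n + 1)).interior Mbar)) {p x : Mbar}
    (hx : x ∈ (chartAt (EuclideanHalfSpace (n + 1)) p).source ∩ (𝓡∂ (n + 1)).interior Mbar)
    (k i j : Fin (n + 1)) :
    coordDeriv p (fun y ↦ g.tauInvMetric p y ![i, j] ![]) x k =
      2 / ((n : ℝ) + 2) * (∑ l, christoffel nabla' p x l k l) * g.tauInvMetric p x ![i, j] ![]
        - ∑ l, christoffel nabla' p x i k l * g.tauInvMetric p x ![l, j] ![]
        - ∑ l, christoffel nabla' p x j k l * g.tauInvMetric p x ![i, l] ![]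
        - (if k = i then 1 else 0) * liftMiddle nabla' p (g.tauInvMetric p) x ![j] ![]
        - (if k = j then 1 else 0) * liftMiddle nabla' p (g.tauInvMetric p) x ![i] ![] := by
  obtain ⟨Υ, -, hΥ⟩ := hproj
  -- Up to sign this is the middle slot of the lift, since contracting `key` yields
  -- `∇_i h^{ij} = (n + 2) W^j`.
  set W : Fin (n + 1) → ℝ := fun j ↦ ∑ l, Υ x (coordField p l x) * g.tauInvMetric p x ![l, j] ![]
    with hW
  have key : ∀ k i j, coordDeriv p (fun y ↦ g.tauInvMetric p y ![i, j] ![]) x k =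
      2 / ((n : ℝ) + 2) * (∑ l, christoffel nabla' p x l k l) * g.tauInvMetric p x ![i, j] ![]
        - ∑ l, christoffel nabla' p x i k l * g.tauInvMetric p x ![l, j] ![]
        - ∑ l, christoffel nabla' p x j k l * g.tauInvMetric p x ![i, l] ![]
        + (if k = i then 1 else 0) * W j + (if k = j then 1 else 0) * W i := by
    intro k i j
    have e1 : ∑ l, christoffel nabla' p x i k l * g.tauInvMetric p x ![l, j] ![] =
        ∑ l, christoffel nabla p x i k l * g.tauInvMetric p x ![l, j] ![]
          + Υ x (coordField p k x) * g.tauInvMetric p x ![i, j] ![]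
          + (if k = i then 1 else 0) * W j := by
      simp only [christoffel_projectiveChange hΥ hx, add_mul, Finset.sum_add_distrib, hW]
      simp [eq_comm (a := k), Finset.mul_sum]
    have e2 : ∑ l, christoffel nabla' p x j k l * g.tauInvMetric p x ![i, l] ![] =
        ∑ l, christoffel nabla p x j k l * g.tauInvMetric p x ![i, l] ![]
          + Υ x (coordField p k x) * g.tauInvMetric p x ![i, j] ![]
          + (if k = j then 1 else 0) * W i := by
      simp only [christoffel_projectiveChange hΥ hx, add_mul, Finset.sum_add_distrib, hW]
      simp [eq_comm (a := k), Finset.mul_sum, tauInvMetric_symm (g := g) p hx.2 i]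
    rw [coordDeriv_tauInvMetric hnabla hx, e1, e2, sum_christoffel_projectiveChange hΥ hx]
    field_simp
    ring
  have hmid : ∀ j, liftMiddle nabla' p (g.tauInvMetric p) x ![j] ![] = -W j := by
    intro j
    have e : ∀ i, covDeriv nabla' p (-2) (g.tauInvMetric p) x i ![i, j] ![] =
        W j + (if i = j then 1 else 0) * W i := fun i ↦ by
      rw [covDeriv_two_zero, key]
      simp only [if_true]
      ring
    simp only [liftMiddle, Matrix.cons_val_zero, e, Finset.sum_add_distrib]
    simp
    field_simp
    ring
  rw [hmid, hmid, key]
  ring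

end Metricity

/-! ### Smooth extension of the tractor lift -/

section TractorLift

variable {n : ℕ} {Mbar : Type*} [TopologicalSpace Mbar]
  [ChartedSpace (EuclideanHalfSpace (n + 1)) Mbar] [IsManifold (𝓡∂ (n + 1)) ∞ Mbar]

theorem ContMDiffOn.coordDeriv_interior {p : Mbar} {f : Mbar → ℝ}
    (hf : ContMDiffOn (𝓡∂ (n + 1)) 𝓘(ℝ, ℝ) ∞ f
      ((chartAt (EuclideanHalfSpace (n + 1)) p).source ∩ (𝓡∂ (n + 1)).interior Mbar))
    (k : Fin (n + 1)) :
    ContMDiffOn (𝓡∂ (n + 1)) 𝓘(ℝ, ℝ) ∞ (fun x ↦ _root_.coordDeriv p f x k)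
      ((chartAt (EuclideanHalfSpace (n + 1)) p).source ∩ (𝓡∂ (n + 1)).interior Mbar) := by
  rw [contMDiffOn_interior_iff_readInChart] at hf ⊢
  refine (hf.partialDeriv (isOpen_interior.inter (isOpen_chartOpen p)) k).congr fun u hu ↦ ?_
  rw [← contMDiffOn_interior_iff_readInChart] at hf
  rw [← image_extChartAt_interior] at hu
  obtain ⟨x, hx, rfl⟩ := hu
  rw [readInChart_extChartAt hx.1, coordDeriv_eq_partialDeriv hx]
  exact (hf.contMDiffAt ((isOpen_source_inter_interior p).mem_nhds hx)).mdifferentiableAt (by simp)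

theorem ContDiffOn.comp_extChartAt {p : Mbar} {G : EuclideanSpace ℝ (Fin (n + 1)) → ℝ}
    (hG : ContDiffOn ℝ ∞ G (range (𝓡∂ (n + 1)) ∩ chartOpen p)) :
    ContMDiffOn (𝓡∂ (n + 1)) 𝓘(ℝ, ℝ) ∞ (G ∘ extChartAt (𝓡∂ (n + 1)) p)
      (chartAt (EuclideanHalfSpace (n + 1)) p).source := by
  rw [contMDiffOn_source_iff_readInChart]
  refine hG.congr fun u hu ↦ ?_
  rw [← extChartAt_target_eq] at hu
  simp only [readInChart, Function.comp_apply]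
  rw [(extChartAt (𝓡∂ (n + 1)) p).right_inv hu]

theorem contMDiffOn_schoutenTensor {nabla' : AffineOperator n Mbar} {p : Mbar}
    (hΓ : ∀ l k j, ContMDiffOn (𝓡∂ (n + 1)) 𝓘(ℝ, ℝ) ∞ (fun x ↦ christoffel nabla' p x l k j)
      (chartAt (EuclideanHalfSpace (n + 1)) p).source) (i j : Fin (n + 1)) :
    ContMDiffOn (𝓡∂ (n + 1)) 𝓘(ℝ, ℝ) ∞ (fun x ↦ schoutenTensor nabla' p x i j)
      (chartAt (EuclideanHalfSpace (n + 1)) p).source := by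
  have hR : ∀ i j k l, ContMDiffOn (𝓡∂ (n + 1)) 𝓘(ℝ, ℝ) ∞
      (fun x ↦ riemannTensor nabla' p x i j k l)
      (chartAt (EuclideanHalfSpace (n + 1)) p).source := fun i j k l ↦
    (((hΓ k j l).coordDeriv i).sub ((hΓ k i l).coordDeriv j)).add (contMDiffOn_finsetSum
      fun m _ ↦ ((hΓ k i m).mul (hΓ m j l)).sub ((hΓ k j m).mul (hΓ m i l)))
  have hRic : ∀ i j, ContMDiffOn (𝓡∂ (n + 1)) 𝓘(ℝ, ℝ) ∞ (fun x ↦ ricciTensor nabla' p x i j)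
      (chartAt (EuclideanHalfSpace (n + 1)) p).source := fun i j ↦
    contMDiffOn_finsetSum fun k _ ↦ hR k i k j
  simp only [schoutenTensor, div_eq_mul_inv]
  exact ((contMDiffOn_const.mul (hRic i j)).add (hRic j i)).mul contMDiffOn_const

variable {g : PseudoRiemannianMetricOn (n := n) ((𝓡∂ (n + 1)).interior Mbar)}
  {nabla nabla' : AffineOperator n Mbar} {p : Mbar}

theorem contMDiffOn_liftMiddle
    (hΓ : ∀ l k j, ContMDiffOn (𝓡∂ (n + 1)) 𝓘(ℝ, ℝ) ∞ (fun x ↦ christoffel nabla' p x l k j)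
      (chartAt (EuclideanHalfSpace (n + 1)) p).source) (i : Fin (n + 1)) :
    ContMDiffOn (𝓡∂ (n + 1)) 𝓘(ℝ, ℝ) ∞
      (fun x ↦ liftMiddle nabla' p (g.tauInvMetric p) x ![i] ![])
      ((chartAt (EuclideanHalfSpace (n + 1)) p).source ∩ (𝓡∂ (n + 1)).interior Mbar) := by
  simp only [liftMiddle, Matrix.cons_val_zero, covDeriv_two_zero]
  have hΓ' := fun l k j ↦ (hΓ l k j).mono
    (inter_subset_left (t := (𝓡∂ (n + 1)).interior Mbar))
  have hh := fun K L ↦ contMDiffOn_tauInvMetric (g := g) p K L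
  exact contMDiffOn_const.mul (contMDiffOn_finsetSum fun k _ ↦
    ((((hh _ _).coordDeriv_interior k).add (contMDiffOn_finsetSum fun l _ ↦
      (hΓ' _ _ _).mul (hh _ _))).add (contMDiffOn_finsetSum fun l _ ↦
      (hΓ' _ _ _).mul (hh _ _))).add ((contMDiffOn_const.mul (contMDiffOn_finsetSum fun l _ ↦
      hΓ' _ _ _)).mul (hh _ _)))

/-- The prolongation of `τ⁻¹ g⁻¹` read in the preferred chart around `p`. -/
noncomputable def metricProlongation (g : PseudoRiemannianMetricOn (n := n)
    ((𝓡∂ (n + 1)).interior Mbar)) (nabla' : AffineOperator n Mbar) (p : Mbar) :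
    (Fin (n + 1) × Fin (n + 1)) ⊕ Fin (n + 1) ⊕ Unit → EuclideanSpace ℝ (Fin (n + 1)) → ℝ :=
  prolongation (fun i j ↦ readInChart p fun x ↦ g.tauInvMetric p x ![i, j] ![])
    fun i ↦ readInChart p fun x ↦ liftMiddle nabla' p (g.tauInvMetric p) x ![i] ![]

omit [IsManifold (𝓡∂ (n + 1)) ∞ Mbar] in
theorem uniqueDiffOn_chart (p : Mbar) :
    UniqueDiffOn ℝ (range (𝓡∂ (n + 1)) ∩ chartOpen p) :=
  (𝓡∂ (n + 1)).uniqueDiffOn.inter (isOpen_chartOpen p)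

/-- The metricity equation makes `(h, λ, ∂_i λ^i)` a closed linear system with coefficients smooth
up to the boundary. -/
theorem partialDeriv_metricProlongation_mem (hn : 1 ≤ n) (hnabla : IsLeviCivitaOn g nabla)
    (hproj : ProjectivelyEquivalentOn nabla nabla' ((𝓡∂ (n + 1)).interior Mbar))
    (hΓ : ∀ l k j, ContMDiffOn (𝓡∂ (n + 1)) 𝓘(ℝ, ℝ) ∞ (fun x ↦ christoffel nabla' p x l k j)
      (chartAt (EuclideanHalfSpace (n + 1)) p).source)
    (a : (Fin (n + 1) × Fin (n + 1)) ⊕ Fin (n + 1) ⊕ Unit) (k : Fin (n + 1)) :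
    partialDeriv k (metricProlongation g nabla' p a) ∈
      smoothSpan (range (𝓡∂ (n + 1)) ∩ chartOpen p)
        (interior (range (𝓡∂ (n + 1))) ∩ chartOpen p) (metricProlongation g nabla' p) := by
  have hΓ' := fun l k j ↦ (contMDiffOn_source_iff_readInChart p _).1 (hΓ l k j)
  refine partialDeriv_prolongation_mem (by omega) (uniqueDiffOn_chart p)
    (isOpen_interior.inter (isOpen_chartOpen p)) (inter_subset_inter_left _ interior_subset)
    (fun i j ↦ (contMDiffOn_interior_iff_readInChart p _).1 (contMDiffOn_tauInvMetric p _ _))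
    (fun i ↦ (contMDiffOn_interior_iff_readInChart p _).1 (contMDiffOn_liftMiddle hΓ i))
    (fun k i j ↦ ?_) a k
  set T := range (𝓡∂ (n + 1)) ∩ chartOpen (n := n) p
  set Ω := interior (range (𝓡∂ (n + 1))) ∩ chartOpen (n := n) p
  set h : Fin (n + 1) × Fin (n + 1) → EuclideanSpace ℝ (Fin (n + 1)) → ℝ :=
    fun q ↦ readInChart p fun x ↦ g.tauInvMetric p x ![q.1, q.2] ![]
  have hγ : ContDiffOn ℝ ∞ (fun u ↦ 2 / ((n : ℝ) + 2) *
      ∑ l, readInChart p (fun x ↦ christoffel nabla' p x l k l) u) T :=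
    contDiffOn_const.mul (ContDiffOn.sum fun l _ ↦ hΓ' l k l)
  refine smoothSpan.congr (sub_mem (sub_mem
    (smoothSpan.mul_mem hγ (smoothSpan.generator_mem (f := h) (i, j)))
    (smoothSpan.sum_mem Finset.univ fun l _ ↦
      smoothSpan.mul_mem (hΓ' i k l) (smoothSpan.generator_mem (f := h) (l, j))))
    (smoothSpan.sum_mem Finset.univ fun l _ ↦
      smoothSpan.mul_mem (hΓ' j k l) (smoothSpan.generator_mem (f := h) (i, l)))) fun u hu ↦ ?_
  obtain ⟨x, hx, rfl⟩ := (image_extChartAt_interior p).ge hu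
  have hd : MDifferentiableAt (𝓡∂ (n + 1)) 𝓘(ℝ, ℝ) (fun x ↦ g.tauInvMetric p x ![i, j] ![]) x :=
    ((contMDiffOn_tauInvMetric p _ _).contMDiffAt
      ((isOpen_source_inter_interior p).mem_nhds hx)).mdifferentiableAt (by simp)
  simp only [← coordDeriv_eq_partialDeriv hx hd, Pi.sub_apply, h, readInChart_extChartAt hx.1]
  rw [coordDeriv_tauInvMetric_of_projectivelyEquivalentOn hnabla hproj hx]
  ring

/-- The bottom slot is a combination of `h`, `λ` and `∂_i λ^i`: its only derivative of `λ` is the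
divergence. -/
theorem liftBottom_mem_smoothSpan
    (hΓ : ∀ l k j, ContMDiffOn (𝓡∂ (n + 1)) 𝓘(ℝ, ℝ) ∞ (fun x ↦ christoffel nabla' p x l k j)
      (chartAt (EuclideanHalfSpace (n + 1)) p).source) :
    readInChart p (liftBottom nabla' p (g.tauInvMetric p)) ∈
      smoothSpan (range (𝓡∂ (n + 1)) ∩ chartOpen p)
        (interior (range (𝓡∂ (n + 1))) ∩ chartOpen p) (metricProlongation g nabla' p) := by
  have hΓ' := fun l k j ↦ (contMDiffOn_source_iff_readInChart p _).1 (hΓ l k j)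
  have hP := fun i j ↦ (contMDiffOn_source_iff_readInChart p _).1
    (contMDiffOn_schoutenTensor hΓ i j)
  set T := range (𝓡∂ (n + 1)) ∩ chartOpen (n := n) p
  set Ω := interior (range (𝓡∂ (n + 1))) ∩ chartOpen (n := n) p
  have hγ : ∀ k, ContDiffOn ℝ ∞ (fun u ↦ -2 / ((n : ℝ) + 2) *
      ∑ l, readInChart p (fun x ↦ christoffel nabla' p x l k l) u) T := fun k ↦
    contDiffOn_const.mul (ContDiffOn.sum fun l _ ↦ hΓ' l k l)
  set f := metricProlongation g nabla' p with hf
  have hgen := fun a ↦ smoothSpan.generator_mem (T := T) (Ω := Ω) (f := f) a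
  refine smoothSpan.congr (smoothSpan.mul_mem (contDiffOn_const (c := 1 / ((n : ℝ) + 1)))
    (sub_mem (smoothSpan.sum_mem Finset.univ fun i _ ↦ smoothSpan.sum_mem Finset.univ fun j _ ↦
      smoothSpan.mul_mem (hP i j) (hgen (Sum.inl (i, j))))
      (add_mem (hgen (Sum.inr (Sum.inr ()))) (smoothSpan.sum_mem Finset.univ fun i _ ↦ add_mem
        (smoothSpan.sum_mem Finset.univ fun l _ ↦
          smoothSpan.mul_mem (hΓ' i i l) (hgen (Sum.inr (Sum.inl l))))
        (smoothSpan.mul_mem (hγ i) (hgen (Sum.inr (Sum.inl i)))))))) fun u hu ↦ ?_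
  obtain ⟨x, hx, rfl⟩ := (image_extChartAt_interior p).ge hu
  have hd : ∀ i, MDifferentiableAt (𝓡∂ (n + 1)) 𝓘(ℝ, ℝ)
      (fun x ↦ liftMiddle nabla' p (g.tauInvMetric p) x ![i] ![]) x := fun i ↦
    ((contMDiffOn_liftMiddle hΓ i).contMDiffAt
      ((isOpen_source_inter_interior p).mem_nhds hx)).mdifferentiableAt (by simp)
  simp only [hf, metricProlongation, prolongation, Sum.elim_inl, Sum.elim_inr, Pi.sub_apply,
    Pi.add_apply, readInChart_extChartAt hx.1, ← coordDeriv_eq_partialDeriv hx (hd _), liftBottom,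
    covDeriv_one_zero, Finset.sum_add_distrib]
  ring

theorem exists_contMDiffOn_extension_liftMatrix (hn : 1 ≤ n) (hnabla : IsLeviCivitaOn g nabla)
    (hproj : ProjectivelyEquivalentOn nabla nabla' ((𝓡∂ (n + 1)).interior Mbar))
    (hΓ : ∀ l k j, ContMDiffOn (𝓡∂ (n + 1)) 𝓘(ℝ, ℝ) ∞ (fun x ↦ christoffel nabla' p x l k j)
      (chartAt (EuclideanHalfSpace (n + 1)) p).source) (a b : Fin (n + 1) ⊕ Unit) :
    ∃ G : Mbar → ℝ, ContMDiffOn (𝓡∂ (n + 1)) 𝓘(ℝ, ℝ) ∞ G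
        (chartAt (EuclideanHalfSpace (n + 1)) p).source ∧
      EqOn G (fun x ↦ g.liftMatrix nabla' p x a b)
        ((chartAt (EuclideanHalfSpace (n + 1)) p).source ∩ (𝓡∂ (n + 1)).interior Mbar) := by
  have hmem : readInChart p (fun x ↦ g.liftMatrix nabla' p x a b) ∈
      smoothSpan (range (𝓡∂ (n + 1)) ∩ chartOpen p)
        (interior (range (𝓡∂ (n + 1))) ∩ chartOpen p) (metricProlongation g nabla' p) := by
    rcases a with i | _ <;> rcases b with j | _
    · exact smoothSpan.generator_mem (f := metricProlongation g nabla' p) (Sum.inl (i, j))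
    · exact smoothSpan.generator_mem (f := metricProlongation g nabla' p) (Sum.inr (Sum.inl i))
    · exact smoothSpan.generator_mem (f := metricProlongation g nabla' p) (Sum.inr (Sum.inl j))
    · exact liftBottom_mem_smoothSpan hΓ
  have hΩ : IsOpen (interior (range (𝓡∂ (n + 1))) ∩ chartOpen (n := n) p) :=
    isOpen_interior.inter (isOpen_chartOpen p)
  have hh : ∀ i j, ContDiffOn ℝ ∞ (readInChart p fun x ↦ g.tauInvMetric p x ![i, j] ![])
      (interior (range (𝓡∂ (n + 1))) ∩ chartOpen p) := fun i j ↦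
    (contMDiffOn_interior_iff_readInChart p _).1 (contMDiffOn_tauInvMetric p _ _)
  have hlam : ∀ i, ContDiffOn ℝ ∞
      (readInChart p fun x ↦ liftMiddle nabla' p (g.tauInvMetric p) x ![i] ![])
      (interior (range (𝓡∂ (n + 1))) ∩ chartOpen p) := fun i ↦
    (contMDiffOn_interior_iff_readInChart p _).1 (contMDiffOn_liftMiddle hΓ i)
  have hfd : ∀ a, DifferentiableOn ℝ (metricProlongation g nabla' p a)
      (interior (range (𝓡∂ (n + 1))) ∩ chartOpen p) := by
    rintro (q | i | _)
    · exact (hh q.1 q.2).differentiableOn (by simp)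
    · exact (hlam i).differentiableOn (by simp)
    · exact (ContDiffOn.sum (s := Finset.univ) fun i _ ↦
        (hlam i).partialDeriv hΩ i).differentiableOn (by simp)
  obtain ⟨G, hG, hGe⟩ := exists_contDiffOn_extension_of_partialDeriv_mem
    (𝓡∂ (n + 1)).convex_range (𝓡∂ (n + 1)).isClosed_range (𝓡∂ (n + 1)).nonempty_interior
    (isOpen_chartOpen p) hfd (partialDeriv_metricProlongation_mem hn hnabla hproj hΓ) hmem
  refine ⟨_, hG.comp_extChartAt, fun x hx ↦ ?_⟩
  rw [Function.comp_apply, hGe ((mem_interior_iff_extChartAt hx.1).1 hx.2),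
    readInChart_extChartAt hx.1]

/-- The lift extends smoothly to the boundary, so the extension by continuity is its smooth
extension. -/
theorem contMDiffOn_extendedLiftMatrix (hn : 1 ≤ n) (hnabla : IsLeviCivitaOn g nabla)
    (hproj : ProjectivelyEquivalentOn nabla nabla' ((𝓡∂ (n + 1)).interior Mbar))
    (hΓ : ∀ l k j, ContMDiffOn (𝓡∂ (n + 1)) 𝓘(ℝ, ℝ) ∞ (fun x ↦ christoffel nabla' p x l k j)
      (chartAt (EuclideanHalfSpace (n + 1)) p).source) :
    (∀ a b, ContMDiffOn (𝓡∂ (n + 1)) 𝓘(ℝ, ℝ) ∞ (fun x ↦ g.extendedLiftMatrix nabla' p x a b)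
        (chartAt (EuclideanHalfSpace (n + 1)) p).source) ∧
      ∀ x ∈ (chartAt (EuclideanHalfSpace (n + 1)) p).source ∩ (𝓡∂ (n + 1)).interior Mbar,
        g.extendedLiftMatrix nabla' p x = g.liftMatrix nabla' p x := by
  choose G hG hGe using exists_contMDiffOn_extension_liftMatrix (g := g) hn hnabla hproj hΓ
  have key : ∀ x ∈ (chartAt (EuclideanHalfSpace (n + 1)) p).source,
      g.extendedLiftMatrix nabla' p x = Matrix.of fun a b ↦ G a b x := by
    intro x hx
    refine extendFrom_eq (dense_interior x) ?_
    refine tendsto_pi_nhds.2 fun a ↦ tendsto_pi_nhds.2 fun b ↦ ?_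
    have hc : Tendsto (G a b) (𝓝[(𝓡∂ (n + 1)).interior Mbar] x) (𝓝 (G a b x)) :=
      (((hG a b).continuousOn.continuousAt
        ((chartAt (EuclideanHalfSpace (n + 1)) p).open_source.mem_nhds hx)).tendsto).mono_left
          inf_le_left
    refine hc.congr' ?_
    filter_upwards [self_mem_nhdsWithin, mem_nhdsWithin_of_mem_nhds
      ((chartAt (EuclideanHalfSpace (n + 1)) p).open_source.mem_nhds hx)] with y hy hy'
    exact hGe a b ⟨hy', hy⟩
  refine ⟨fun a b ↦ (hG a b).congr fun x hx ↦ by rw [key x hx]; rfl, fun x hx ↦ ?_⟩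
  rw [key x hx.1]
  ext a b
  exact hGe a b hx

end TractorLift

/-! ### The derivative of the bottom slot of the inverse -/

section InverseDerivative

variable {n : ℕ} {Mbar : Type*} [TopologicalSpace Mbar]
  [ChartedSpace (EuclideanHalfSpace (n + 1)) Mbar] [IsManifold (𝓡∂ (n + 1)) ∞ Mbar]

/-- If `r` is a row of the inverse of the symmetric matrix `F`, then the derivative of its diagonal
entry is `-(r ∂F rᵀ)`. -/
theorem coordDeriv_inv_row {ι : Type*} [Fintype ι] [DecidableEq ι] {p x : Mbar} {U : Set Mbar}
    (hU : IsOpen U) (hx : x ∈ U) {F : Mbar → Matrix ι ι ℝ} {r : Mbar → ι → ℝ} (c : ι)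
    (hF : ∀ a b, MDifferentiableAt (𝓡∂ (n + 1)) 𝓘(ℝ, ℝ) (fun y ↦ F y a b) x)
    (hr : ∀ a, MDifferentiableAt (𝓡∂ (n + 1)) 𝓘(ℝ, ℝ) (fun y ↦ r y a) x)
    (hrF : ∀ y ∈ U, ∀ b, ∑ a, r y a * F y a b = if c = b then 1 else 0)
    (hsymm : ∀ a b, F x a b = F x b a) (k : Fin (n + 1)) :
    coordDeriv p (fun y ↦ r y c) x k =
      -∑ a, ∑ b, r x a * r x b * coordDeriv p (fun y ↦ F y a b) x k := by
  have h1 : ∀ b, ∑ a, (coordDeriv p (fun y ↦ r y a) x k * F x a b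
      + r x a * coordDeriv p (fun y ↦ F y a b) x k) = 0 := fun b ↦ by
    have h : coordDeriv p (fun y ↦ ∑ a, r y a * F y a b) x k = 0 := by
      rw [← coordDeriv_const p x (if c = b then 1 else 0) k]
      exact coordDeriv_congr_of_eqOn hU hx (fun y hy ↦ hrF y hy b) k
    rw [coordDeriv_sum _ (f := fun a y ↦ r y a * F y a b) fun a _ ↦ (hr a).mul (hF a b)] at h
    simpa only [coordDeriv_mul (hr _) (hF _ b)] using h
  have h2 : ∑ b, r x b * ∑ a, (coordDeriv p (fun y ↦ r y a) x k * F x a b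
      + r x a * coordDeriv p (fun y ↦ F y a b) x k) = 0 := by simp only [h1, mul_zero,
        Finset.sum_const_zero]
  have h3 : ∑ b, r x b * ∑ a, coordDeriv p (fun y ↦ r y a) x k * F x a b =
      coordDeriv p (fun y ↦ r y c) x k := by
    simp only [Finset.mul_sum]
    rw [Finset.sum_comm]
    have : ∀ a, ∑ b, r x b * (coordDeriv p (fun y ↦ r y a) x k * F x a b) =
        coordDeriv p (fun y ↦ r y a) x k * if c = a then 1 else 0 := fun a ↦ by
      rw [← hrF x hx a, Finset.mul_sum]
      exact Finset.sum_congr rfl fun b _ ↦ by rw [hsymm a b]; ring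
    simp [this]
  simp only [Finset.sum_add_distrib, mul_add] at h2
  rw [h3] at h2
  rw [eq_neg_iff_add_eq_zero, ← h2, Finset.sum_comm]
  simp only [Finset.mul_sum]
  congr 1
  exact Finset.sum_congr rfl fun b _ ↦ Finset.sum_congr rfl fun a _ ↦ by ring

/-- For a symmetric tractor `F` with slots `(h, λ, ν)` and the bottom row `r = (μ, σ)` of its
inverse, the components `κ_k`, in the chart around `p`, for which `∇_k σ = 2 μ_k - σ κ_k`. -/
noncomputable def errorForm (nabla' : AffineOperator n Mbar) (p : Mbar)
    (F : Mbar → Matrix (Fin (n + 1) ⊕ Unit) (Fin (n + 1) ⊕ Unit) ℝ)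
    (r : Mbar → Fin (n + 1) ⊕ Unit → ℝ) (x : Mbar) (k : Fin (n + 1)) : ℝ :=
  2 * F x (.inr ()) (.inr ()) * r x (.inl k)
    + 2 * ∑ i, ∑ l, christoffel nabla' p x i k l * (r x (.inl i) * F x (.inl l) (.inr ()))
    - 2 / ((n : ℝ) + 2) * (∑ l, christoffel nabla' p x l k l) *
        (∑ i, r x (.inl i) * F x (.inl i) (.inr ()) + 1)
    + 2 * ∑ j, r x (.inl j) * coordDeriv p (fun y ↦ F y (.inl j) (.inr ())) x k
    + r x (.inr ()) * coordDeriv p (fun y ↦ F y (.inr ()) (.inr ())) x k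

theorem contMDiffOn_errorForm {nabla' : AffineOperator n Mbar} {p : Mbar}
    {F : Mbar → Matrix (Fin (n + 1) ⊕ Unit) (Fin (n + 1) ⊕ Unit) ℝ}
    {r : Mbar → Fin (n + 1) ⊕ Unit → ℝ}
    (hΓ : ∀ l k j, ContMDiffOn (𝓡∂ (n + 1)) 𝓘(ℝ, ℝ) ∞ (fun x ↦ christoffel nabla' p x l k j)
      (chartAt (EuclideanHalfSpace (n + 1)) p).source)
    (hF : ∀ a b, ContMDiffOn (𝓡∂ (n + 1)) 𝓘(ℝ, ℝ) ∞ (fun x ↦ F x a b)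
      (chartAt (EuclideanHalfSpace (n + 1)) p).source)
    (hr : ∀ a, ContMDiffOn (𝓡∂ (n + 1)) 𝓘(ℝ, ℝ) ∞ (fun x ↦ r x a)
      (chartAt (EuclideanHalfSpace (n + 1)) p).source) (k : Fin (n + 1)) :
    ContMDiffOn (𝓡∂ (n + 1)) 𝓘(ℝ, ℝ) ∞ (fun x ↦ errorForm nabla' p F r x k)
      (chartAt (EuclideanHalfSpace (n + 1)) p).source :=
  (((((contMDiffOn_const.mul (hF _ _)).mul (hr _)).add
    (contMDiffOn_const.mul (contMDiffOn_finsetSum fun i _ ↦ contMDiffOn_finsetSum fun l _ ↦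
      (hΓ i k l).mul ((hr _).mul (hF _ _))))).sub
    ((contMDiffOn_const.mul (contMDiffOn_finsetSum fun l _ ↦ hΓ l k l)).mul
      ((contMDiffOn_finsetSum fun i _ ↦ (hr (.inl i)).mul (hF (.inl i) (.inr ()))).add
        contMDiffOn_const))).add
    (contMDiffOn_const.mul (contMDiffOn_finsetSum fun j _ ↦
      (hr (.inl j)).mul ((hF (.inl j) (.inr ())).coordDeriv k)))).add
    ((hr _).mul ((hF _ _).coordDeriv k))

/-- If the block `h` of `F` satisfies the metricity equation, then `∇_k σ = 2 μ_k - σ κ_k`. In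
`∂_k σ = -(r ∂_k F rᵀ)` the connection terms of `∂_k h` become divisible by `σ` because
`h^{ij} μ_j = -σ λ^i`, and its terms `δ_k^i λ^j` contribute `2 μ_k λ^i μ_i = 2 μ_k (1 - σ ν)`. -/
theorem coordDeriv_add_eq_errorForm {nabla' : AffineOperator n Mbar} {p x : Mbar} {U : Set Mbar}
    (hU : IsOpen U) (hx : x ∈ U)
    {F : Mbar → Matrix (Fin (n + 1) ⊕ Unit) (Fin (n + 1) ⊕ Unit) ℝ}
    {r : Mbar → Fin (n + 1) ⊕ Unit → ℝ}
    (hF : ∀ a b, MDifferentiableAt (𝓡∂ (n + 1)) 𝓘(ℝ, ℝ) (fun y ↦ F y a b) x)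
    (hr : ∀ a, MDifferentiableAt (𝓡∂ (n + 1)) 𝓘(ℝ, ℝ) (fun y ↦ r y a) x)
    (hrF : ∀ y ∈ U, ∀ b, ∑ a, r y a * F y a b = if .inr () = b then 1 else 0)
    (hsymm : ∀ y ∈ U, ∀ a b, F y a b = F y b a) (k : Fin (n + 1))
    (hmetr : ∀ i j, coordDeriv p (fun y ↦ F y (.inl i) (.inl j)) x k =
      2 / ((n : ℝ) + 2) * (∑ l, christoffel nabla' p x l k l) * F x (.inl i) (.inl j)
        - ∑ l, christoffel nabla' p x i k l * F x (.inl l) (.inl j)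
        - ∑ l, christoffel nabla' p x j k l * F x (.inl i) (.inl l)
        - (if k = i then 1 else 0) * F x (.inl j) (.inr ())
        - (if k = j then 1 else 0) * F x (.inl i) (.inr ())) :
    coordDeriv p (fun y ↦ r y (.inr ())) x k
        + 2 / ((n : ℝ) + 2) * (∑ l, christoffel nabla' p x l k l) * r x (.inr ()) =
      2 * r x (.inl k) - r x (.inr ()) * errorForm nabla' p F r x k := by
  have hd : ∀ j, coordDeriv p (fun y ↦ F y (.inr ()) (.inl j)) x k =
      coordDeriv p (fun y ↦ F y (.inl j) (.inr ())) x k := fun j ↦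
    coordDeriv_congr_of_eqOn hU hx (fun y hy ↦ hsymm y hy _ _) k
  have hrow : ∀ j, ∑ i, r x (.inl i) * F x (.inl i) (.inl j) =
      -(r x (.inr ()) * F x (.inl j) (.inr ())) := fun j ↦ by
    have := hrF x hx (.inl j)
    simp only [Fintype.sum_sum_type, Finset.univ_unique, Finset.sum_singleton, reduceCtorEq,
      if_false, hsymm x hx (.inr default)] at this
    exact eq_neg_of_add_eq_zero_left this
  have hrow' : ∀ i, ∑ j, r x (.inl j) * F x (.inl i) (.inl j) =
      -(r x (.inr ()) * F x (.inl i) (.inr ())) := fun i ↦ by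
    simpa only [hsymm x hx (.inl i) (.inl _)] using hrow i
  have hcor : ∑ i, r x (.inl i) * F x (.inl i) (.inr ()) =
      1 - r x (.inr ()) * F x (.inr ()) (.inr ()) := by
    have := hrF x hx (.inr ())
    simp only [Fintype.sum_sum_type, Finset.univ_unique, Finset.sum_singleton, if_true] at this
    exact eq_sub_of_add_eq this
  have hquad : ∑ i, ∑ j, r x (.inl i) * r x (.inl j) *
      coordDeriv p (fun y ↦ F y (.inl i) (.inl j)) x k =
      -(r x (.inr ()) * (2 / ((n : ℝ) + 2) * (∑ l, christoffel nabla' p x l k l) *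
          ∑ i, r x (.inl i) * F x (.inl i) (.inr ())))
        + 2 * (r x (.inr ()) *
          ∑ i, ∑ l, christoffel nabla' p x i k l * (r x (.inl i) * F x (.inl l) (.inr ())))
        - 2 * r x (.inl k) * ∑ i, r x (.inl i) * F x (.inl i) (.inr ()) := by
    have t1 : ∀ c : ℝ, ∑ i, ∑ j, r x (.inl i) * r x (.inl j) * (c * F x (.inl i) (.inl j)) =
        -(r x (.inr ()) * (c * ∑ i, r x (.inl i) * F x (.inl i) (.inr ()))) := fun c ↦ by
      have : ∀ i, ∑ j, r x (.inl i) * r x (.inl j) * (c * F x (.inl i) (.inl j)) =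
          r x (.inl i) * c * ∑ j, r x (.inl j) * F x (.inl i) (.inl j) := fun i ↦ by
        rw [Finset.mul_sum]; exact Finset.sum_congr rfl fun j _ ↦ by ring
      simp only [this, hrow', Finset.mul_sum, ← Finset.sum_neg_distrib]
      exact Finset.sum_congr rfl fun j _ ↦ by ring
    have t2 : ∑ i, ∑ j, r x (.inl i) * r x (.inl j) *
        (∑ l, christoffel nabla' p x i k l * F x (.inl l) (.inl j)) = -(r x (.inr ()) *
          ∑ i, ∑ l, christoffel nabla' p x i k l * (r x (.inl i) * F x (.inl l) (.inr ()))) := by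
      rw [Finset.mul_sum, ← Finset.sum_neg_distrib]
      refine Finset.sum_congr rfl fun i _ ↦ ?_
      simp only [Finset.mul_sum, ← Finset.sum_neg_distrib]
      rw [Finset.sum_comm]
      refine Finset.sum_congr rfl fun l _ ↦ ?_
      have : ∑ j, r x (.inl i) * r x (.inl j) *
          (christoffel nabla' p x i k l * F x (.inl l) (.inl j)) =
          r x (.inl i) * christoffel nabla' p x i k l *
            ∑ j, r x (.inl j) * F x (.inl l) (.inl j) := by
        rw [Finset.mul_sum]; exact Finset.sum_congr rfl fun j _ ↦ by ring
      rw [this, hrow']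
      ring
    have t3 : ∑ i, ∑ j, r x (.inl i) * r x (.inl j) *
        (∑ l, christoffel nabla' p x j k l * F x (.inl i) (.inl l)) = -(r x (.inr ()) *
          ∑ i, ∑ l, christoffel nabla' p x i k l * (r x (.inl i) * F x (.inl l) (.inr ()))) := by
      rw [← t2, Finset.sum_comm]
      refine Finset.sum_congr rfl fun i _ ↦ Finset.sum_congr rfl fun j _ ↦ ?_
      simp only [hsymm x hx (.inl j)]
      ring
    have t4 : ∑ i, ∑ j, r x (.inl i) * r x (.inl j) *
        ((if k = i then 1 else 0) * F x (.inl j) (.inr ())) =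
        r x (.inl k) * ∑ i, r x (.inl i) * F x (.inl i) (.inr ()) := by
      rw [Finset.sum_comm]
      simp [Finset.mul_sum, mul_assoc]
    have t5 : ∑ i, ∑ j, r x (.inl i) * r x (.inl j) *
        ((if k = j then 1 else 0) * F x (.inl i) (.inr ())) =
        r x (.inl k) * ∑ i, r x (.inl i) * F x (.inl i) (.inr ()) := by
      rw [← t4, Finset.sum_comm]
      exact Finset.sum_congr rfl fun i _ ↦ Finset.sum_congr rfl fun j _ ↦ by ring
    simp only [hmetr, mul_sub, Finset.sum_sub_distrib]
    rw [t1, t2, t3, t4, t5]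
    ring
  have hmain := coordDeriv_inv_row (p := p) hU hx (.inr ()) hF hr hrF (hsymm x hx) k
  simp only [Fintype.sum_sum_type, Finset.univ_unique, Finset.sum_singleton, PUnit.default_eq_unit,
    Finset.sum_add_distrib, hd] at hmain
  rw [hquad] at hmain
  have e1 : ∑ i, r x (.inl i) * r x (.inr ()) *
      coordDeriv p (fun y ↦ F y (.inl i) (.inr ())) x k =
      r x (.inr ()) * ∑ j, r x (.inl j) * coordDeriv p (fun y ↦ F y (.inl j) (.inr ())) x k := by
    rw [Finset.mul_sum]; exact Finset.sum_congr rfl fun j _ ↦ by ring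
  have e2 : ∑ i, r x (.inr ()) * r x (.inl i) *
      coordDeriv p (fun y ↦ F y (.inl i) (.inr ())) x k =
      r x (.inr ()) * ∑ j, r x (.inl j) * coordDeriv p (fun y ↦ F y (.inl j) (.inr ())) x k := by
    rw [Finset.mul_sum]; exact Finset.sum_congr rfl fun j _ ↦ by ring
  rw [e1, e2] at hmain
  rw [hmain, errorForm, hcor]
  ring

end InverseDerivative

/-! ### Changes of frame -/

section FrameChange

variable {n : ℕ} {Mbar : Type*} [TopologicalSpace Mbar]
  [ChartedSpace (EuclideanHalfSpace (n + 1)) Mbar]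

theorem sum_fin_one_fun {ι M : Type*} [Fintype ι] [AddCommMonoid M] (f : (Fin 1 → ι) → M) :
    ∑ K, f K = ∑ i, f ![i] :=
  Fintype.sum_equiv (Equiv.funUnique (Fin 1) ι) _ _ fun K ↦
    congrArg f (funext fun a ↦ by rw [Subsingleton.elim a 0]; rfl)

theorem sum_fin_two_fun {ι M : Type*} [Fintype ι] [AddCommMonoid M] (f : (Fin 2 → ι) → M) :
    ∑ K, f K = ∑ i, ∑ j, f ![i, j] := by
  rw [← Fintype.sum_prod_type']
  exact Fintype.sum_equiv (finTwoArrowEquiv ι) _ _ fun K ↦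
    congrArg f (funext fun a ↦ by fin_cases a <;> rfl)

namespace WeightedTensorField

variable {w : ℝ} {x : Mbar} {v : Fin (n + 1) → TangentSpace (𝓡∂ (n + 1)) x}
  {A : Matrix (Fin (n + 1)) (Fin (n + 1)) ℝ}

theorem toFun_scalar (T : WeightedTensorField n Mbar w 0 0) (hv : LinearIndependent ℝ v)
    (hA : A.det ≠ 0) : T.toFun x (fun j ↦ ∑ i, A i j • v i) ![] ![] =
      |A.det| ^ (-w / ((n : ℝ) + 2)) * T.toFun x v ![] ![] := by
  rw [T.equivariant x v hv A hA]
  simp [Subsingleton.elim default ![]]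

theorem toFun_covector (T : WeightedTensorField n Mbar w 0 1) (hv : LinearIndependent ℝ v)
    (hA : A.det ≠ 0) (k : Fin (n + 1)) : T.toFun x (fun j ↦ ∑ i, A i j • v i) ![] ![k] =
      |A.det| ^ (-w / ((n : ℝ) + 2)) * ∑ i, A i k * T.toFun x v ![] ![i] := by
  rw [T.equivariant x v hv A hA]
  simp [sum_fin_one_fun, Subsingleton.elim default ![]]

theorem toFun_bilinear (T : WeightedTensorField n Mbar w 0 2) (hv : LinearIndependent ℝ v)
    (hA : A.det ≠ 0) (k l : Fin (n + 1)) : T.toFun x (fun j ↦ ∑ i, A i j • v i) ![] ![k, l] =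
      |A.det| ^ (-w / ((n : ℝ) + 2)) * ∑ i, ∑ j, A i k * A j l * T.toFun x v ![] ![i, j] := by
  rw [T.equivariant x v hv A hA]
  simp [sum_fin_two_fun, Subsingleton.elim default ![]]

end WeightedTensorField

/-- The matrix, in the frame `v`, of the symmetric form with slots `(σ, μ, ψ)` on tractors. -/
noncomputable def cotractorMatrix (σ : WeightedTensorField n Mbar 2 0 0)
    (μ : WeightedTensorField n Mbar 2 0 1)
    (ψ : WeightedTensorField n Mbar 2 0 2) (x : Mbar)
    (v : Fin (n + 1) → TangentSpace (𝓡∂ (n + 1)) x) :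
    Matrix (Fin (n + 1) ⊕ Unit) (Fin (n + 1) ⊕ Unit) ℝ :=
  tractorMatrix (fun i j ↦ ψ.toFun x v ![] ![i, j]) (fun i ↦ μ.toFun x v ![] ![i])
    (σ.toFun x v ![] ![])

variable {σ : WeightedTensorField n Mbar 2 0 0} {μ : WeightedTensorField n Mbar 2 0 1}
    {ψ : WeightedTensorField n Mbar 2 0 2}

/-- A change of frame by `A` acts on tractors by the block matrix `diag(A, 1)`. -/
theorem cotractorMatrix_frame {x : Mbar} {v : Fin (n + 1) → TangentSpace (𝓡∂ (n + 1)) x}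
    (hv : LinearIndependent ℝ v) {A : Matrix (Fin (n + 1)) (Fin (n + 1)) ℝ} (hA : A.det ≠ 0) :
    cotractorMatrix σ μ ψ x (fun j ↦ ∑ i, A i j • v i) =
      (|A.det| ^ (-(2 : ℝ) / ((n : ℝ) + 2))) •
        ((Matrix.fromBlocks A 0 0 (1 : Matrix Unit Unit ℝ)).transpose *
          cotractorMatrix σ μ ψ x v * Matrix.fromBlocks A 0 0 (1 : Matrix Unit Unit ℝ)) := by
  simp only [cotractorMatrix, tractorMatrix, Matrix.fromBlocks_transpose,
    Matrix.fromBlocks_multiply, Matrix.fromBlocks_smul, σ.toFun_scalar hv hA,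
    μ.toFun_covector hv hA, ψ.toFun_bilinear hv hA]
  congr 1
  · ext i j
    simp only [Matrix.of_apply, Matrix.smul_apply, smul_eq_mul, Matrix.add_apply, Matrix.mul_apply,
      Matrix.transpose_apply, Matrix.transpose_zero, Matrix.zero_apply, zero_mul, mul_zero,
      Finset.sum_const_zero, add_zero, Finset.sum_mul]
    rw [Finset.sum_comm]
    congr 1
    exact Finset.sum_congr rfl fun _ _ ↦ Finset.sum_congr rfl fun _ _ ↦ by ring
  · ext i j
    simp [Matrix.mul_apply]
  · ext i j
    simp [Matrix.mul_apply, mul_comm]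
  · ext i j
    simp

/-- The inverse of a form on tractors has weight `-2` in each slot. -/
theorem cotractorMatrix_inv_frame {x : Mbar} {v : Fin (n + 1) → TangentSpace (𝓡∂ (n + 1)) x}
    (hv : LinearIndependent ℝ v) {A : Matrix (Fin (n + 1)) (Fin (n + 1)) ℝ} (hA : A.det ≠ 0) :
    (cotractorMatrix σ μ ψ x (fun j ↦ ∑ i, A i j • v i))⁻¹ =
      (|A.det| ^ (-(-2 : ℝ) / ((n : ℝ) + 2))) •
        (Matrix.fromBlocks A⁻¹ 0 0 (1 : Matrix Unit Unit ℝ) * (cotractorMatrix σ μ ψ x v)⁻¹ *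
          (Matrix.fromBlocks A⁻¹ 0 0 (1 : Matrix Unit Unit ℝ)).transpose) := by
  have hB : (Matrix.fromBlocks A 0 0 (1 : Matrix Unit Unit ℝ))⁻¹ =
      Matrix.fromBlocks A⁻¹ 0 0 1 := by
    refine Matrix.inv_eq_right_inv ?_
    rw [Matrix.fromBlocks_multiply]
    simp [Matrix.mul_nonsing_inv _ hA.isUnit]
  have hpos : 0 < |A.det| := abs_pos.2 hA
  have hw : |A.det| ^ (-(-2 : ℝ) / ((n : ℝ) + 2)) = (|A.det| ^ (-(2 : ℝ) / ((n : ℝ) + 2)))⁻¹ := by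
    rw [← Real.rpow_neg hpos.le]
    congr 1
    ring
  have hw0 : |A.det| ^ (-(2 : ℝ) / ((n : ℝ) + 2)) ≠ 0 := (Real.rpow_pos_of_pos hpos _).ne'
  have hsmul : ∀ (c : ℝ) (_ : c ≠ 0) (N : Matrix (Fin (n + 1) ⊕ Unit) (Fin (n + 1) ⊕ Unit) ℝ),
      (c • N)⁻¹ = c⁻¹ • N⁻¹ := fun c hc N ↦ by
    have : c • N = (c • (1 : Matrix (Fin (n + 1) ⊕ Unit) (Fin (n + 1) ⊕ Unit) ℝ)) * N := by simp
    rw [this, Matrix.mul_inv_rev]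
    have h1 : (c • (1 : Matrix (Fin (n + 1) ⊕ Unit) (Fin (n + 1) ⊕ Unit) ℝ))⁻¹ = c⁻¹ • 1 :=
      Matrix.inv_eq_right_inv (by simp [smul_smul, hc])
    rw [h1]
    simp
  rw [cotractorMatrix_frame hv hA, hsmul _ hw0, Matrix.mul_inv_rev, Matrix.mul_inv_rev, hw,
    ← Matrix.transpose_nonsing_inv, hB, ← Matrix.mul_assoc]

theorem cotractorMatrix_inv_frame_mixed {x : Mbar}
    {v : Fin (n + 1) → TangentSpace (𝓡∂ (n + 1)) x}
    (hv : LinearIndependent ℝ v) {A : Matrix (Fin (n + 1)) (Fin (n + 1)) ℝ} (hA : A.det ≠ 0)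
    (i : Fin (n + 1)) :
    (cotractorMatrix σ μ ψ x (fun j ↦ ∑ i, A i j • v i))⁻¹ (.inl i) (.inr ()) =
      |A.det| ^ (-(-2 : ℝ) / ((n : ℝ) + 2)) *
        ∑ j, A⁻¹ i j * (cotractorMatrix σ μ ψ x v)⁻¹ (.inl j) (.inr ()) := by
  rw [cotractorMatrix_inv_frame hv hA]
  simp [Matrix.mul_apply, Matrix.fromBlocks_transpose]

theorem cotractorMatrix_inv_frame_corner {x : Mbar}
    {v : Fin (n + 1) → TangentSpace (𝓡∂ (n + 1)) x}
    (hv : LinearIndependent ℝ v) {A : Matrix (Fin (n + 1)) (Fin (n + 1)) ℝ} (hA : A.det ≠ 0) :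
    (cotractorMatrix σ μ ψ x (fun j ↦ ∑ i, A i j • v i))⁻¹ (.inr ()) (.inr ()) =
      |A.det| ^ (-(-2 : ℝ) / ((n : ℝ) + 2)) *
        (cotractorMatrix σ μ ψ x v)⁻¹ (.inr ()) (.inr ()) := by
  rw [cotractorMatrix_inv_frame hv hA]
  simp [Matrix.mul_apply, Matrix.fromBlocks_transpose]

/-- The tensor field `κ_j λ^i / 2` of weight `-2`, where `κ` is a one-form and `λ` is the middle
slot of the inverse of the form with slots `(σ, μ, ψ)`. -/
noncomputable def mixedErrorField (σ : WeightedTensorField n Mbar 2 0 0)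
    (μ : WeightedTensorField n Mbar 2 0 1)
    (ψ : WeightedTensorField n Mbar 2 0 2)
    (κ : Π x : Mbar, TangentSpace (𝓡∂ (n + 1)) x →ₗ[ℝ] ℝ) :
    WeightedTensorField n Mbar (-2) 1 1 where
  toFun x v K L := 1 / 2 * κ x (v (L 0)) * (cotractorMatrix σ μ ψ x v)⁻¹ (.inl (K 0)) (.inr ())
  equivariant x v hv A hA K L := by
    rw [cotractorMatrix_inv_frame_mixed hv hA]
    simp only [sum_fin_one_fun, map_sum, map_smul, smul_eq_mul, Finset.univ_unique,
      Finset.prod_singleton, Fin.default_eq_zero, Matrix.cons_val_zero]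
    rw [mul_left_comm]
    congr 1
    simp only [Finset.mul_sum, Finset.sum_mul]
    exact Finset.sum_congr rfl fun i _ ↦ Finset.sum_congr rfl fun j _ ↦ by ring

/-- The one-form `ν κ_i` of weight `-2`, where `κ` is a one-form and `ν` is the bottom slot of the
inverse of the form with slots `(σ, μ, ψ)`. -/
noncomputable def cornerErrorField (σ : WeightedTensorField n Mbar 2 0 0)
    (μ : WeightedTensorField n Mbar 2 0 1)
    (ψ : WeightedTensorField n Mbar 2 0 2)
    (κ : Π x : Mbar, TangentSpace (𝓡∂ (n + 1)) x →ₗ[ℝ] ℝ) :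
    WeightedTensorField n Mbar (-2) 0 1 where
  toFun x v _ L := κ x (v (L 0)) * (cotractorMatrix σ μ ψ x v)⁻¹ (.inr ()) (.inr ())
  equivariant x v hv A hA K L := by
    rw [cotractorMatrix_inv_frame_corner hv hA]
    simp only [sum_fin_one_fun, map_sum, map_smul, smul_eq_mul, Finset.univ_unique,
      Finset.sum_singleton, Finset.univ_eq_empty, Finset.prod_empty, one_mul,
      Finset.prod_singleton, Fin.default_eq_zero, Matrix.cons_val_zero]
    rw [mul_left_comm, Finset.sum_mul]
    congr 1
    exact Finset.sum_congr rfl fun j _ ↦ by ring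

section Transition

variable [IsManifold (𝓡∂ (n + 1)) ∞ Mbar]

/-- The matrix expressing the coordinate frame around `q` in terms of the one around `p`. -/
noncomputable def transition (p q x : Mbar) : Matrix (Fin (n + 1)) (Fin (n + 1)) ℝ :=
  Matrix.of fun i j ↦ coordComponent p x (coordField q j x) i

theorem coordField_eq_sum_transition {p q x : Mbar}
    (hp : x ∈ (chartAt (EuclideanHalfSpace (n + 1)) p).source) (j : Fin (n + 1)) :
    coordField q j x = ∑ i, transition p q x i j • coordFrame p x i :=
  (sum_coordComponent_smul hp _).symm

theorem coordFrame_eq_sum_transition {p q x : Mbar}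
    (hp : x ∈ (chartAt (EuclideanHalfSpace (n + 1)) p).source) :
    coordFrame (n := n) q x = fun j ↦ ∑ i, transition p q x i j • coordFrame p x i :=
  funext fun j ↦ coordField_eq_sum_transition hp j

theorem transition_mul_transition {p q x : Mbar}
    (hp : x ∈ (chartAt (EuclideanHalfSpace (n + 1)) p).source)
    (hq : x ∈ (chartAt (EuclideanHalfSpace (n + 1)) q).source) :
    transition (n := n) p q x * transition q p x = 1 := by
  ext i j
  have h := congrArg (fun v : TangentSpace (𝓡∂ (n + 1)) x ↦ coordComponent p x v i)
    (coordField_eq_sum_transition (q := p) hq j)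
  simp only [coordComponent_sum, coordComponent_smul, coordComponent_coordField hp,
    coordFrame] at h
  rw [Matrix.mul_apply, Matrix.one_apply, h]
  exact Finset.sum_congr rfl fun k _ ↦ mul_comm _ _

theorem transition_det_ne_zero {p q x : Mbar}
    (hp : x ∈ (chartAt (EuclideanHalfSpace (n + 1)) p).source)
    (hq : x ∈ (chartAt (EuclideanHalfSpace (n + 1)) q).source) :
    (transition (n := n) p q x).det ≠ 0 := by
  intro h
  have := congrArg Matrix.det (transition_mul_transition hp hq)
  simp [h] at this

theorem contMDiffOn_transition (p q : Mbar) (i j : Fin (n + 1)) :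
    ContMDiffOn (𝓡∂ (n + 1)) 𝓘(ℝ, ℝ) ∞ (fun x ↦ transition p q x i j)
      ((chartAt (EuclideanHalfSpace (n + 1)) p).source ∩
        (chartAt (EuclideanHalfSpace (n + 1)) q).source) :=
  ((contMDiffOn_coordField q j).mono inter_subset_right).coordComponent inter_subset_left i

theorem tau_frame {s : Set Mbar} (g : PseudoRiemannianMetricOn (n := n) s) (x : Mbar)
    (v : Fin (n + 1) → TangentSpace (𝓡∂ (n + 1)) x)
    {A : Matrix (Fin (n + 1)) (Fin (n + 1)) ℝ} :
    g.tau x (fun j ↦ ∑ i, A i j • v i) =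
      |A.det| ^ (-(2 : ℝ) / ((n : ℝ) + 2)) * g.tau x v := by
  have hG : g.gram x (fun j ↦ ∑ i, A i j • v i) = A.transpose * g.gram x v * A := by
    ext i j
    simp only [PseudoRiemannianMetricOn.gram, Matrix.of_apply, Matrix.mul_apply,
      Matrix.transpose_apply, map_sum, map_smul, sum_apply, smul_apply, smul_eq_mul, Finset.sum_mul,
      Finset.mul_sum]
    exact Finset.sum_congr rfl fun _ _ ↦ Finset.sum_congr rfl fun _ _ ↦ by ring
  have hdet : |(g.gram x (fun j ↦ ∑ i, A i j • v i)).det| =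
      |A.det| ^ 2 * |(g.gram x v).det| := by
    rw [hG, Matrix.det_mul, Matrix.det_mul, Matrix.det_transpose, abs_mul, abs_mul]
    ring
  rw [PseudoRiemannianMetricOn.tau, PseudoRiemannianMetricOn.tau, PseudoRiemannianMetricOn.vol,
    PseudoRiemannianMetricOn.vol, hdet, Real.sqrt_mul (sq_nonneg _), Real.sqrt_sq (abs_nonneg _),
    Real.mul_rpow (abs_nonneg _) (Real.sqrt_nonneg _)]

/-- The one-form whose components at `x` in the preferred chart around `x` are `κ x x`. -/
noncomputable def oneFormOfComponents (κ : Mbar → Mbar → Fin (n + 1) → ℝ) (x : Mbar) :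
    TangentSpace (𝓡∂ (n + 1)) x →ₗ[ℝ] ℝ where
  toFun v := ∑ i, κ x x i * coordComponent x x v i
  map_add' v w := by simp only [coordComponent_add, mul_add, Finset.sum_add_distrib]
  map_smul' c v := by
    simp only [coordComponent_smul, Finset.mul_sum, RingHom.id_apply, smul_eq_mul]
    exact Finset.sum_congr rfl fun _ _ ↦ by ring

/-- Continuous components that obey the transformation rule of one-forms in the interior do so up
to the boundary. -/
theorem oneFormOfComponents_coordField {κ : Mbar → Mbar → Fin (n + 1) → ℝ}
    (hc : ∀ p i, ContinuousOn (fun x ↦ κ p x i) (chartAt (EuclideanHalfSpace (n + 1)) p).source)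
    (hint : ∀ p q, ∀ x ∈ (chartAt (EuclideanHalfSpace (n + 1)) p).source ∩
        (chartAt (EuclideanHalfSpace (n + 1)) q).source ∩ (𝓡∂ (n + 1)).interior Mbar, ∀ i,
      κ p x i = ∑ j, κ q x j * transition q p x j i) {p x : Mbar}
    (hx : x ∈ (chartAt (EuclideanHalfSpace (n + 1)) p).source) (i : Fin (n + 1)) :
    oneFormOfComponents κ x (coordField p i x) = κ p x i := by
  set S := (chartAt (EuclideanHalfSpace (n + 1)) p).source ∩
    (chartAt (EuclideanHalfSpace (n + 1)) x).source
  have hS : IsOpen S := (chartAt (EuclideanHalfSpace (n + 1)) p).open_source.inter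
    (chartAt (EuclideanHalfSpace (n + 1)) x).open_source
  have h1 : ContinuousOn (fun y ↦ ∑ j, κ x y j * transition x p y j i) S :=
    continuousOn_finsetSum _ fun j _ ↦ ((hc x j).mono inter_subset_right).mul
      ((contMDiffOn_transition x p j i).continuousOn.mono (inter_comm _ _).le)
  have h2 : ContinuousOn (fun y ↦ κ p y i) S := (hc p i).mono inter_subset_left
  have heq : EqOn (fun y ↦ ∑ j, κ x y j * transition x p y j i) (fun y ↦ κ p y i) S := by
    refine EqOn.of_subset_closure (s := S ∩ (𝓡∂ (n + 1)).interior Mbar)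
      (fun y hy ↦ (hint p x y hy i).symm) h1 h2 inter_subset_left ?_
    exact dense_interior.open_subset_closure_inter hS
  exact heq ⟨hx, mem_chart_source _ x⟩

end Transition

end FrameChange

/-! ### Tensoriality of the error form -/

section Density

variable {n : ℕ} {Mbar : Type*} [TopologicalSpace Mbar]
  [ChartedSpace (EuclideanHalfSpace (n + 1)) Mbar] [IsManifold (𝓡∂ (n + 1)) ∞ Mbar]
  {g : PseudoRiemannianMetricOn (n := n) ((𝓡∂ (n + 1)).interior Mbar)}

/-- The function `σ / τ` in the interior. -/
noncomputable def densityQuotient (σ : WeightedTensorField n Mbar 2 0 0)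
    (g : PseudoRiemannianMetricOn (n := n) ((𝓡∂ (n + 1)).interior Mbar)) (x : Mbar) : ℝ :=
  σ.toFun x (coordFrame x x) ![] ![] / g.tau x (coordFrame x x)

/-- The quotient `σ / τ` of densities of equal weight does not depend on the frame. -/
theorem tau_mul_densityQuotient (σ : WeightedTensorField n Mbar 2 0 0) {p x : Mbar}
    (hx : x ∈ (chartAt (EuclideanHalfSpace (n + 1)) p).source ∩ (𝓡∂ (n + 1)).interior Mbar) :
    g.tau x (coordFrame p x) * densityQuotient σ g x = σ.inChart p x ![] ![] := by
  have hxx := mem_chart_source (EuclideanHalfSpace (n + 1)) x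
  have ht := (tau_pos (g := g) hx.2 (linearIndependent_coordFrame (n := n) hxx)).ne'
  rw [WeightedTensorField.inChart, coordFrame_eq_sum_transition (q := p) hxx, tau_frame,
    σ.toFun_scalar (linearIndependent_coordFrame hxx) (transition_det_ne_zero hxx hx.1),
    densityQuotient]
  field_simp

/-- Since `∇ τ = 0` and `∇'` differs from `∇` on `E(2)` by `2 Υ`,
`∇'_k σ = τ ∂_k (σ / τ) + 2 Υ_k σ` in the interior. -/
theorem coordDeriv_density {nabla nabla' : AffineOperator n Mbar} (hnabla : IsLeviCivitaOn g nabla)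
    {Υ : Π x : Mbar, TangentSpace (𝓡∂ (n + 1)) x →L[ℝ] ℝ}
    (hΥ : ∀ x ∈ (𝓡∂ (n + 1)).interior Mbar, ∀ Y : Π y : Mbar, TangentSpace (𝓡∂ (n + 1)) y,
      FieldDifferentiableAt Y x → ∀ v : TangentSpace (𝓡∂ (n + 1)) x,
        nabla' Y x v = nabla Y x v + Υ x v • Y x + Υ x (Y x) • v)
    {σ : WeightedTensorField n Mbar 2 0 0} {p x : Mbar}
    (hσ : ContMDiffOn (𝓡∂ (n + 1)) 𝓘(ℝ, ℝ) ∞ (fun y ↦ σ.inChart p y ![] ![])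
      (chartAt (EuclideanHalfSpace (n + 1)) p).source)
    (hx : x ∈ (chartAt (EuclideanHalfSpace (n + 1)) p).source ∩ (𝓡∂ (n + 1)).interior Mbar)
    (k : Fin (n + 1)) :
    coordDeriv p (fun y ↦ σ.inChart p y ![] ![]) x k
        + 2 / ((n : ℝ) + 2) * (∑ l, christoffel nabla' p x l k l) * σ.inChart p x ![] ![] =
      g.tau x (coordFrame p x) *
          mvfderiv (𝓡∂ (n + 1)) (densityQuotient σ g) x (coordField p k x)
        + 2 * σ.inChart p x ![] ![] * Υ x (coordField p k x) := by
  have hU := isOpen_source_inter_interior (n := n) p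
  have hpos : ∀ y ∈ (chartAt (EuclideanHalfSpace (n + 1)) p).source ∩
      (𝓡∂ (n + 1)).interior Mbar, g.tau y (coordFrame p y) ≠ 0 := fun y hy ↦
    (tau_pos hy.2 (linearIndependent_coordFrame (n := n) hy.1)).ne'
  have hτ := contMDiffOn_tau (g := g) p
  have hs : ContMDiffOn (𝓡∂ (n + 1)) 𝓘(ℝ, ℝ) ∞ (densityQuotient σ g)
      ((chartAt (EuclideanHalfSpace (n + 1)) p).source ∩ (𝓡∂ (n + 1)).interior Mbar) := by
    refine ((hτ.inv₀ hpos).mul (hσ.mono inter_subset_left)).congr fun y hy ↦ ?_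
    simp only [Pi.mul_apply]
    rw [← tau_mul_densityQuotient (g := g) σ hy, inv_mul_cancel_left₀ (hpos y hy)]
  have hsd := (hs.contMDiffAt (hU.mem_nhds hx)).mdifferentiableAt (by simp)
  have hτd := (hτ.contMDiffAt (hU.mem_nhds hx)).mdifferentiableAt (by simp)
  rw [← coordDeriv_congr_of_eqOn hU hx (fun y hy ↦ tau_mul_densityQuotient (g := g) σ hy) k,
    coordDeriv_mul hτd hsd, coordDeriv_tau hnabla hx, sum_christoffel_projectiveChange hΥ hx,
    ← tau_mul_densityQuotient (g := g) σ hx]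
  have : mvfderiv (𝓡∂ (n + 1)) (densityQuotient σ g) x (coordField p k x) =
    coordDeriv p (densityQuotient σ g) x k := rfl
  rw [this]
  field_simp
  ring

/-- In the interior `σ` has no zeros: if `σ = 0` then `h^{ij} μ_i = 0`, so `μ = 0` because `h` is
invertible there, which contradicts `μ_i λ^i + σ ν = 1`. -/
theorem row_corner_ne_zero {p x : Mbar}
    (hx : x ∈ (chartAt (EuclideanHalfSpace (n + 1)) p).source ∩ (𝓡∂ (n + 1)).interior Mbar)
    {F : Matrix (Fin (n + 1) ⊕ Unit) (Fin (n + 1) ⊕ Unit) ℝ}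
    (hF : ∀ i j, F (.inl i) (.inl j) = g.tauInvMetric p x ![i, j] ![])
    {r : Fin (n + 1) ⊕ Unit → ℝ}
    (hrF : ∀ b, ∑ a, r a * F a b = if .inr () = b then 1 else 0) : r (.inr ()) ≠ 0 := by
  intro h
  have hli := linearIndependent_coordFrame (n := n) hx.1
  have ht := (tau_pos (g := g) hx.2 hli).ne'
  have hG := gram_det_ne_zero g hx.2 hli
  have hμ : (fun i ↦ r (.inl i)) = 0 := by
    refine Matrix.eq_zero_of_vecMul_eq_zero (M := (g.gram x (coordFrame p x))⁻¹) ?_ ?_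
    · exact ((Matrix.isUnit_nonsing_inv_det_iff).2 hG.isUnit).ne_zero
    · ext j
      have := hrF (.inl j)
      simp only [Fintype.sum_sum_type, Finset.univ_unique, Finset.sum_singleton, reduceCtorEq,
        if_false, PUnit.default_eq_unit, h, zero_mul, add_zero, hF,
        PseudoRiemannianMetricOn.tauInvMetric, Matrix.cons_val_zero, Matrix.cons_val_one,
        mul_left_comm _ (g.tau x (coordFrame p x))⁻¹, ← Finset.mul_sum, mul_eq_zero,
        inv_eq_zero, ht, false_or] at this
      exact this
  have := hrF (.inr ())
  simp only [Fintype.sum_sum_type, Finset.univ_unique, if_true,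
    PUnit.default_eq_unit, h, zero_mul, add_zero, fun i ↦ congrFun hμ i, Pi.zero_apply,
    Finset.sum_const_zero, zero_ne_one] at this

/-- In the interior, `2 μ_k - ∇_k σ = σ κ_k` and `∇_k σ = σ (d(σ/τ) / (σ/τ) + 2 Υ)_k` show that the
components `κ_k` transform like those of a one-form. -/
theorem errorForm_transition {nabla nabla' : AffineOperator n Mbar}
    (hnabla : IsLeviCivitaOn g nabla)
    (hproj : ProjectivelyEquivalentOn nabla nabla' ((𝓡∂ (n + 1)).interior Mbar))
    {σ : WeightedTensorField n Mbar 2 0 0} {μ : WeightedTensorField n Mbar 2 0 1}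
    (hσ : σ.IsSmooth) {κ : Mbar → Mbar → Fin (n + 1) → ℝ}
    (hne : ∀ p, ∀ x ∈ (chartAt (EuclideanHalfSpace (n + 1)) p).source ∩
      (𝓡∂ (n + 1)).interior Mbar, σ.inChart p x ![] ![] ≠ 0)
    (hκ : ∀ p, ∀ x ∈ (chartAt (EuclideanHalfSpace (n + 1)) p).source ∩
      (𝓡∂ (n + 1)).interior Mbar, ∀ k, coordDeriv p (fun y ↦ σ.inChart p y ![] ![]) x k
        + 2 / ((n : ℝ) + 2) * (∑ l, christoffel nabla' p x l k l) * σ.inChart p x ![] ![] =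
      2 * μ.inChart p x ![] ![k] - σ.inChart p x ![] ![] * κ p x k)
    {p q x : Mbar}
    (hx : x ∈ (chartAt (EuclideanHalfSpace (n + 1)) p).source ∩
        (chartAt (EuclideanHalfSpace (n + 1)) q).source ∩ (𝓡∂ (n + 1)).interior Mbar)
    (i : Fin (n + 1)) : κ p x i = ∑ j, κ q x j * transition q p x j i := by
  obtain ⟨Υ, -, hΥ⟩ := hproj
  have key : ∀ p, x ∈ (chartAt (EuclideanHalfSpace (n + 1)) p).source → ∀ k,
      κ p x k = 2 * (μ.inChart p x ![] ![k] / σ.inChart p x ![] ![])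
        - ((densityQuotient σ g x)⁻¹ • mvfderiv (𝓡∂ (n + 1)) (densityQuotient σ g) x
          + (2 : ℝ) • Υ x) (coordField p k x) := fun p hp k ↦ by
    have h1 := hκ p x ⟨hp, hx.2⟩ k
    rw [coordDeriv_density hnabla hΥ (hσ p _ _) ⟨hp, hx.2⟩] at h1
    have h0 := hne p x ⟨hp, hx.2⟩
    rw [← tau_mul_densityQuotient (g := g) σ ⟨hp, hx.2⟩] at h0 h1 ⊢
    simp only [add_apply, smul_apply, smul_eq_mul]
    obtain ⟨h2, h3⟩ := mul_ne_zero_iff.1 h0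
    field_simp
    linear_combination h1
  have hpq := transition_det_ne_zero hx.1.2 hx.1.1
  have hli := linearIndependent_coordFrame (n := n) hx.1.2
  have hw := (Real.rpow_pos_of_pos (abs_pos.2 hpq) (-(2 : ℝ) / ((n : ℝ) + 2))).ne'
  have h0 := hne q x ⟨hx.1.2, hx.2⟩
  simp only [key p hx.1.1, key q hx.1.2, sub_mul, Finset.sum_sub_distrib]
  congr 1
  · simp only [WeightedTensorField.inChart] at h0 ⊢
    rw [coordFrame_eq_sum_transition (q := p) hx.1.2, σ.toFun_scalar hli hpq,
      μ.toFun_covector hli hpq, mul_div_mul_left _ _ hw, Finset.sum_div, Finset.mul_sum]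
    exact Finset.sum_congr rfl fun j _ ↦ by ring
  · rw [coordField_eq_sum_transition hx.1.2, map_sum]
    exact Finset.sum_congr rfl fun j _ ↦ by rw [map_smul, smul_eq_mul, mul_comm]; rfl

end Density

end

/-! ### The differential equation for the bottom slot -/

theorem mainTheorem5 (n : ℕ) (hn : 1 ≤ n) (Mbar : Type*) [TopologicalSpace Mbar] [T2Space Mbar]
    [SecondCountableTopology Mbar] [ChartedSpace (EuclideanHalfSpace (n + 1)) Mbar]
    [IsManifold (𝓡∂ (n + 1)) ∞ Mbar]
    (g : PseudoRiemannianMetricOn (n := n) ((𝓡∂ (n + 1)).interior Mbar))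
    (nabla : AffineOperator n Mbar) (hnabla : IsLeviCivitaOn g nabla)
    (nablaTilde : CovariantDerivative (𝓡∂ (n + 1)) (EuclideanSpace ℝ (Fin (n + 1)))
      (TangentSpace (𝓡∂ (n + 1)) : Mbar → Type _))
    (hsmooth : nablaTilde.ContMDiffCovariantDerivative ∞)
    (htorsion : IsTorsionFreeOn nablaTilde.toFun Set.univ)
    (hproj : ProjectivelyEquivalentOn nabla nablaTilde.toFun ((𝓡∂ (n + 1)).interior Mbar))
    (σ : WeightedTensorField n Mbar 2 0 0) (μ : WeightedTensorField n Mbar 2 0 1)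
    (ψ : WeightedTensorField n Mbar 2 0 2)
    (hΦ : ∀ p : Mbar, ∀ x ∈ (chartAt (EuclideanHalfSpace (n + 1)) p).source,
      tractorMatrix (fun i j ↦ ψ.inChart p x ![] ![i, j]) (fun i ↦ μ.inChart p x ![] ![i])
          (σ.inChart p x ![] ![]) *
        g.extendedLiftMatrix nablaTilde.toFun p x = 1) :
    (σ.IsSmooth ∧ μ.IsSmooth ∧ ψ.IsSmooth) ∧
    ∃ (ξ : WeightedTensorField n Mbar (-2) 1 1) (η : WeightedTensorField n Mbar (-2) 0 1),
      ξ.IsSmooth ∧ η.IsSmooth ∧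
      ∀ p : Mbar, ∀ x ∈ (chartAt (EuclideanHalfSpace (n + 1)) p).source, ∀ i : Fin (n + 1),
        covDeriv nablaTilde.toFun p 2 (σ.inChart p) x i ![] ![] =
          2 * μ.inChart p x ![] ![i]
            - 2 * σ.inChart p x ![] ![] *
                ∑ j, μ.inChart p x ![] ![j] * ξ.inChart p x ![j] ![i]
            - σ.inChart p x ![] ![] ^ 2 * η.inChart p x ![] ![i] := by
  have hΓ := fun p ↦ contMDiffOn_christoffel hsmooth p
  set F := g.extendedLiftMatrix nablaTilde.toFun
  have hF : ∀ p a b, ContMDiffOn (𝓡∂ (n + 1)) 𝓘(ℝ, ℝ) ∞ (fun x ↦ F p x a b)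
      (chartAt (EuclideanHalfSpace (n + 1)) p).source := fun p ↦
    (contMDiffOn_extendedLiftMatrix hn hnabla hproj (hΓ p)).1
  have hFint : ∀ p, ∀ x ∈ (chartAt (EuclideanHalfSpace (n + 1)) p).source ∩
      (𝓡∂ (n + 1)).interior Mbar, F p x = g.liftMatrix nablaTilde.toFun p x := fun p ↦
    (contMDiffOn_extendedLiftMatrix hn hnabla hproj (hΓ p)).2
  have hinv : ∀ p, ∀ x ∈ (chartAt (EuclideanHalfSpace (n + 1)) p).source,
      (F p x)⁻¹ = cotractorMatrix σ μ ψ x (coordFrame p x) := fun p x hx ↦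
    Matrix.inv_eq_left_inv (hΦ p x hx)
  have hinv' : ∀ p, ∀ x ∈ (chartAt (EuclideanHalfSpace (n + 1)) p).source,
      (cotractorMatrix σ μ ψ x (coordFrame p x))⁻¹ = F p x := fun p x hx ↦
    Matrix.inv_eq_right_inv (hΦ p x hx)
  have hdet : ∀ p, ∀ x ∈ (chartAt (EuclideanHalfSpace (n + 1)) p).source, (F p x).det ≠ 0 :=
    fun p x hx ↦ (Matrix.isUnit_det_of_left_inverse (hΦ p x hx)).ne_zero
  have hsm : ∀ p a b, ContMDiffOn (𝓡∂ (n + 1)) 𝓘(ℝ, ℝ) ∞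
      (fun x ↦ cotractorMatrix σ μ ψ x (coordFrame p x) a b)
      (chartAt (EuclideanHalfSpace (n + 1)) p).source := fun p a b ↦
    (ContMDiffOn.matrix_inv_apply (hF p) (hdet p) a b).congr fun x hx ↦ by rw [hinv p x hx]
  have hσ : σ.IsSmooth := fun p K L ↦ by
    rw [Subsingleton.elim K ![], Subsingleton.elim L ![]]
    exact hsm p (.inr ()) (.inr ())
  have hμ : μ.IsSmooth := fun p K L ↦ by
    have e : L = ![L 0] := funext fun a ↦ by rw [Subsingleton.elim a 0]; rfl
    rw [Subsingleton.elim K ![], e]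
    exact hsm p (.inl (L 0)) (.inr ())
  have hψ : ψ.IsSmooth := fun p K L ↦ by
    have e : L = ![L 0, L 1] := funext fun a ↦ by fin_cases a <;> rfl
    rw [Subsingleton.elim K ![], e]
    exact hsm p (.inl (L 0)) (.inl (L 1))
  -- The bottom row `(μ, σ)` of the inverse of the lift, in the chart around `p`.
  set r : Mbar → Mbar → Fin (n + 1) ⊕ Unit → ℝ := fun p x a ↦
    cotractorMatrix σ μ ψ x (coordFrame p x) (.inr ()) a
  have hrF : ∀ p, ∀ x ∈ (chartAt (EuclideanHalfSpace (n + 1)) p).source, ∀ b,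
      ∑ a, r p x a * F p x a b = if .inr () = b then 1 else 0 := fun p x hx b ↦ by
    have := congrFun (congrFun (hΦ p x hx) (.inr ())) b
    rwa [Matrix.mul_apply, Matrix.one_apply] at this
  set κ : Mbar → Mbar → Fin (n + 1) → ℝ := fun p ↦
    errorForm nablaTilde.toFun p (F p) (r p)
  have hκ : ∀ p k, ContMDiffOn (𝓡∂ (n + 1)) 𝓘(ℝ, ℝ) ∞ (fun x ↦ κ p x k)
      (chartAt (EuclideanHalfSpace (n + 1)) p).source := fun p k ↦
    contMDiffOn_errorForm (hΓ p) (hF p) (hsm p (.inr ())) k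
  have hint : ∀ p, ∀ x ∈ (chartAt (EuclideanHalfSpace (n + 1)) p).source ∩
      (𝓡∂ (n + 1)).interior Mbar, ∀ k, coordDeriv p (fun y ↦ σ.inChart p y ![] ![]) x k
        + 2 / ((n : ℝ) + 2) * (∑ l, christoffel nablaTilde.toFun p x l k l) *
          σ.inChart p x ![] ![] =
      2 * μ.inChart p x ![] ![k] - σ.inChart p x ![] ![] * κ p x k := by
    intro p x hx k
    have hU := isOpen_source_inter_interior (n := n) p
    have hd : ∀ {f : Mbar → ℝ}, ContMDiffOn (𝓡∂ (n + 1)) 𝓘(ℝ, ℝ) ∞ f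
        (chartAt (EuclideanHalfSpace (n + 1)) p).source →
        MDifferentiableAt (𝓡∂ (n + 1)) 𝓘(ℝ, ℝ) f x := fun h ↦
      (h.contMDiffAt ((chartAt (EuclideanHalfSpace (n + 1)) p).open_source.mem_nhds
        hx.1)).mdifferentiableAt (by simp)
    refine coordDeriv_add_eq_errorForm (F := F p) (r := r p) hU hx (fun a b ↦ hd (hF p a b))
      (fun a ↦ hd (hsm p (.inr ()) a)) (fun y hy ↦ hrF p y hy.1) (fun y hy a b ↦ ?_) k
      fun i j ↦ ?_
    · rw [hFint p y hy]
      rcases a with i | _ <;> rcases b with j | _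
      · exact tauInvMetric_symm p hy.2 i j
      · rfl
      · rfl
      · rfl
    · rw [coordDeriv_congr_of_eqOn hU hx (f' := fun y ↦ g.tauInvMetric p y ![i, j] ![])
        (fun y hy ↦ by rw [hFint p y hy]; rfl), hFint p x hx]
      exact coordDeriv_tauInvMetric_of_projectivelyEquivalentOn hnabla hproj hx k i j
  -- Both sides are continuous on the chart domain, where the interior is dense.
  have hall : ∀ p, ∀ x ∈ (chartAt (EuclideanHalfSpace (n + 1)) p).source, ∀ k,
      coordDeriv p (fun y ↦ σ.inChart p y ![] ![]) x k
        + 2 / ((n : ℝ) + 2) * (∑ l, christoffel nablaTilde.toFun p x l k l) *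
          σ.inChart p x ![] ![] =
      2 * μ.inChart p x ![] ![k] - σ.inChart p x ![] ![] * κ p x k := fun p x hx k ↦
    Set.EqOn.of_subset_closure (fun y hy ↦ hint p y hy k)
      (((hσ p _ _).coordDeriv k).add ((contMDiffOn_const.mul
        (contMDiffOn_finsetSum fun l _ ↦ hΓ p l k l)).mul (hσ p _ _))).continuousOn
      ((contMDiffOn_const.mul (hμ p _ _)).sub ((hσ p _ _).mul (hκ p k))).continuousOn
      Set.inter_subset_left (dense_interior.open_subset_closure_inter
        (chartAt (EuclideanHalfSpace (n + 1)) p).open_source) hx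
  have hform : ∀ p, ∀ x ∈ (chartAt (EuclideanHalfSpace (n + 1)) p).source, ∀ i,
      oneFormOfComponents κ x (coordField p i x) = κ p x i := fun p x hx i ↦
    oneFormOfComponents_coordField (fun p i ↦ (hκ p i).continuousOn) (fun p q x hx i ↦
      errorForm_transition hnabla hproj hσ (fun p x hx ↦
        row_corner_ne_zero (r := r p x) hx (fun i j ↦ by rw [hFint p x hx]; rfl) (hrF p x hx.1))
        hint hx i) hx i
  have hξ : ∀ p, ∀ x ∈ (chartAt (EuclideanHalfSpace (n + 1)) p).source, ∀ K L,
      (mixedErrorField σ μ ψ (oneFormOfComponents κ)).inChart p x K L =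
        1 / 2 * κ p x (L 0) * F p x (.inl (K 0)) (.inr ()) := fun p x hx K L ↦ by
    rw [← hform p x hx, ← hinv' p x hx]
    rfl
  have hη : ∀ p, ∀ x ∈ (chartAt (EuclideanHalfSpace (n + 1)) p).source, ∀ K L,
      (cornerErrorField σ μ ψ (oneFormOfComponents κ)).inChart p x K L =
        κ p x (L 0) * F p x (.inr ()) (.inr ()) := fun p x hx K L ↦ by
    rw [← hform p x hx, ← hinv' p x hx]
    rfl
  refine ⟨⟨hσ, hμ, hψ⟩, mixedErrorField σ μ ψ (oneFormOfComponents κ),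
    cornerErrorField σ μ ψ (oneFormOfComponents κ), fun p K L ↦ ?_, fun p K L ↦ ?_,
    fun p x hx i ↦ ?_⟩
  · exact ((contMDiffOn_const.mul (hκ p _)).mul (hF p _ _)).congr fun x hx ↦ hξ p x hx K L
  · exact ((hκ p _).mul (hF p _ _)).congr fun x hx ↦ hη p x hx K L
  · have hcor := hrF p x hx (.inr ())
    simp only [Fintype.sum_sum_type, Finset.univ_unique, Finset.sum_singleton, if_true,
      PUnit.default_eq_unit] at hcor
    have hcor' : ∑ j, μ.inChart p x ![] ![j] * F p x (.inl j) (.inr ())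
        + σ.inChart p x ![] ![] * F p x (.inr ()) (.inr ()) = 1 := hcor
    have hsum : ∑ j, μ.inChart p x ![] ![j] *
        (mixedErrorField σ μ ψ (oneFormOfComponents κ)).inChart p x ![j] ![i] =
        1 / 2 * κ p x i * ∑ j, μ.inChart p x ![] ![j] * F p x (.inl j) (.inr ()) := by
      rw [Finset.mul_sum]
      refine Finset.sum_congr rfl fun j _ ↦ ?_
      rw [hξ p x hx]
      simp only [Matrix.cons_val_zero]
      ring
    rw [covDeriv_zero_zero, hall p x hx i, hsum, hη p x hx]
    simp only [Matrix.cons_val_zero]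
    linear_combination (σ.inChart p x ![] ![] * κ p x i) * hcor'
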